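/- Let $n\ge 2$. Take finitely many $n$-simplices and identify their facets in pairs by affine maps that carry vertices to vertices (two facets of the same simplex may be paired, no facet is paired with itself), so that the resulting quotient space $M$ is a topological $n$-manifold. A \emph{face} of this triangulation is a class of faces of the simplices under the equivalence relation generated by the identifications; let $\mathcal E$ be the set of its edges. A \emph{polyhedral metric} on $M$ is given by edge lengths $\ell\in\mathbb R^{\mathcal E}$ such that every simplex is realized as a nondegenerate Euclidean $n$-simplex with these edge lengths; the distance in $M$ is the infimum of the lengths of polygonal paths. For a codimension-$2$ face $Q$ let $\mathrm{vol}(Q)$ be its $(n-2)$-dimensional Euclidean volume (equal to $1$ if $n=2$), and let $K_Q$ be $2\pi$ minus the cone angle around $Q$, the cone angle being the sum of the dihedral angles of the simplices at all their faces that represent $Q$. For a constant $a_n\neq 0$ let $$F(\ell)=a_n\sum_Q K_Q\,\mathrm{vol}(Q),$$ the sum being over all codimension-$2$ faces $Q$ of the triangulation (those with $K_Q=0$ contribute nothing). Let $\ell$ be a polyhedral metric. Then: 1. Every $\ell'\in\mathbb R^{\mathcal E}$ sufficiently close to $\ell$ is a polyhedral metric. 2. The functions $\mathrm{vol}(Q)$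 and $F$ of the edge lengths are differentiable at $\ell$, and $$dF = a_n\sum_Q K_Q\, d\,\mathrm{vol}(Q)\quad\text{at }\ell.$$ 3. $\ell$ is a critical point of $F$ (that is, $dF=0$ at $\ell$) if and only if $\sum_Q K_Q\,\frac{\partial\,\mathrm{vol}(Q)}{\partial \ell_e}=0$ at $\ell$ for every edge $e\in\mathcal E$. 4. If $n=3$ and $\ell$ is a critical point of $F$, then the metric is flat, i.e. $M$ with its intrinsic metric is locally isometric to $\mathbb R^3$: every point is the centre of an open ball that is isometric to a Euclidean ball of the same radius. -/

import Mathlib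

open scoped ENNReal Topology

/-- A closed gluing pattern of `n`-simplices.  The simplices are indexed by `T`, the vertices of
each of them by `Fin (n + 1)`, and facet `i` of a simplex is the one opposite to vertex `i`.
Facet `i` of the simplex `t` is identified with facet `perm t i i` of the simplex `nbr t i`, the
vertex `j ≠ i` of `t` being identified with the vertex `perm t i j` of `nbr t i`.
The facets are identified in pairs: the pairing is an involution without fixed facets.
Two facets of one simplex may be paired with each other. -/
structure FacetGluing (T : Type*) (n : ℕ) where
  nbr : T → Fin (n + 1) → T
  perm : T → Fin (n + 1) → Equiv.Perm (Fin (n + 1))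
  nbr_nbr : ∀ t i, nbr (nbr t i) (perm t i i) = t
  perm_perm : ∀ t i, perm (nbr t i) (perm t i i) = (perm t i)⁻¹
  no_fixed_facet : ∀ t i, ¬ (nbr t i = t ∧ perm t i i = i)

namespace FacetGluing

variable {T : Type*} {n : ℕ}

section Combinatorics

/-- `d` is the face of a neighbouring simplex with which the face `c` (given by its simplex and
its set of `m` vertices) is identified through some facet containing it. -/
def FaceStep (G : FacetGluing T n) (m : ℕ)
    (c d : T × {s : Finset (Fin (n + 1)) // s.card = m}) : Prop :=
  ∃ i, i ∉ c.2.1 ∧ d.1 = G.nbr c.1 i ∧ d.2.1 = c.2.1.map (G.perm c.1 i).toEmbedding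

/-- The faces with `m` vertices (that is, of dimension `m - 1`) of the glued space: classes of
faces of simplices under the equivalence relation generated by the facet identifications. -/
def Face (G : FacetGluing T n) (m : ℕ) : Type _ := Quot (G.FaceStep m)

/-- The edges of the triangulation. -/
abbrev Edge (G : FacetGluing T n) : Type _ := G.Face 2

/-- The codimension-`2` faces of the triangulation (for `2 ≤ n`). -/
abbrev Hinge (G : FacetGluing T n) : Type _ := G.Face (n - 1)

noncomputable instance [Finite T] (G : FacetGluing T n) (m : ℕ) : Fintype (G.Face m) :=
  @Fintype.ofFinite _ (inferInstanceAs (Finite (Quot (G.FaceStep m))))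

noncomputable instance (G : FacetGluing T n) (m : ℕ) : DecidableEq (G.Face m) :=
  Classical.decEq _

/-- The edge of the triangulation given by the edge `ij` of the simplex `t`. -/
def edge (G : FacetGluing T n) (t : T) (i j : Fin (n + 1)) (h : i ≠ j) : G.Edge :=
  Quot.mk _ (t, ⟨{i, j}, Finset.card_pair h⟩)

/-- The codimension-`2` face of the triangulation given by the face of the simplex `t` spanned by
all its vertices except `i` and `j`. -/
def hinge (G : FacetGluing T n) (t : T) (i j : Fin (n + 1)) (h : i ≠ j) : G.Hinge :=
  Quot.mk _ (t, ⟨{i, j}ᶜ, by rw [Finset.card_compl, Finset.card_pair h, Fintype.card_fin]; omega⟩)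

end Combinatorics

section Space

/-- The point with barycentric coordinates `x` in the simplex `c.1`, lying on the facet `i`, is
identified with the point of the neighbouring simplex with the corresponding coordinates. -/
def PointStep (G : FacetGluing T n) (c d : Σ _ : T, stdSimplex ℝ (Fin (n + 1))) : Prop :=
  ∃ i, c.2 i = 0 ∧ d = ⟨G.nbr c.1 i, stdSimplex.map (G.perm c.1 i) c.2⟩

/-- The topological space obtained from the disjoint union of the simplices by the gluing, with
the quotient topology. -/
abbrev Space (G : FacetGluing T n) : Type _ := Quot G.PointStep

/-- The point of the glued space with barycentric coordinates `x` in the simplex `t`. -/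
def point (G : FacetGluing T n) (t : T) (x : stdSimplex ℝ (Fin (n + 1))) : G.Space :=
  Quot.mk _ ⟨t, x⟩

/-- The glued space is a topological `n`-manifold: Hausdorff, second countable and locally
homeomorphic to `ℝⁿ`. -/
def IsTopManifold (G : FacetGluing T n) : Prop :=
  T2Space G.Space ∧ SecondCountableTopology G.Space ∧
    ∀ x : G.Space, ∃ φ : OpenPartialHomeomorph G.Space (EuclideanSpace ℝ (Fin n)), x ∈ φ.source

end Space

section Metric

/-- `p` is a nondegenerate Euclidean simplex whose edge lengths are those prescribed by `ℓ` for
the edges of `t`. -/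
def IsPlacement (G : FacetGluing T n) (ℓ : G.Edge → ℝ) (t : T)
    (p : Fin (n + 1) → EuclideanSpace ℝ (Fin n)) : Prop :=
  AffineIndependent ℝ p ∧ ∀ i j, ∀ h : i ≠ j, dist (p i) (p j) = ℓ (G.edge t i j h)

/-- `ℓ` is the system of edge lengths of a polyhedral metric: every simplex of the pattern is
realized as a nondegenerate Euclidean simplex with these edge lengths.  (Facets that are
identified are then isometric, since they have the same edges.) -/
def IsPolyhedralMetric (G : FacetGluing T n) (ℓ : G.Edge → ℝ) : Prop :=
  ∀ t, ∃ p, G.IsPlacement ℓ t p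

open Classical in
/-- The Euclidean simplex with the edge lengths `ℓ` that realizes `t`; it is unique up to
isometry.  (Junk value if there is none.) -/
noncomputable def placement (G : FacetGluing T n) (ℓ : G.Edge → ℝ) (t : T) :
    Fin (n + 1) → EuclideanSpace ℝ (Fin n) :=
  if h : ∃ p, G.IsPlacement ℓ t p then h.choose else 0

/-- The position, in the Euclidean simplex that realizes `t`, of the point with barycentric
coordinates `x`. -/
noncomputable def position (G : FacetGluing T n) (ℓ : G.Edge → ℝ) (t : T)
    (x : stdSimplex ℝ (Fin (n + 1))) : EuclideanSpace ℝ (Fin n) :=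
  ∑ i, x i • G.placement ℓ t i

/-- `IsChain ℓ x y L`: there is a polygonal path of length `L` from `x` to `y`, that is, a finite
sequence of straight segments, each within one simplex, each starting where the previous one
ends in the glued space. -/
inductive IsChain (G : FacetGluing T n) (ℓ : G.Edge → ℝ) : G.Space → G.Space → ℝ≥0∞ → Prop
  | nil (x : G.Space) : IsChain G ℓ x x 0
  | cons (t : T) (u v : stdSimplex ℝ (Fin (n + 1))) (y : G.Space) (L : ℝ≥0∞) :
      IsChain G ℓ (G.point t v) y L →
      IsChain G ℓ (G.point t u) y (edist (G.position ℓ t u) (G.position ℓ t v) + L)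

/-- The intrinsic distance of the polyhedral metric: the infimum of the lengths of polygonal
paths (infinite for points in different components). -/
noncomputable def intrinsicDist (G : FacetGluing T n) (ℓ : G.Edge → ℝ) (x y : G.Space) : ℝ≥0∞ :=
  sInf {L | G.IsChain ℓ x y L}

/-- The polyhedral metric is flat: locally isometric to `ℝⁿ`, that is, every point is the centre
of a ball isometric to a Euclidean ball of the same radius. -/
def IsFlat (G : FacetGluing T n) (ℓ : G.Edge → ℝ) : Prop :=
  ∀ x : G.Space, ∃ r : ℝ≥0∞, 0 < r ∧ r < ∞ ∧ ∃ f : G.Space → EuclideanSpace ℝ (Fin n),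
    Set.BijOn f {y | G.intrinsicDist ℓ x y < r} (Metric.eball (f x) r) ∧
    ∀ y z, G.intrinsicDist ℓ x y < r → G.intrinsicDist ℓ x z < r →
      edist (f y) (f z) = G.intrinsicDist ℓ y z

end Metric

end FacetGluing

/-- The component orthogonal to the face `Q` with vertices `p k`, `k ∉ {i, j}`, of the vector
from a point of `Q` (its centroid, say) to the vertex `p i`. -/
noncomputable def simplexConormal {n : ℕ} (p : Fin (n + 1) → EuclideanSpace ℝ (Fin n))
    (i j : Fin (n + 1)) : EuclideanSpace ℝ (Fin n) :=
  (vectorSpan ℝ (p '' (({i, j}ᶜ : Finset (Fin (n + 1))) : Set (Fin (n + 1)))))ᗮ.starProjection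
    (p i - ({i, j}ᶜ : Finset (Fin (n + 1))).centroid ℝ p)

/-- The (interior) dihedral angle of the simplex with vertices `p` at the codimension-`2` face `Q`
with vertices `p k`, `k ∉ {i, j}`: the angle between the half-hyperplanes that are bounded by the
affine span of `Q` and contain `p i` and `p j` respectively. -/
noncomputable def dihedralAngle {n : ℕ} (p : Fin (n + 1) → EuclideanSpace ℝ (Fin n))
    (i j : Fin (n + 1)) : ℝ :=
  InnerProductGeometry.angle (simplexConormal p i j) (simplexConormal p j i)

namespace FacetGluing

variable {T : Type*} {n : ℕ}

/-- The cone angle around the codimension-`2` face `Q`: the sum of the dihedral angles of all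
simplices at all their faces that represent `Q`. -/
noncomputable def coneAngle [Fintype T] (G : FacetGluing T n) (ℓ : G.Edge → ℝ)
    (Q : G.Hinge) : ℝ :=
  ∑ t : T, ∑ q : {q : Fin (n + 1) × Fin (n + 1) // q.1 < q.2},
    if G.hinge t q.1.1 q.1.2 q.2.ne = Q then dihedralAngle (G.placement ℓ t) q.1.1 q.1.2 else 0

/-- The curvature `K_Q` of the codimension-`2` face `Q`. -/
noncomputable def curvature [Fintype T] (G : FacetGluing T n) (ℓ : G.Edge → ℝ)
    (Q : G.Hinge) : ℝ :=
  2 * Real.pi - G.coneAngle ℓ Q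

open MeasureTheory in
/-- The `(n - 2)`-dimensional volume of the codimension-`2` face `Q`, as that of any face of a
Euclidean simplex that represents `Q`; a point has volume `1`. -/
noncomputable def vol (G : FacetGluing T n) (ℓ : G.Edge → ℝ) (Q : G.Hinge) : ℝ :=
  ((μHE[n - 2] : Measure (EuclideanSpace ℝ (Fin n)))
    (convexHull ℝ (G.placement ℓ (Quot.out Q).1 ''
      ((Quot.out Q).2.1 : Set (Fin (n + 1)))))).toReal

/-- The discrete (Regge) total scalar curvature `a ∑_Q K_Q vol(Q)`. -/
noncomputable def totalScalarCurvature [Fintype T] (G : FacetGluing T n) (a : ℝ)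
    (ℓ : G.Edge → ℝ) : ℝ :=
  a * ∑ Q : G.Hinge, G.curvature ℓ Q * G.vol ℓ Q

/-- The metric `ℓ` is a critical point of the discrete total scalar curvature. -/
def IsCriticalMetric [Fintype T] (G : FacetGluing T n) (a : ℝ) (ℓ : G.Edge → ℝ) : Prop :=
  HasFDerivAt (G.totalScalarCurvature a) (0 : (G.Edge → ℝ) →L[ℝ] ℝ) ℓ

end FacetGluing

/-! The variational part is Schläfli's formula. For one nondegenerate simplex let H be the Gram
matrix of the gradients of the barycentric coordinates (`dualGram`). Without the row and column of a
vertex k it is the inverse of the Gram matrix of the edge vectors at k, whose entries are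
polynomials in the edge lengths; so H is differentiable in the lengths. The dihedral angle between
facets i and j is arccos(-H_ij / √(H_ii H_jj)) (`dihedralAngle_eq_arccos`), and by Jacobi's identity
for complementary minors the face opposite to the edge ij has volume √(H_ii H_jj - H_ij²) times a
factor depending on the simplex only (`IsPolyhedralMetric.vol_hinge`). Since the rows of H sum to
zero, Σ vol · dθ = 0 in each simplex (`schlaefli_formula`). Summing over the simplices gives Σ_Q
vol(Q) dK_Q = 0, and the product rule leaves Σ_Q K_Q d vol(Q). Polyhedral metrics form an open set
because they are described by positivity of lengths and positive definiteness of Gram matrices.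

For n = 3 the codimension-2 faces are the edges and their volumes are a constant multiple of their
lengths, so a critical metric has K_e = 0 for every edge e. It remains to show that a glued
3-manifold with all cone angles 2π is flat.

The tool is a development: motions attached to the simplices near a point that place neighbouring
simplices on opposite sides of their common facet. If the resulting developing map is a
homeomorphism near the point (`IsLocallyFlatAt`), comparing lengths of paths yields the isometric
ball (`IsLocallyFlatAt.exists_ball`). Such a development is evident inside a simplex or a facet.
Around an edge the simplices fill successive sectors about an axis, and the angle 2π closes the
circuit (`Frame.isLocallyFlatAt_edge`), provided that the circuit does not return with the edge
reversed.

Reversed edges and vertices need the manifold hypothesis. A punctured ball of dimension at least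
three is simply connected, so local developments around an isolated point can be combined into one
and extended over the point (`exists_development_of_punctured`). At the midpoint of a reversed edge
this is contradictory, because one motion would have to send both ends of the edge to the same place
(`Frame.iterate_order_eq`). At a vertex the developing map is a finite covering of a punctured ball
by a connected space, hence injective (`isLocallyFlatAt_of_punctured`). -/

/-! ### Volumes of simplices as Gram determinants -/

section SimplexVolume

open MeasureTheory

/-- The simplex in `ℝᵐ` spanned by the origin and the standard basis. -/
def cornerSimplex (m : ℕ) : Set (EuclideanSpace ℝ (Fin m)) :=
  {x | (∀ a, 0 ≤ x a) ∧ ∑ a, x a ≤ 1}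

/-- The volume of the corner simplex. -/
noncomputable def cornerVolume (m : ℕ) : ℝ := (volume (cornerSimplex m)).toReal

theorem volume_cornerSimplex_ne_top (m : ℕ) : volume (cornerSimplex m) ≠ ∞ := by
  have hsub : cornerSimplex m ⊆ Metric.closedBall 0 m := by
    intro x hx
    have h1 : ∀ a, x a ≤ 1 := fun a =>
      (Finset.single_le_sum (fun b _ => hx.1 b) (Finset.mem_univ a)).trans hx.2
    rw [mem_closedBall_zero_iff, EuclideanSpace.norm_eq]
    refine Real.sqrt_le_iff.2 ⟨Nat.cast_nonneg _, ?_⟩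
    calc ∑ a, ‖x a‖ ^ 2 ≤ ∑ _a : Fin m, (1 : ℝ) := by
          refine Finset.sum_le_sum fun a _ => ?_
          rw [Real.norm_eq_abs, sq_abs]
          nlinarith [h1 a, hx.1 a]
      _ = m := by simp
      _ ≤ (m : ℝ) ^ 2 := by
          rcases Nat.eq_zero_or_pos m with rfl | hm
          · simp
          · have : (1 : ℝ) ≤ m := by exact_mod_cast hm
            nlinarith
  exact ((measure_mono hsub).trans_lt (isCompact_closedBall _ _).measure_lt_top).ne

/-- The exact value plays no role: the constant only has to be cancelled, so positivity suffices. -/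
theorem cornerVolume_pos (m : ℕ) : 0 < cornerVolume m := by
  refine ENNReal.toReal_pos (ne_of_gt ?_) (volume_cornerSimplex_ne_top m)
  let U : Set (EuclideanSpace ℝ (Fin m)) := {x | ∀ a, x a ∈ Set.Ioo (0 : ℝ) (1 / (m + 1))}
  have hU : IsOpen U := by
    have : U = ⋂ a, (fun x : EuclideanSpace ℝ (Fin m) => x a) ⁻¹' Set.Ioo (0 : ℝ) (1 / (m + 1)) := by
      ext x; simp [U]
    rw [this]
    exact isOpen_iInter_of_finite fun a => isOpen_Ioo.preimage (by fun_prop)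
  have hne : U.Nonempty := by
    refine ⟨WithLp.toLp 2 (fun _ => 1 / (m + 2)), fun a => ⟨by positivity, ?_⟩⟩
    show (1 : ℝ) / (m + 2) < 1 / (m + 1)
    exact one_div_lt_one_div_of_lt (by positivity) (by linarith)
  refine (hU.measure_pos volume hne).trans_le (measure_mono fun x hx => ⟨fun a => (hx a).1.le, ?_⟩)
  calc ∑ a, x a ≤ ∑ _a : Fin m, (1 / (m + 1) : ℝ) := Finset.sum_le_sum fun a _ => (hx a).2.le
    _ ≤ 1 := by
      rw [Finset.sum_const, Finset.card_univ, Fintype.card_fin, nsmul_eq_mul, mul_one_div,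
        div_le_one (by positivity)]
      linarith

theorem convex_cornerSimplex (m : ℕ) : Convex ℝ (cornerSimplex m) := by
  intro x hx y hy a b ha hb hab
  refine ⟨fun i => ?_, ?_⟩
  · have := mul_nonneg ha (hx.1 i)
    have := mul_nonneg hb (hy.1 i)
    simp only [PiLp.add_apply, PiLp.smul_apply, smul_eq_mul]
    linarith
  · simp only [PiLp.add_apply, PiLp.smul_apply, smul_eq_mul]
    rw [Finset.sum_add_distrib, ← Finset.mul_sum, ← Finset.mul_sum]
    nlinarith [hx.2, hy.2]

variable {V : Type*} [NormedAddCommGroup V] [InnerProductSpace ℝ V]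

/-- Barycentric coordinates with the one at `k` eliminated. No independence of the points is needed.
-/
theorem convexHull_range_eq_image_cornerSimplex {ι : Type*} {m : ℕ} (q : ι → V)
    (k : ι) (e : Fin m ≃ {a // a ≠ k}) :
    convexHull ℝ (Set.range q) =
      (fun x => q k + x) '' ((Fintype.linearCombination ℝ (fun a => q (e a) - q k) ∘ₗ
        (WithLp.linearEquiv 2 ℝ (Fin m → ℝ)).toLinearMap) '' cornerSimplex m) := by
  classical
  apply Set.Subset.antisymm
  · refine convexHull_min ?_ ?_
    · rintro _ ⟨a, rfl⟩
      by_cases ha : a = k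
      · subst ha
        exact ⟨0, ⟨0, ⟨by simp, by simp⟩, by simp⟩, by simp⟩
      · refine ⟨_, ⟨EuclideanSpace.single (e.symm ⟨a, ha⟩) 1, ⟨fun b => ?_, ?_⟩, rfl⟩, ?_⟩
        · simp only [PiLp.single_apply]
          split_ifs <;> norm_num
        · simp
        · simp [Fintype.linearCombination_apply, Pi.single_apply]
    · rw [show (fun x => q k + x) = (fun x => q k +ᵥ x) from rfl, Set.image_vadd]
      exact ((convex_cornerSimplex m).linear_image _).vadd _
  · rintro _ ⟨_, ⟨x, hx, rfl⟩, rfl⟩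
    -- The extra index `none` carries the weight of `q k`, which is the slack in the inequality of
    -- the corner simplex.
    have key : q k + ∑ a, x a • (q (e a) - q k) =
        ∑ o : Option (Fin m), (o.elim (1 - ∑ a, x a) x) • (o.elim (q k) (fun a => q (e a))) := by
      rw [Fintype.sum_option]
      simp only [Option.elim, smul_sub, Finset.sum_sub_distrib, sub_smul, one_smul,
        ← Finset.sum_smul]
      abel
    have hmem : (∑ o : Option (Fin m), (o.elim (1 - ∑ a, x a) x) •
        (o.elim (q k) (fun a => q (e a)))) ∈ convexHull ℝ (Set.range q) := by
      refine (convex_convexHull ℝ _).sum_mem ?_ ?_ ?_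
      · rintro (_ | a) -
        · simpa using hx.2
        · exact hx.1 a
      · rw [Fintype.sum_option]; simp
      · rintro (_ | a) -
        · exact subset_convexHull ℝ _ ⟨k, rfl⟩
        · exact subset_convexHull ℝ _ ⟨_, rfl⟩
    rw [← key] at hmem
    simpa [Fintype.linearCombination_apply] using hmem

/-- The Gram matrix of the edge vectors of the family `q` at the vertex `k`. -/
noncomputable def edgeGram {ι : Type*} (q : ι → V) (k : ι) : Matrix {a // a ≠ k} {a // a ≠ k} ℝ :=
  Matrix.gram ℝ fun a : {a // a ≠ k} => q a - q k

variable [MeasurableSpace V] [BorelSpace V]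

/-- The square of the Jacobian of a linear map is the Gram determinant of the images of an
orthonormal basis. The result is an explicit function of the distances between the vertices, which
makes volumes of faces differentiable. -/
theorem euclideanHausdorffMeasure_convexHull {ι : Type*} [Fintype ι] [DecidableEq ι] {m : ℕ}
    (q : ι → V) (k : ι) (hm : Fintype.card ι = m + 1) :
    ((μHE[m] : Measure V) (convexHull ℝ (Set.range q))).toReal =
      cornerVolume m * √(edgeGram q k).det := by
  have hc : Fintype.card {a // a ≠ k} = m := by
    rw [Fintype.card_subtype_compl, Fintype.card_subtype_eq, hm]; rfl
  let e : Fin m ≃ {a // a ≠ k} := (Fintype.equivFinOfCardEq hc).symm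
  set L := (Fintype.linearCombination ℝ (fun a => q (e a) - q k) ∘ₗ
        (WithLp.linearEquiv 2 ℝ (Fin m → ℝ)).toLinearMap) with hL
  have h1 := LinearMap.euclideanHausdorffMeasure_image_eq_normDet_mul_volume L (cornerSimplex m)
  rw [finrank_euclideanSpace, Fintype.card_fin] at h1
  rw [convexHull_range_eq_image_cornerSimplex q k e]
  have h2 : (μHE[m] : Measure V) ((fun x => q k + x) '' (L '' cornerSimplex m)) =
      μHE[m] (L '' cornerSimplex m) :=
    Isometry.euclideanHausdorffMeasure_image (IsometryEquiv.constVAdd (q k)).isometry _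
  rw [h2, h1, ENNReal.toReal_mul, ENNReal.toReal_ofReal L.normDet_nonneg, mul_comm]
  congr 1
  have h3 := LinearMap.normDet_sq_eq_det_gram L (EuclideanSpace.basisFun (Fin m) ℝ)
  have h4 : (fun a => L (EuclideanSpace.basisFun (Fin m) ℝ a)) = fun a => q (e a) - q k := by
    funext a
    simp [hL]
  have h5 : (edgeGram q k).det = (Matrix.gram ℝ (fun a => q (e a) - q k)).det := by
    rw [← Matrix.det_submatrix_equiv_self e]; rfl
  rw [h5, ← h4]
  simp only [RCLike.ofReal_real_eq_id, id_eq] at h3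
  rw [← h3, Real.sqrt_sq L.normDet_nonneg]

end SimplexVolume

/-! ### Congruence of point systems with equal distances -/

section Congruence

variable {V : Type*} [NormedAddCommGroup V] [InnerProductSpace ℝ V] 

theorem inner_sub_sub_eq_dist (a b c : V) :
    inner ℝ (a - c) (b - c) = (dist a c ^ 2 + dist b c ^ 2 - dist a b ^ 2) / 2 := by
  have h := norm_sub_sq_real (a - c) (b - c)
  rw [sub_sub_sub_cancel_right] at h
  rw [dist_eq_norm, dist_eq_norm, dist_eq_norm]
  linarith

variable [FiniteDimensional ℝ V]

/-- Equal distances mean equal Gram matrices, so combinations of difference vectors with the same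
coefficients have the same norm. This gives an isometry between the spans, which extends to the
whole space. The points need not span, so the lemma applies to facets and smaller faces. -/
theorem exists_affineIsometryEquiv_of_dist_eq {ι : Type*} [Fintype ι] [Nonempty ι] {q q' : ι → V}
    (h : ∀ i j, dist (q i) (q j) = dist (q' i) (q' j)) :
    ∃ g : V ≃ᵃⁱ[ℝ] V, ∀ i, g (q i) = q' i := by
  classical
  obtain ⟨k⟩ := ‹Nonempty ι›
  let S := Fintype.linearCombination ℝ (fun a => q a - q k)
  let S' := Fintype.linearCombination ℝ (fun a => q' a - q' k)
  have hnorm : ∀ x, ‖S x‖ = ‖S' x‖ := by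
    intro x
    rw [← sq_eq_sq₀ (norm_nonneg _) (norm_nonneg _), ← real_inner_self_eq_norm_sq,
      ← real_inner_self_eq_norm_sq]
    simp only [S, S', Fintype.linearCombination_apply, sum_inner, inner_sum, inner_smul_left,
      inner_smul_right, inner_sub_sub_eq_dist, h]
  -- The choice of preimages is harmless: by `hnorm` the maps `S` and `S'` have the same kernel.
  obtain ⟨R, hR⟩ := LinearMap.exists_rightInverse_of_surjective S.rangeRestrict S.range_rangeRestrict
  have hR' : ∀ y, S (R y) = y := fun y => congrArg Subtype.val (LinearMap.congr_fun hR y)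
  let f : LinearMap.range S →ₗᵢ[ℝ] V :=
    ⟨S' ∘ₗ R, fun y => by
      rw [LinearMap.comp_apply, ← hnorm, hR']; rfl⟩
  have hf : ∀ x, f ⟨S x, x, rfl⟩ = S' x := by
    intro x
    show S' (R _) = S' x
    rw [← sub_eq_zero, ← map_sub, ← norm_eq_zero, ← hnorm, map_sub, hR', sub_self, norm_zero]
  let F : V ≃ₗᵢ[ℝ] V := f.extend.toLinearIsometryEquiv rfl
  have hF : ∀ x, F (S x) = S' x := by
    intro x
    rw [← hf x]
    exact f.extend_apply ⟨S x, x, rfl⟩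
  refine ⟨(AffineIsometryEquiv.constVAdd ℝ V (-q k)).trans
    (F.toAffineIsometryEquiv.trans (AffineIsometryEquiv.constVAdd ℝ V (q' k))), fun i => ?_⟩
  have hi := hF (Pi.single i 1)
  simp only [S, S', Fintype.linearCombination_apply_single, one_smul] at hi
  simp only [AffineIsometryEquiv.coe_trans, Function.comp_apply,
    AffineIsometryEquiv.coe_constVAdd, LinearIsometryEquiv.coe_toAffineIsometryEquiv, vadd_eq_add]
  rw [neg_add_eq_sub, hi, add_sub_cancel]

end Congruence

/-! ### Gradients of barycentric coordinates: dihedral angles and face volumes -/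

section Dual

variable {n : ℕ} {p : Fin (n + 1) → EuclideanSpace ℝ (Fin n)}

/-- The affine basis formed by the vertices of a nondegenerate simplex. -/
noncomputable def simplexBasis (h : AffineIndependent ℝ p) :
    AffineBasis (Fin (n + 1)) ℝ (EuclideanSpace ℝ (Fin n)) :=
  ⟨p, h, h.affineSpan_eq_top_iff_card_eq_finrank_add_one.2 (by simp)⟩

theorem simplexBasis_apply (h : AffineIndependent ℝ p) (i) : simplexBasis h i = p i := rfl

/-- The gradient of the barycentric coordinate of the vertex `i`. -/
noncomputable def baryGrad (h : AffineIndependent ℝ p) (i : Fin (n + 1)) :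
    EuclideanSpace ℝ (Fin n) :=
  (InnerProductSpace.toDual ℝ _).symm
    (LinearMap.toContinuousLinearMap ((simplexBasis h).coord i).linear)

theorem inner_baryGrad (h : AffineIndependent ℝ p) (i) (v : EuclideanSpace ℝ (Fin n)) :
    inner ℝ (baryGrad h i) v = ((simplexBasis h).coord i).linear v := by
  simp [baryGrad]

theorem inner_baryGrad_sub (h : AffineIndependent ℝ p) (i) (v w : EuclideanSpace ℝ (Fin n)) :
    inner ℝ (baryGrad h i) (v - w) = (simplexBasis h).coord i v - (simplexBasis h).coord i w := by
  rw [inner_baryGrad, ← vsub_eq_sub, AffineMap.linearMap_vsub, vsub_eq_sub]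

theorem inner_baryGrad_vertex_sub (h : AffineIndependent ℝ p) (i j k) :
    inner ℝ (baryGrad h i) (p j - p k) = (if i = j then 1 else 0) - (if i = k then 1 else 0) := by
  rw [inner_baryGrad_sub, ← simplexBasis_apply h j, ← simplexBasis_apply h k,
    AffineBasis.coord_apply, AffineBasis.coord_apply]

theorem sum_inner_baryGrad (h : AffineIndependent ℝ p) (v : EuclideanSpace ℝ (Fin n)) :
    ∑ i, inner ℝ (baryGrad h i) v = 0 := by
  have := fun i => inner_baryGrad_sub h i v 0
  simp only [sub_zero] at this
  simp only [this, Finset.sum_sub_distrib, AffineBasis.sum_coord_apply_eq_one, sub_self]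

theorem sum_inner_baryGrad_smul (h : AffineIndependent ℝ p) (v : EuclideanSpace ℝ (Fin n)) :
    ∑ i, inner ℝ (baryGrad h i) v • p i = v := by
  have := fun i => inner_baryGrad_sub h i v 0
  simp only [sub_zero] at this
  simp only [this, sub_smul, Finset.sum_sub_distrib, ← simplexBasis_apply h,
    AffineBasis.linear_combination_coord_eq_self, sub_zero]

theorem sum_inner_baryGrad_smul_sub (h : AffineIndependent ℝ p) (v : EuclideanSpace ℝ (Fin n))
    (k : Fin (n + 1)) : ∑ i, inner ℝ (baryGrad h i) v • (p i - p k) = v := by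
  simp only [smul_sub, Finset.sum_sub_distrib, ← Finset.sum_smul, sum_inner_baryGrad,
    sum_inner_baryGrad_smul, zero_smul, sub_zero]

/-- The inner products of the gradients of the barycentric coordinates. -/
noncomputable def dualGram (h : AffineIndependent ℝ p) (i j : Fin (n + 1)) : ℝ :=
  inner ℝ (baryGrad h i) (baryGrad h j)

theorem inner_baryGrad_baryGrad (h : AffineIndependent ℝ p) (i j : Fin (n + 1)) :
    inner ℝ (baryGrad h i) (baryGrad h j) = dualGram h i j := rfl

theorem dualGram_comm (h : AffineIndependent ℝ p) (i j) : dualGram h i j = dualGram h j i :=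
  real_inner_comm _ _

/-- The barycentric coordinates add up to a constant, so their gradients add up to zero. This is the
linear relation behind Schläfli's formula. -/
theorem sum_dualGram (h : AffineIndependent ℝ p) (i) : ∑ j, dualGram h i j = 0 := by
  simp_rw [dualGram_comm h i]
  exact sum_inner_baryGrad h _

theorem dualGram_self_pos (hn : n ≠ 0) (h : AffineIndependent ℝ p) (i) : 0 < dualGram h i i := by
  refine real_inner_self_pos.2 fun h0 => ?_
  have : Nontrivial (Fin (n + 1)) := Fin.nontrivial_iff_two_le.2 (by omega)
  obtain ⟨k, hk⟩ := exists_ne i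
  have := inner_baryGrad_vertex_sub h i i k
  rw [h0, inner_zero_left, if_pos rfl, if_neg hk.symm] at this
  norm_num at this

theorem exists_ne_ne (hn : 2 ≤ n) (i j : Fin (n + 1)) : ∃ k, k ≠ i ∧ k ≠ j := by
  have : ({i, j} : Finset (Fin (n + 1))) ≠ Finset.univ := by
    intro h
    have h1 := Finset.card_le_two (a := i) (b := j)
    rw [h, Finset.card_univ, Fintype.card_fin] at h1
    omega
  obtain ⟨k, hk⟩ := not_forall.1 (mt Finset.eq_univ_iff_forall.2 this)
  simp only [Finset.mem_insert, Finset.mem_singleton, not_or] at hk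
  exact ⟨k, hk⟩

/-- Strict Cauchy–Schwarz: two gradients are linearly independent, as is seen by pairing the
combination `w` with the edge from a third vertex `k` to the vertex `i`. -/
theorem dualGram_discr_pos (hn : 2 ≤ n) (h : AffineIndependent ℝ p) {i j : Fin (n + 1)}
    (hij : i ≠ j) : 0 < dualGram h i i * dualGram h j j - dualGram h i j ^ 2 := by
  obtain ⟨k, hki, hkj⟩ := exists_ne_ne hn i j
  set w := dualGram h j j • baryGrad h i - dualGram h i j • baryGrad h j with hw
  have hj := dualGram_self_pos (by omega) h j
  have hw0 : w ≠ 0 := by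
    intro h0
    have h1 : inner ℝ w (p i - p k) = dualGram h j j := by
      simp only [hw, inner_sub_left, inner_smul_left, inner_baryGrad_vertex_sub]
      simp [hki.symm, hkj.symm, hij.symm]
    rw [h0, inner_zero_left] at h1
    exact hj.ne h1
  have h2 : inner ℝ w w = dualGram h j j * (dualGram h i i * dualGram h j j - dualGram h i j ^ 2) := by
    simp only [hw, inner_sub_left, inner_sub_right, inner_smul_left, inner_smul_right, conj_trivial,
    inner_baryGrad_baryGrad]
    rw [dualGram_comm h j i]
    ring
  have h3 := real_inner_self_pos.2 hw0
  rw [h2] at h3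
  exact (mul_pos_iff_of_pos_left hj).1 h3

theorem mem_vectorSpan_face_iff (hn : 2 ≤ n) (h : AffineIndependent ℝ p) (i j : Fin (n + 1))
    (v : EuclideanSpace ℝ (Fin n)) :
    v ∈ vectorSpan ℝ (p '' (({i, j}ᶜ : Finset (Fin (n + 1))) : Set (Fin (n + 1)))) ↔
      inner ℝ (baryGrad h i) v = 0 ∧ inner ℝ (baryGrad h j) v = 0 := by
  constructor
  · intro hv
    rw [vectorSpan] at hv
    induction hv using Submodule.span_induction with
    | mem x hx =>
      obtain ⟨_, ⟨a, ha, rfl⟩, _, ⟨b, hb, rfl⟩, rfl⟩ := hx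
      simp only [Finset.coe_compl, Set.mem_compl_iff, Finset.mem_coe, Finset.mem_insert,
        Finset.mem_singleton, not_or] at ha hb
      simp only [vsub_eq_sub, inner_baryGrad_vertex_sub]
      simp [Ne.symm ha.1, Ne.symm ha.2, Ne.symm hb.1, Ne.symm hb.2]
    | zero => simp
    | add x y _ _ hx hy => simp [inner_add_right, hx, hy]
    | smul a x _ hx => simp [inner_smul_right, hx]
  · rintro ⟨hi, hj⟩
    obtain ⟨k, hki, hkj⟩ := exists_ne_ne hn i j
    rw [← sum_inner_baryGrad_smul_sub h v k]
    refine Submodule.sum_mem _ fun a _ => ?_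
    by_cases hai : a = i
    · rw [hai, hi, zero_smul]; exact Submodule.zero_mem _
    by_cases haj : a = j
    · rw [haj, hj, zero_smul]; exact Submodule.zero_mem _
    refine Submodule.smul_mem _ _ (vsub_mem_vectorSpan ℝ ⟨a, ?_, rfl⟩ ⟨k, ?_, rfl⟩) <;> simp [*]

/-- The plane orthogonal to the face is spanned by the gradients of the two omitted coordinates. The
conormal is the vector of that plane on which these coordinates have derivatives 1 and 0, and
solving the 2 × 2 system gives the formula. -/
theorem simplexConormal_eq (hn : 2 ≤ n) (h : AffineIndependent ℝ p) {i j : Fin (n + 1)}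
    (hij : i ≠ j) : simplexConormal p i j =
      (dualGram h i i * dualGram h j j - dualGram h i j ^ 2)⁻¹ •
        (dualGram h j j • baryGrad h i - dualGram h i j • baryGrad h j) := by
  have hD := dualGram_discr_pos hn h hij
  obtain ⟨k, hki, hkj⟩ := exists_ne_ne hn i j
  have hk : k ∈ ({i, j}ᶜ : Finset (Fin (n + 1))) := by simp [hki, hkj]
  rw [simplexConormal]
  set W := vectorSpan ℝ (p '' (({i, j}ᶜ : Finset (Fin (n + 1))) : Set (Fin (n + 1)))) with hW
  have hg : ∀ a, a = i ∨ a = j → baryGrad h a ∈ Wᗮ := by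
    intro a ha
    rw [Submodule.mem_orthogonal']
    intro u hu
    rw [mem_vectorSpan_face_iff hn h] at hu
    rcases ha with rfl | rfl
    exacts [hu.1, hu.2]
  refine Submodule.eq_starProjection_of_mem_of_inner_eq_zero ?_ ?_
  · exact Submodule.smul_mem _ _ (Submodule.sub_mem _ (Submodule.smul_mem _ _ (hg i (.inl rfl)))
      (Submodule.smul_mem _ _ (hg j (.inr rfl))))
  · intro w hw
    refine Submodule.inner_right_of_mem_orthogonal ?_ hw
    have hc : p k - Finset.centroid ℝ ({i, j}ᶜ : Finset (Fin (n + 1))) p ∈ W := by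
      refine vsub_mem_vectorSpan_of_mem_affineSpan_of_mem_affineSpan
        (subset_affineSpan ℝ _ ⟨k, hk, rfl⟩) ?_
      have := affineCombination_mem_affineSpan_image (k := ℝ) (p := p)
        (w := Finset.centroidWeights ℝ ({i, j}ᶜ : Finset (Fin (n + 1)))) (s := {i, j}ᶜ)
        (s' := (({i, j}ᶜ : Finset (Fin (n + 1))) : Set (Fin (n + 1))))
        (Finset.sum_centroidWeights_eq_one_of_nonempty ℝ _ ⟨k, hk⟩) (fun a ha ha' => absurd ha ha')
      exact this
    rw [← sub_add_sub_cancel (p i) (p k), add_sub_right_comm]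
    refine Submodule.add_mem _ ?_ hc
    rw [mem_vectorSpan_face_iff hn h]
    have h1 : inner ℝ (baryGrad h i) (baryGrad h i) = dualGram h i i := rfl
    have h2 : inner ℝ (baryGrad h i) (baryGrad h j) = dualGram h i j := rfl
    have h3 : inner ℝ (baryGrad h j) (baryGrad h i) = dualGram h i j := real_inner_comm _ _
    have h4 : inner ℝ (baryGrad h j) (baryGrad h j) = dualGram h j j := rfl
    simp only [inner_sub_right, inner_smul_right, h1, h2, h3, h4]
    rw [← inner_sub_right, ← inner_sub_right, inner_baryGrad_vertex_sub, inner_baryGrad_vertex_sub]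
    simp only [hki.symm, hkj.symm, hij.symm, if_true, if_false]
    constructor
    · field_simp
      ring
    · ring

theorem inner_simplexConormal (hn : 2 ≤ n) (h : AffineIndependent ℝ p) {i j : Fin (n + 1)}
    (hij : i ≠ j) : inner ℝ (simplexConormal p i j) (simplexConormal p j i) =
      -dualGram h i j / (dualGram h i i * dualGram h j j - dualGram h i j ^ 2) := by
  have hD := dualGram_discr_pos hn h hij
  rw [simplexConormal_eq hn h hij, simplexConormal_eq hn h hij.symm, dualGram_comm h j i,
    mul_comm (dualGram h j j)]
  simp only [inner_sub_left, inner_sub_right, inner_smul_left, inner_smul_right, conj_trivial,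
    inner_baryGrad_baryGrad]
  rw [dualGram_comm h j i]
  field_simp
  ring

theorem norm_simplexConormal (hn : 2 ≤ n) (h : AffineIndependent ℝ p) {i j : Fin (n + 1)}
    (hij : i ≠ j) : ‖simplexConormal p i j‖ =
      √(dualGram h j j) / √(dualGram h i i * dualGram h j j - dualGram h i j ^ 2) := by
  have hD := dualGram_discr_pos hn h hij
  rw [norm_eq_sqrt_real_inner, ← Real.sqrt_div' _ hD.le, simplexConormal_eq hn h hij]
  congr 1
  simp only [inner_sub_left, inner_sub_right, inner_smul_left, inner_smul_right, conj_trivial,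
    inner_baryGrad_baryGrad]
  rw [dualGram_comm h j i]
  field_simp
  ring

/-- The gradients are inward normals of the two facets, and the interior angle is the supplement of
the angle between them; hence the minus sign. -/
theorem dihedralAngle_eq_arccos (hn : 2 ≤ n) (h : AffineIndependent ℝ p) {i j : Fin (n + 1)}
    (hij : i ≠ j) : dihedralAngle p i j =
      Real.arccos (-(dualGram h i j / (√(dualGram h i i) * √(dualGram h j j)))) := by
  have hD := dualGram_discr_pos hn h hij
  have hi := dualGram_self_pos (by omega) h i
  have hj := dualGram_self_pos (by omega) h j
  rw [dihedralAngle, InnerProductGeometry.angle, inner_simplexConormal hn h hij,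
    norm_simplexConormal hn h hij, norm_simplexConormal hn h hij.symm, dualGram_comm h j i,
    mul_comm (dualGram h j j)]
  congr 1
  have h1 := Real.mul_self_sqrt hD.le
  have h2 := Real.sqrt_pos.2 hD
  have h3 := Real.sqrt_pos.2 hi
  have h4 := Real.sqrt_pos.2 hj
  rw [← mul_div_mul_comm, h1, mul_comm (√(dualGram h j j))]
  field_simp

theorem abs_dualGram_div_lt_one (hn : 2 ≤ n) (h : AffineIndependent ℝ p) {i j : Fin (n + 1)}
    (hij : i ≠ j) : |dualGram h i j / (√(dualGram h i i) * √(dualGram h j j))| < 1 := by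
  have hD := dualGram_discr_pos hn h hij
  have hi := dualGram_self_pos (by omega) h i
  have hj := dualGram_self_pos (by omega) h j
  rw [← Real.sqrt_mul hi.le, abs_div, abs_of_nonneg (Real.sqrt_nonneg _),
    div_lt_one (Real.sqrt_pos.2 (mul_pos hi hj))]
  refine Real.lt_sqrt_of_sq_lt ?_
  rw [sq_abs]
  linarith

theorem edgeGram_eq_dist {ι : Type*} {V : Type*} [NormedAddCommGroup V] [InnerProductSpace ℝ V]
    (q : ι → V) (k : ι) : edgeGram q k =
    Matrix.of fun a b : {a // a ≠ k} =>
      (dist (q a) (q k) ^ 2 + dist (q b) (q k) ^ 2 - dist (q a) (q b) ^ 2) / 2 := by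
  ext a b
  exact inner_sub_sub_eq_dist _ _ _

/-- The gradients and the edge vectors at `k` are dual bases, and Gram matrices of dual bases are
inverse to each other. -/
theorem edgeGram_mul_dualGram (h : AffineIndependent ℝ p) (k : Fin (n + 1)) :
    edgeGram p k * (Matrix.of fun a b : {a // a ≠ k} => dualGram h a b) = 1 := by
  ext a c
  have h1 := sum_inner_baryGrad_smul_sub h (baryGrad h c) k
  rw [Fintype.sum_eq_add_sum_subtype_ne _ k, sub_self, smul_zero, zero_add] at h1
  have h2 : inner ℝ (p a - p k) (baryGrad h c) = (if a = c then 1 else 0 : ℝ) := by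
    rw [real_inner_comm, inner_baryGrad_vertex_sub, if_neg c.2, sub_zero]
    simp only [Subtype.ext_iff, eq_comm]
  rw [Matrix.mul_apply, Matrix.one_apply, ← h2]
  conv_rhs => rw [← h1]
  rw [inner_sum]
  refine Finset.sum_congr rfl fun b _ => ?_
  rw [inner_smul_right, mul_comm]
  rfl

theorem dualGram_eq_inv (h : AffineIndependent ℝ p) {k : Fin (n + 1)} (a b : {a // a ≠ k}) :
    dualGram h a b = (edgeGram p k)⁻¹ a b := by
  rw [Matrix.inv_eq_right_inv (edgeGram_mul_dualGram h k)]
  rfl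

theorem det_edgeGram_pos {ι V : Type*} [NormedAddCommGroup V] [InnerProductSpace ℝ V] [Fintype ι]
    [DecidableEq ι] {q : ι → V} (h : AffineIndependent ℝ q) (k : ι) : 0 < (edgeGram q k).det :=
  (Matrix.posDef_gram_of_linearIndependent
    ((affineIndependent_iff_linearIndependent_vsub ℝ q k).1 h)).det_pos

/-- Jacobi's identity for complementary minors. Replacing the columns of `N` outside `P` by unit
vectors and multiplying by `M` gives a block triangular matrix; take determinants. -/
theorem Matrix.det_mul_det_toSquareBlockProp_of_mul_eq_one {α : Type*} [Fintype α] [DecidableEq α]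
    {M N : Matrix α α ℝ} (hMN : M * N = 1) (P : α → Prop) [DecidablePred P] :
    M.det * (N.toSquareBlockProp P).det = (M.toSquareBlockProp fun a => ¬P a).det := by
  let e := Equiv.sumCompl P
  let M' := M.submatrix e e
  let N' := N.submatrix e e
  have h1 : M' * N' = 1 := by
    rw [Matrix.submatrix_mul_equiv, hMN, Matrix.submatrix_one_equiv]
  rw [← Matrix.fromBlocks_toBlocks M', ← Matrix.fromBlocks_toBlocks N',
    Matrix.fromBlocks_multiply, ← Matrix.fromBlocks_one, Matrix.fromBlocks_inj] at h1
  have h2 : M' * Matrix.fromBlocks N'.toBlocks₁₁ 0 N'.toBlocks₂₁ 1 =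
      Matrix.fromBlocks 1 M'.toBlocks₁₂ 0 M'.toBlocks₂₂ := by
    conv_lhs => rw [← Matrix.fromBlocks_toBlocks M']
    rw [Matrix.fromBlocks_multiply]
    simp [h1.1, h1.2.2.1]
  have h3 := congrArg Matrix.det h2
  rw [Matrix.det_mul, Matrix.det_fromBlocks_zero₁₂, Matrix.det_fromBlocks_zero₂₁,
    Matrix.det_one, Matrix.det_one, one_mul, mul_one, Matrix.det_submatrix_equiv_self] at h3
  exact h3

/-- Jacobi's identity for the rows `i` and `j` of the dual Gram matrix. The first factor on the
right does not involve `i` and `j`: this makes the volumes of all codimension-two faces of one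
simplex proportional to square roots of 2 × 2 minors. -/
theorem det_edgeGram_face (h : AffineIndependent ℝ p) {i j k : Fin (n + 1)}
    (hij : i ≠ j) (hki : k ≠ i) (hkj : k ≠ j) {s : Finset (Fin (n + 1))} (hs : s = {i, j}ᶜ)
    (hk : k ∈ s) :
    (edgeGram (fun a : s => p a) ⟨k, hk⟩).det =
      (edgeGram p k).det * (dualGram h i i * dualGram h j j - dualGram h i j ^ 2) := by
  subst hs
  have h1 := Matrix.det_mul_det_toSquareBlockProp_of_mul_eq_one (edgeGram_mul_dualGram h k)
    (fun a => (a : Fin (n + 1)) = i ∨ (a : Fin (n + 1)) = j)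
  let f : Fin 2 → {a : {a : Fin (n + 1) // a ≠ k} // (a : Fin (n + 1)) = i ∨ (a : Fin (n + 1)) = j} :=
    ![⟨⟨i, hki.symm⟩, .inl rfl⟩, ⟨⟨j, hkj.symm⟩, .inr rfl⟩]
  have hf : Function.Bijective f := by
    constructor
    · intro a b hab
      fin_cases a <;> fin_cases b <;> simp [f, hij, hij.symm] at hab ⊢
    · rintro ⟨⟨a, hak⟩, rfl | rfl⟩
      exacts [⟨0, rfl⟩, ⟨1, rfl⟩]
  rw [← Matrix.det_submatrix_equiv_self (Equiv.ofBijective f hf), Matrix.det_fin_two] at h1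
  have h2 : dualGram h i i * dualGram h j j - dualGram h i j ^ 2 =
    dualGram h i i * dualGram h j j - dualGram h i j * dualGram h j i := by
    rw [dualGram_comm h j i]; ring
  rw [h2]
  refine Eq.trans ?_ h1.symm
  let e : {a : {a : Fin (n + 1) // a ≠ k} //
      ¬((a : Fin (n + 1)) = i ∨ (a : Fin (n + 1)) = j)} ≃
      {x : (({i, j}ᶜ : Finset (Fin (n + 1))) : Type _) // x ≠ ⟨k, hk⟩} :=
    { toFun := fun a => ⟨⟨a.1.1, by simpa using a.2⟩, fun hh => a.1.2 (congrArg Subtype.val hh)⟩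
      invFun := fun x => ⟨⟨x.1.1, fun hh => x.2 (Subtype.ext hh)⟩, by simpa using x.1.2⟩
      left_inv := fun a => rfl
      right_inv := fun x => rfl }
  rw [← Matrix.det_submatrix_equiv_self e]
  rfl

end Dual

/-! ### Schläfli's formula -/

section Schlaefli

theorem sum_ne_eq_two_nsmul_sum_lt {N : ℕ} {M : Type*} [AddCommMonoid M] (f : Fin N → Fin N → M)
    (hf : ∀ i j, f i j = f j i) :
    ∑ x : Fin N × Fin N with x.1 ≠ x.2, f x.1 x.2 =
      2 • ∑ q : {q : Fin N × Fin N // q.1 < q.2}, f q.1.1 q.1.2 := by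
  classical
  have h1 : (Finset.univ.filter fun x : Fin N × Fin N => x.1 ≠ x.2) =
      (Finset.univ.filter fun x : Fin N × Fin N => x.1 < x.2) ∪
      (Finset.univ.filter fun x : Fin N × Fin N => x.2 < x.1) := by
    ext x
    simp [lt_or_lt_iff_ne]
  have h2 : Disjoint (Finset.univ.filter fun x : Fin N × Fin N => x.1 < x.2)
      (Finset.univ.filter fun x : Fin N × Fin N => x.2 < x.1) := by
    rw [Finset.disjoint_filter]
    intro x _ h
    exact h.le.not_gt
  have h3 : ∑ x : Fin N × Fin N with x.2 < x.1, f x.1 x.2 =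
      ∑ x : Fin N × Fin N with x.1 < x.2, f x.1 x.2 := by
    refine Finset.sum_nbij' Prod.swap Prod.swap ?_ ?_ ?_ ?_ ?_
    · simp
    · simp
    · simp
    · simp
    · intro x _; exact hf _ _
  rw [h1, Finset.sum_union h2, h3, two_nsmul,
    Finset.sum_subtype (p := fun x : Fin N × Fin N => x.1 < x.2) _ (by simp)]

variable {E : Type*} [NormedAddCommGroup E] [NormedSpace ℝ E]

/-- The angle whose cosine is the negative of that of the vectors with Gram matrix `H`. -/
noncomputable def gramAngle {N : ℕ} (H : Fin N → Fin N → E → ℝ) (i j : Fin N) (y : E) : ℝ :=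
  Real.arccos (-(H i j y / (√(H i i y) * √(H j j y))))

variable {N : ℕ} {H : Fin N → Fin N → E → ℝ} {x : E}

theorem abs_div_sqrt_lt_one {a b c : ℝ} (ha : 0 < a) (hb : 0 < b) (hD : 0 < a * b - c ^ 2) :
    |c / (√a * √b)| < 1 := by
  rw [← Real.sqrt_mul ha.le, abs_div, abs_of_nonneg (Real.sqrt_nonneg _),
    div_lt_one (Real.sqrt_pos.2 (mul_pos ha hb))]
  refine Real.lt_sqrt_of_sq_lt ?_
  rw [sq_abs]
  linarith

theorem differentiableAt_div_mul {f g h : E → ℝ} (hf : DifferentiableAt ℝ f x)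
    (hg : DifferentiableAt ℝ g x) (hh : DifferentiableAt ℝ h x) (h0 : g x * h x ≠ 0) :
    DifferentiableAt ℝ (fun y => f y / (g y * h y)) x := by
  simp only [div_eq_mul_inv]
  exact hf.fun_mul ((hg.fun_mul hh).fun_inv h0)

theorem hasFDerivAt_gramAngle (hd : ∀ i j, DifferentiableAt ℝ (H i j) x)
    (hpos : ∀ i, 0 < H i i x) {i j : Fin N} (hD : 0 < H i i x * H j j x - H i j x ^ 2) :
    HasFDerivAt (gramAngle H i j)
      ((√(1 - (H i j x / (√(H i i x) * √(H j j x))) ^ 2))⁻¹ •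
        fderiv ℝ (fun y => H i j y / (√(H i i y) * √(H j j y))) x) x := by
  have hC : DifferentiableAt ℝ (fun y => H i j y / (√(H i i y) * √(H j j y))) x :=
    differentiableAt_div_mul (hd i j) ((hd i i).sqrt (hpos i).ne') ((hd j j).sqrt (hpos j).ne')
      (mul_pos (Real.sqrt_pos.2 (hpos i)) (Real.sqrt_pos.2 (hpos j))).ne'
  have h1 := abs_lt.1 (abs_div_sqrt_lt_one (hpos i) (hpos j) hD)
  have h2 := (Real.hasDerivAt_arccos (x := -(H i j x / (√(H i i x) * √(H j j x))))
    (by linarith) (by linarith)).comp_hasFDerivAt x hC.hasFDerivAt.neg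
  rw [neg_sq, smul_neg, neg_smul, neg_neg, one_div] at h2
  exact h2

/-- With C the normalized entry, the derivative of arccos(-C) contributes 1 / √(1 - C²), and the
face volume is proportional to √(H_ii H_jj) √(1 - C²); the irrational factor cancels. -/
theorem sqrt_discr_smul_fderiv_gramAngle (hd : ∀ i j, DifferentiableAt ℝ (H i j) x)
    (hpos : ∀ i, 0 < H i i x) {i j : Fin N} (hD : 0 < H i i x * H j j x - H i j x ^ 2) :
    √(H i i x * H j j x - H i j x ^ 2) • fderiv ℝ (gramAngle H i j) x =
      (√(H i i x) * √(H j j x)) • fderiv ℝ (fun y => H i j y / (√(H i i y) * √(H j j y))) x := by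
  have h1 := abs_div_sqrt_lt_one (hpos i) (hpos j) hD
  have hi := Real.sqrt_pos.2 (hpos i)
  have hj := Real.sqrt_pos.2 (hpos j)
  have h2 : 0 < 1 - (H i j x / (√(H i i x) * √(H j j x))) ^ 2 := by
    rw [← sq_abs]
    nlinarith [abs_nonneg (H i j x / (√(H i i x) * √(H j j x)))]
  have h3 : √(H i i x * H j j x - H i j x ^ 2) =
      √(H i i x) * √(H j j x) * √(1 - (H i j x / (√(H i i x) * √(H j j x))) ^ 2) := by
    rw [← Real.sqrt_mul (hpos i).le, ← Real.sqrt_mul (mul_pos (hpos i) (hpos j)).le]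
    congr 1
    rw [div_pow, Real.sq_sqrt (mul_pos (hpos i) (hpos j)).le]
    have := hpos i
    have := hpos j
    field_simp
  rw [(hasFDerivAt_gramAngle hd hpos hD).fderiv, smul_smul, h3, mul_assoc,
    mul_inv_cancel₀ (Real.sqrt_pos.2 h2).ne', mul_one]

/-- Logarithmic differentiation of the quotient. The case `i = j` is included; there the left side
is the derivative of a constant. -/
theorem sqrt_mul_sqrt_smul_fderiv (hd : ∀ i j, DifferentiableAt ℝ (H i j) x)
    (hpos : ∀ i, 0 < H i i x) (i j : Fin N) :
    (√(H i i x) * √(H j j x)) • fderiv ℝ (fun y => H i j y / (√(H i i y) * √(H j j y))) x =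
      fderiv ℝ (H i j) x - H i j x • ((√(H i i x))⁻¹ • fderiv ℝ (fun y => √(H i i y)) x)
        - H i j x • ((√(H j j x))⁻¹ • fderiv ℝ (fun y => √(H j j y)) x) := by
  have hi := Real.sqrt_pos.2 (hpos i)
  have hj := Real.sqrt_pos.2 (hpos j)
  have di : DifferentiableAt ℝ (fun y => √(H i i y)) x := (hd i i).sqrt (hpos i).ne'
  have dj : DifferentiableAt ℝ (fun y => √(H j j y)) x := (hd j j).sqrt (hpos j).ne'
  have dC : DifferentiableAt ℝ (fun y => H i j y / (√(H i i y) * √(H j j y))) x :=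
    differentiableAt_div_mul (hd i j) di dj (mul_pos hi hj).ne'
  have h1 : (fun y => H i j y / (√(H i i y) * √(H j j y)) * (√(H i i y) * √(H j j y))) =ᶠ[𝓝 x]
      H i j := by
    filter_upwards [(hd i i).continuousAt.eventually_mem (Ioi_mem_nhds (hpos i)),
      (hd j j).continuousAt.eventually_mem (Ioi_mem_nhds (hpos j))] with y hyi hyj
    exact div_mul_cancel₀ _ (mul_pos (Real.sqrt_pos.2 hyi) (Real.sqrt_pos.2 hyj)).ne'
  have h2 := h1.fderiv_eq (𝕜 := ℝ)
  rw [fderiv_fun_mul dC (di.fun_mul dj), fderiv_fun_mul di dj] at h2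
  rw [← h2]
  ext v
  simp only [sub_apply, add_apply,
    smul_apply, smul_eq_mul]
  field_simp
  ring

/-- **Schläfli's formula**, for a simplex given by the Gram matrix of its scaled normals. -/
theorem schlaefli_formula (hd : ∀ i j, DifferentiableAt ℝ (H i j) x)
    (hsymm : ∀ i j y, H i j y = H j i y) (hsum : ∀ i, ∀ᶠ y in 𝓝 x, ∑ j, H i j y = 0)
    (hpos : ∀ i, 0 < H i i x) (hD : ∀ i j, i ≠ j → 0 < H i i x * H j j x - H i j x ^ 2) :
    ∑ q : {q : Fin N × Fin N // q.1 < q.2},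
      √(H q.1.1 q.1.1 x * H q.1.2 q.1.2 x - H q.1.1 q.1.2 x ^ 2) •
        fderiv ℝ (gramAngle H q.1.1 q.1.2) x = 0 := by
  -- For `i ≠ j` this is volume times differential of the angle. The forms are symmetric, vanish on
  -- the diagonal, and have total sum zero because the rows and columns of `H` sum to zero; so the
  -- sum over pairs vanishes.
  let D : Fin N → Fin N → E →L[ℝ] ℝ := fun i j => fderiv ℝ (H i j) x
    - H i j x • ((√(H i i x))⁻¹ • fderiv ℝ (fun y => √(H i i y)) x)
    - H i j x • ((√(H j j x))⁻¹ • fderiv ℝ (fun y => √(H j j y)) x)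
  have hDs : ∀ i j, D i j = D j i := by
    intro i j
    simp only [D]
    rw [show H i j = H j i from funext (hsymm i j), sub_right_comm]
  have hD0 : ∀ i, D i i = 0 := by
    intro i
    simp only [D]
    rw [← sqrt_mul_sqrt_smul_fderiv hd hpos i i]
    have h1 : (fun y => H i i y / (√(H i i y) * √(H i i y))) =ᶠ[𝓝 x] fun _ => 1 := by
      filter_upwards [(hd i i).continuousAt.eventually_mem (Ioi_mem_nhds (hpos i))] with y hy
      rw [Real.mul_self_sqrt (le_of_lt hy), div_self (ne_of_gt hy)]
    rw [h1.fderiv_eq, fderiv_fun_const]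
    simp
  have hsum' : ∀ i, ∑ j, fderiv ℝ (H i j) x = 0 := by
    intro i
    have h1 : (fun y => ∑ j, H i j y) =ᶠ[𝓝 x] fun _ => 0 := hsum i
    rw [← fderiv_fun_sum fun j _ => hd i j, h1.fderiv_eq, fderiv_fun_const]
    rfl
  have hsum0 : ∀ i, ∑ j, H i j x = 0 := fun i => (hsum i).self_of_nhds
  have hsum1 : ∀ j, ∑ i, H i j x = 0 := fun j => by simp_rw [hsymm _ j, hsum0]
  have hall : ∑ i, ∑ j, D i j = 0 := by
    simp only [D, Finset.sum_sub_distrib, hsum', ← Finset.sum_smul, hsum0, zero_smul,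
      Finset.sum_const_zero]
    rw [Finset.sum_comm]
    simp only [← Finset.sum_smul, hsum1, zero_smul, Finset.sum_const_zero, sub_self]
  have h1 : ∑ y : Fin N × Fin N with y.1 ≠ y.2, D y.1 y.2 = 0 := by
    rw [← hall, ← Fintype.sum_prod_type' (fun i j => D i j)]
    refine Finset.sum_filter_of_ne fun y _ hy hyy => hy ?_
    rw [hyy, hD0]
  rw [sum_ne_eq_two_nsmul_sum_lt D hDs,
    ← Nat.cast_smul_eq_nsmul ℝ] at h1
  rw [← (smul_eq_zero.1 h1).resolve_left (by norm_num)]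
  refine Finset.sum_congr rfl fun q _ => ?_
  rw [sqrt_discr_smul_fderiv_gramAngle hd hpos (hD _ _ q.2.ne), sqrt_mul_sqrt_smul_fderiv hd hpos]

end Schlaefli

/-! ### Differentiability of determinants and inverses, and realization of distance matrices -/

section MatrixCalculus

variable {E : Type*} [NormedAddCommGroup E] [NormedSpace ℝ E] {ι : Type*} [Fintype ι]
  [DecidableEq ι] {M : E → Matrix ι ι ℝ} {x : E}

theorem DifferentiableAt.matrix_det (h : ∀ a b, DifferentiableAt ℝ (fun y => M y a b) x) :
    DifferentiableAt ℝ (fun y => (M y).det) x := by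
  have hprod : ∀ (σ : Equiv.Perm ι) (s : Finset ι),
      DifferentiableAt ℝ (fun y => ∏ a ∈ s, M y (σ a) a) x := by
    intro σ s
    induction s using Finset.induction_on with
    | empty => simp
    | insert a s ha ih =>
      simp only [Finset.prod_insert ha]
      exact (h _ _).fun_mul ih
  simp only [Matrix.det_apply]
  refine DifferentiableAt.fun_sum fun σ _ => ?_
  simp only [Units.smul_def, ← Int.cast_smul_eq_zsmul ℝ]
  exact (hprod σ Finset.univ).fun_const_smul _

theorem DifferentiableAt.matrix_inv (h : ∀ a b, DifferentiableAt ℝ (fun y => M y a b) x)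
    (h0 : (M x).det ≠ 0) (a b : ι) : DifferentiableAt ℝ (fun y => (M y)⁻¹ a b) x := by
  simp only [Matrix.inv_def, Ring.inverse_eq_inv', Matrix.smul_apply, smul_eq_mul]
  refine ((DifferentiableAt.matrix_det h).inv h0).mul ?_
  simp only [Matrix.adjugate_apply]
  refine DifferentiableAt.matrix_det fun c d => ?_
  by_cases hc : c = b
  · subst hc; simp
  · simpa [Matrix.updateRow_ne hc] using h c d

/-- Positivity of the quadratic form needs to be tested on the unit sphere only, which is compact,
so it persists under small perturbations. -/
theorem Matrix.PosDef.eventually {ι : Type*} [Fintype ι] {X : Type*} [TopologicalSpace X]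
    {M : X → Matrix ι ι ℝ} {x : X} (hM : (M x).PosDef)
    (hc : ∀ a b, ContinuousAt (fun y => M y a b) x) (hs : ∀ y, (M y).IsHermitian) :
    ∀ᶠ y in 𝓝 x, (M y).PosDef := by
  classical
  have hK : IsCompact (Metric.sphere (0 : ι → ℝ) 1) := isCompact_sphere _ _
  have h1 : ∀ v ∈ Metric.sphere (0 : ι → ℝ) 1, ∀ᶠ z : X × (ι → ℝ) in 𝓝 (x, v),
      0 < z.2 ⬝ᵥ (M z.1).mulVec z.2 := by
    intro v hv
    have hv0 : v ≠ 0 := by rintro rfl; simp at hv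
    have hpos : 0 < v ⬝ᵥ (M x).mulVec v := by simpa using hM.dotProduct_mulVec_pos hv0
    have : ContinuousAt (fun z : X × (ι → ℝ) => z.2 ⬝ᵥ (M z.1).mulVec z.2) (x, v) := by
      simp only [dotProduct, Matrix.mulVec]
      refine tendsto_finsetSum _ fun a _ => ?_
      refine Filter.Tendsto.mul
        (((continuous_apply a).comp continuous_snd).continuousAt (x := (x, v))) (tendsto_finsetSum _ fun b _ => ?_)
      refine Filter.Tendsto.mul ?_
        (((continuous_apply b).comp continuous_snd).continuousAt (x := (x, v)))
      exact (hc a b).tendsto.comp (continuous_fst.tendsto (x, v))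
    exact this.eventually_mem (Ioi_mem_nhds hpos)
  filter_upwards [hK.eventually_forall_of_forall_eventually
    (P := fun y v => 0 < v ⬝ᵥ (M y).mulVec v) h1] with y hy
  refine Matrix.PosDef.of_dotProduct_mulVec_pos (hs y) fun v hv => ?_
  have hn : 0 < ‖v‖ := norm_pos_iff.2 hv
  have h2 := hy (‖v‖⁻¹ • v) (by simp [norm_smul, hn.ne'])
  rw [Matrix.mulVec_smul, smul_dotProduct, dotProduct_smul, smul_eq_mul, smul_eq_mul] at h2
  have h3 : (0 : ℝ) < ‖v‖⁻¹ := inv_pos.2 hn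
  simpa using (mul_pos_iff_of_pos_left h3).1 ((mul_pos_iff_of_pos_left h3).1 h2)

open scoped MatrixOrder in
-- Factor the prospective Gram matrix as B*B; the columns of B, together with the origin, are the
-- vertices.
theorem exists_simplex_of_posDef {n : ℕ} {d : Fin (n + 1) → Fin (n + 1) → ℝ}
    (hsymm : ∀ i j, d i j = d j i) (hself : ∀ i, d i i = 0) (hnn : ∀ i j, 0 ≤ d i j)
    (hM : (Matrix.of fun a b : Fin n =>
      (d a.succ 0 ^ 2 + d b.succ 0 ^ 2 - d a.succ b.succ ^ 2) / 2).PosDef) :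
    ∃ p : Fin (n + 1) → EuclideanSpace ℝ (Fin n),
      AffineIndependent ℝ p ∧ ∀ i j, dist (p i) (p j) = d i j := by
  obtain ⟨B, hB⟩ := CStarAlgebra.nonneg_iff_eq_star_mul_self.1 hM.posSemidef.nonneg
  let v : Fin n → EuclideanSpace ℝ (Fin n) := fun a => WithLp.toLp 2 fun c => B c a
  have hv : ∀ a b, inner ℝ (v a) (v b) =
      (d a.succ 0 ^ 2 + d b.succ 0 ^ 2 - d a.succ b.succ ^ 2) / 2 := by
    intro a b
    have := congrFun (congrFun hB a) b
    rw [Matrix.of_apply, Matrix.mul_apply] at this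
    rw [this]
    simp [v, PiLp.inner_apply, Matrix.star_apply, mul_comm]
  have hgram : Matrix.gram ℝ v = Matrix.of fun a b : Fin n =>
      (d a.succ 0 ^ 2 + d b.succ 0 ^ 2 - d a.succ b.succ ^ 2) / 2 := by
    ext a b; exact hv a b
  let p : Fin (n + 1) → EuclideanSpace ℝ (Fin n) := Fin.cons 0 v
  refine ⟨p, ?_, ?_⟩
  · rw [affineIndependent_iff_linearIndependent_vsub ℝ p 0]
    have h1 : LinearIndependent ℝ v := Matrix.linearIndependent_of_posDef_gram (hgram ▸ hM)
    have h2 := h1.comp (finSuccAboveEquiv (0 : Fin (n + 1))).symm (Equiv.injective _)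
    have h3 : (fun a : {a : Fin (n + 1) // a ≠ 0} => p a -ᵥ p 0) =
        v ∘ (finSuccAboveEquiv (0 : Fin (n + 1))).symm := by
      funext a
      obtain ⟨b, rfl⟩ := (finSuccAboveEquiv (0 : Fin (n + 1))).surjective a
      rw [Function.comp_apply, Equiv.symm_apply_apply, finSuccAboveEquiv_apply]
      simp only [Fin.succAbove_zero, p, Fin.cons_succ, Fin.cons_zero, vsub_eq_sub, sub_zero]
    rw [h3]
    exact h2
  · have hsq : ∀ i j, dist (p i) (p j) ^ 2 = d i j ^ 2 := by
      intro i j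
      have hself' : ∀ a, ‖v a‖ ^ 2 = d a.succ 0 ^ 2 := by
        intro a
        rw [← real_inner_self_eq_norm_sq, hv, hself]
        ring
      refine Fin.cases ?_ (fun a => ?_) i <;> refine Fin.cases ?_ (fun b => ?_) j
      · simp [hself]
      · simp [p, hself', hsymm 0]
      · simp [p, hself']
      · simp only [p, Fin.cons_succ, dist_eq_norm]
        rw [norm_sub_sq_real, hself', hself', hv]
        ring
    intro i j
    exact (sq_eq_sq₀ dist_nonneg (hnn i j)).1 (hsq i j)

end MatrixCalculus

/-! ### Edge lengths: polyhedral metrics form an open set -/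

namespace FacetGluing

variable {T : Type*} {n : ℕ}

section Lengths

/-- The length of the edge `ij` of the simplex `t` (zero for `i = j`). -/
noncomputable def len (G : FacetGluing T n) (ℓ : G.Edge → ℝ) (t : T) (i j : Fin (n + 1)) : ℝ :=
  if h : i ≠ j then ℓ (G.edge t i j h) else 0

variable {G : FacetGluing T n} {ℓ : G.Edge → ℝ}

theorem len_self (t : T) (i : Fin (n + 1)) : G.len ℓ t i i = 0 := by simp [len]

theorem edge_comm (t : T) (i j : Fin (n + 1)) (h : i ≠ j) : G.edge t i j h = G.edge t j i h.symm := by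
  exact congrArg (fun s => Quot.mk (G.FaceStep 2) (t, s)) (Subtype.ext (Finset.pair_comm i j))

theorem len_comm (t : T) (i j : Fin (n + 1)) : G.len ℓ t i j = G.len ℓ t j i := by
  by_cases h : i = j
  · rw [h]
  · rw [len, len, dif_pos h, dif_pos (Ne.symm h), edge_comm]

theorem len_nbr (t : T) {i a b : Fin (n + 1)} (ha : a ≠ i) (hb : b ≠ i) :
    G.len ℓ (G.nbr t i) (G.perm t i a) (G.perm t i b) = G.len ℓ t a b := by
  by_cases h : a = b
  · rw [h, len_self, len_self]
  · rw [len, len, dif_pos h, dif_pos ((G.perm t i).injective.ne h)]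
    congr 1
    refine (Quot.sound ⟨i, ?_, rfl, ?_⟩).symm
    · simp [ha.symm, hb.symm]
    · simp [Finset.map_insert]

theorem IsPlacement.dist_eq {t : T} {p : Fin (n + 1) → EuclideanSpace ℝ (Fin n)}
    (hp : G.IsPlacement ℓ t p) (i j : Fin (n + 1)) : dist (p i) (p j) = G.len ℓ t i j := by
  by_cases h : i = j
  · rw [h, dist_self, len_self]
  · rw [len, dif_pos h, hp.2 i j h]

theorem isPlacement_of_dist_eq {t : T} {p : Fin (n + 1) → EuclideanSpace ℝ (Fin n)}
    (hp : AffineIndependent ℝ p) (h : ∀ i j, dist (p i) (p j) = G.len ℓ t i j) :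
    G.IsPlacement ℓ t p :=
  ⟨hp, fun i j hij => by rw [h, len, dif_pos hij]⟩

theorem IsPolyhedralMetric.isPlacement (hℓ : G.IsPolyhedralMetric ℓ) (t : T) :
    G.IsPlacement ℓ t (G.placement ℓ t) := by
  rw [placement, dif_pos (hℓ t)]
  exact (hℓ t).choose_spec

theorem IsPolyhedralMetric.affineIndependent (hℓ : G.IsPolyhedralMetric ℓ) (t : T) :
    AffineIndependent ℝ (G.placement ℓ t) := (hℓ.isPlacement t).1

theorem IsPolyhedralMetric.len_pos (hℓ : G.IsPolyhedralMetric ℓ) (t : T) {i j : Fin (n + 1)}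
    (hij : i ≠ j) : 0 < G.len ℓ t i j := by
  rw [← (hℓ.isPlacement t).dist_eq]
  exact dist_pos.2 ((hℓ.affineIndependent t).injective.ne hij)

theorem differentiable_len [Finite T] (t : T) (i j : Fin (n + 1)) :
    Differentiable ℝ fun ℓ : G.Edge → ℝ => G.len ℓ t i j := by
  unfold len
  split_ifs
  · exact differentiable_apply _
  · exact differentiable_const _

theorem eventually_isPolyhedralMetric [Finite T] (hℓ : G.IsPolyhedralMetric ℓ) :
    ∀ᶠ ℓ' in 𝓝 ℓ, G.IsPolyhedralMetric ℓ' := by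
  refine Filter.eventually_all.2 fun t => ?_
  have hpos : ∀ᶠ ℓ' in 𝓝 ℓ, ∀ i j, 0 ≤ G.len ℓ' t i j := by
    refine Filter.eventually_all.2 fun i => Filter.eventually_all.2 fun j => ?_
    by_cases hij : i = j
    · exact Filter.Eventually.of_forall fun ℓ' => by rw [hij, len_self]
    · filter_upwards [(differentiable_len t i j).continuous.continuousAt.eventually_mem
        (Ioi_mem_nhds (hℓ.len_pos t hij))] with ℓ' h using le_of_lt h
  have hM : ∀ᶠ ℓ' in 𝓝 ℓ, (Matrix.of fun a b : Fin n => (G.len ℓ' t a.succ 0 ^ 2 +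
      G.len ℓ' t b.succ 0 ^ 2 - G.len ℓ' t a.succ b.succ ^ 2) / 2).PosDef := by
    refine Matrix.PosDef.eventually ?_ ?_ ?_
    · have h1 := (affineIndependent_iff_linearIndependent_vsub ℝ _ 0).1 (hℓ.affineIndependent t)
      have h2 := h1.comp (finSuccAboveEquiv (0 : Fin (n + 1))) (Equiv.injective _)
      have h3 : (Matrix.of fun a b : Fin n => (G.len ℓ t a.succ 0 ^ 2 +
          G.len ℓ t b.succ 0 ^ 2 - G.len ℓ t a.succ b.succ ^ 2) / 2) = Matrix.gram ℝ
            ((fun a : {a : Fin (n + 1) // a ≠ 0} => G.placement ℓ t a -ᵥ G.placement ℓ t 0) ∘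
              finSuccAboveEquiv (0 : Fin (n + 1))) := by
        ext a b
        simp only [Matrix.of_apply, Matrix.gram_apply, Function.comp_apply, finSuccAboveEquiv_apply,
          Fin.succAbove_zero, vsub_eq_sub, inner_sub_sub_eq_dist, (hℓ.isPlacement t).dist_eq]
      rw [h3]
      exact Matrix.posDef_gram_of_linearIndependent h2
    · intro a b
      have h1 := fun i j => (differentiable_len (G := G) t i j).continuous.continuousAt (x := ℓ)
      exact ((((h1 _ _).pow 2).add ((h1 _ _).pow 2)).sub ((h1 _ _).pow 2)).div_const 2
    · intro ℓ'
      ext a b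
      simp only [Matrix.conjTranspose_apply, Matrix.of_apply, star_trivial,
        len_comm t b.succ a.succ]
      ring
  filter_upwards [hpos, hM] with ℓ' h1 h2
  obtain ⟨p, hp, hd⟩ := exists_simplex_of_posDef (d := G.len ℓ' t) (len_comm t) (len_self t) h1 h2
  exact ⟨p, isPlacement_of_dist_eq hp hd⟩

end Lengths

/-! ### Volumes of codimension-two faces as functions of the edge lengths -/

section Volume

open MeasureTheory

variable {G : FacetGluing T n} {ℓ : G.Edge → ℝ}

/-- The volume of the face `c` in the chosen realization of its simplex. -/
noncomputable def faceVol (G : FacetGluing T n) (ℓ : G.Edge → ℝ)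
    (c : T × {s : Finset (Fin (n + 1)) // s.card = n - 1}) : ℝ :=
  ((μHE[n - 2] : Measure (EuclideanSpace ℝ (Fin n)))
    (convexHull ℝ (G.placement ℓ c.1 '' (c.2.1 : Set (Fin (n + 1)))))).toReal

/-- Identified faces have the same edge lengths, hence are congruent. Therefore `vol` does not
depend on the representative chosen by `Quot.out`. -/
theorem IsPolyhedralMetric.faceVol_eq_of_faceStep (hn : 2 ≤ n) (hℓ : G.IsPolyhedralMetric ℓ)
    {c d : T × {s : Finset (Fin (n + 1)) // s.card = n - 1}} (h : G.FaceStep (n - 1) c d) :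
    G.faceVol ℓ c = G.faceVol ℓ d := by
  obtain ⟨t, s, hs⟩ := c
  obtain ⟨t', s', hs'⟩ := d
  obtain ⟨i, hi, h1, h2⟩ := h
  simp only at hi h1 h2
  subst h1 h2
  have hne : Nonempty s := by
    rw [Finset.nonempty_coe_sort, ← Finset.card_pos, hs]
    omega
  obtain ⟨g, hg⟩ := exists_affineIsometryEquiv_of_dist_eq
    (q := fun a : s => G.placement ℓ t a)
    (q' := fun a : s => G.placement ℓ (G.nbr t i) (G.perm t i a)) fun a b => by
      rw [(hℓ.isPlacement _).dist_eq, (hℓ.isPlacement _).dist_eq, len_nbr]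
      · rintro rfl; exact hi a.2
      · rintro rfl; exact hi b.2
  have h3 : G.placement ℓ (G.nbr t i) '' (s.map (G.perm t i).toEmbedding : Set (Fin (n + 1))) =
      g '' (G.placement ℓ t '' (s : Set (Fin (n + 1)))) := by
    rw [Finset.coe_map, Set.image_image, Set.image_image]
    exact Set.image_congr fun a ha => (hg ⟨a, ha⟩).symm
  simp only [faceVol]
  rw [h3, show (g : EuclideanSpace ℝ (Fin n) → EuclideanSpace ℝ (Fin n)) =
    g.toAffineEquiv.toAffineMap from rfl, ← AffineMap.image_convexHull]
  congr 1
  exact (Isometry.euclideanHausdorffMeasure_image g.isometry _).symm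

theorem IsPolyhedralMetric.vol_mk (hn : 2 ≤ n) (hℓ : G.IsPolyhedralMetric ℓ)
    (c : T × {s : Finset (Fin (n + 1)) // s.card = n - 1}) :
    G.vol ℓ (Quot.mk _ c) = G.faceVol ℓ c := by
  let f : G.Hinge → ℝ := Quot.lift (G.faceVol ℓ) fun _ _ h => hℓ.faceVol_eq_of_faceStep hn h
  calc G.vol ℓ (Quot.mk _ c) = f (Quot.mk _ (Quot.out (Quot.mk (G.FaceStep (n - 1)) c))) := rfl
    _ = f (Quot.mk _ c) := by rw [Quot.out_eq]
    _ = G.faceVol ℓ c := rfl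

/-- The Gram matrix at the vertex `k` of the face `s` of `t`, in terms of edge lengths. -/
noncomputable def lenGram (G : FacetGluing T n) (ℓ : G.Edge → ℝ) (t : T) {ι : Type*}
    (f : ι → Fin (n + 1)) (k : ι) : Matrix {a // a ≠ k} {a // a ≠ k} ℝ :=
  Matrix.of fun a b => (G.len ℓ t (f a) (f k) ^ 2 + G.len ℓ t (f b) (f k) ^ 2
    - G.len ℓ t (f a) (f b) ^ 2) / 2

theorem IsPlacement.edgeGram_eq {t : T} {p : Fin (n + 1) → EuclideanSpace ℝ (Fin n)}
    (hp : G.IsPlacement ℓ t p) {ι : Type*} (f : ι → Fin (n + 1)) (k : ι) :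
    edgeGram (p ∘ f) k = G.lenGram ℓ t f k := by
  rw [edgeGram_eq_dist]
  simp only [Function.comp_apply, hp.dist_eq]
  rfl

theorem differentiable_lenGram [Finite T] (t : T) {ι : Type*}
    (f : ι → Fin (n + 1)) (k : ι) (a b) :
    Differentiable ℝ fun ℓ : G.Edge → ℝ => G.lenGram ℓ t f k a b := by
  have h1 := fun i j => differentiable_len (G := G) t i j
  simp only [lenGram, Matrix.of_apply, div_eq_mul_inv]
  exact ((((h1 _ _).fun_pow 2).fun_add ((h1 _ _).fun_pow 2)).fun_sub ((h1 _ _).fun_pow 2)).mul_const _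

theorem IsPolyhedralMetric.faceVol_eq (hn : 2 ≤ n) (hℓ : G.IsPolyhedralMetric ℓ)
    (c : T × {s : Finset (Fin (n + 1)) // s.card = n - 1}) (k : c.2.1) :
    G.faceVol ℓ c = cornerVolume (n - 2) *
      √(G.lenGram ℓ c.1 (fun a : c.2.1 => (a : Fin (n + 1))) k).det := by
  rw [faceVol, ← (hℓ.isPlacement c.1).edgeGram_eq, Set.image_eq_range]
  exact euclideanHausdorffMeasure_convexHull (fun a : c.2.1 => G.placement ℓ c.1 a) k
    (by rw [Fintype.card_coe, c.2.2]; omega)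

theorem IsPolyhedralMetric.det_lenGram_pos (hℓ : G.IsPolyhedralMetric ℓ) (t : T) {ι : Type*}
    [Fintype ι] [DecidableEq ι] {f : ι → Fin (n + 1)} (hf : Function.Injective f) (k : ι) :
    0 < (G.lenGram ℓ t f k).det := by
  rw [← (hℓ.isPlacement t).edgeGram_eq]
  exact det_edgeGram_pos ((hℓ.affineIndependent t).comp_embedding ⟨f, hf⟩) k

theorem IsPolyhedralMetric.differentiableAt_vol [Finite T] (hn : 2 ≤ n)
    (hℓ : G.IsPolyhedralMetric ℓ) (Q : G.Hinge) :
    DifferentiableAt ℝ (fun ℓ' => G.vol ℓ' Q) ℓ := by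
  obtain ⟨c, rfl⟩ := Quot.exists_rep Q
  have hne : c.2.1.Nonempty := by
    rw [← Finset.card_pos, c.2.2]
    omega
  obtain ⟨k, hk⟩ := hne
  have h1 : (fun ℓ' => G.vol ℓ' (Quot.mk _ c)) =ᶠ[𝓝 ℓ] fun ℓ' => cornerVolume (n - 2) *
      √(G.lenGram ℓ' c.1 (fun a : c.2.1 => (a : Fin (n + 1))) ⟨k, hk⟩).det := by
    filter_upwards [eventually_isPolyhedralMetric hℓ] with ℓ' h
    rw [h.vol_mk hn, h.faceVol_eq hn c ⟨k, hk⟩]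
  refine h1.differentiableAt_iff.2 (DifferentiableAt.const_mul (DifferentiableAt.sqrt ?_ ?_) _)
  · exact DifferentiableAt.matrix_det fun a b => (differentiable_lenGram _ _ _ a b).differentiableAt
  · exact (hℓ.det_lenGram_pos _ Subtype.val_injective _).ne'

/-- The point is that the factor `c` is common to all codimension-two faces of `t`, so that
Schläfli's formula for the minors becomes one for volumes. -/
theorem IsPolyhedralMetric.vol_hinge (hn : 2 ≤ n) (hℓ : G.IsPolyhedralMetric ℓ) (t : T) :
    ∃ c : ℝ, ∀ i j, ∀ h : i ≠ j, G.vol ℓ (G.hinge t i j h) =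
      c * √(dualGram (hℓ.affineIndependent t) i i * dualGram (hℓ.affineIndependent t) j j
        - dualGram (hℓ.affineIndependent t) i j ^ 2) := by
  -- The volume of the whole simplex stands in for the Gram determinant at `k`, which seems to
  -- depend on `k`, a vertex that varies with `i` and `j`.
  refine ⟨cornerVolume (n - 2) * (((μHE[n] : Measure (EuclideanSpace ℝ (Fin n)))
    (convexHull ℝ (Set.range (G.placement ℓ t)))).toReal / cornerVolume n), fun i j h => ?_⟩
  obtain ⟨k, hki, hkj⟩ := exists_ne_ne hn i j
  have hk : k ∈ ({i, j}ᶜ : Finset (Fin (n + 1))) := by simp [hki, hkj]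
  rw [hinge, hℓ.vol_mk hn, hℓ.faceVol_eq hn _ ⟨k, hk⟩, ← (hℓ.isPlacement t).edgeGram_eq,
    euclideanHausdorffMeasure_convexHull _ k (by simp),
    mul_div_cancel_left₀ _ (cornerVolume_pos n).ne', mul_assoc,
    ← Real.sqrt_mul (det_edgeGram_pos (hℓ.affineIndependent t) k).le]
  congr 2
  exact det_edgeGram_face (hℓ.affineIndependent t) h hki hkj rfl hk

end Volume

/-! ### First variation of the total curvature -/

section FirstVariation

variable {G : FacetGluing T n} {ℓ : G.Edge → ℝ}

open Classical in
/-- The Gram matrix of the gradients of the barycentric coordinates of the simplex `t`, as a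
function of the edge lengths. -/
noncomputable def metricDualGram (G : FacetGluing T n) (t : T) (i j : Fin (n + 1))
    (ℓ : G.Edge → ℝ) : ℝ :=
  if h : AffineIndependent ℝ (G.placement ℓ t) then dualGram h i j else 0

theorem IsPolyhedralMetric.metricDualGram_eq (hℓ : G.IsPolyhedralMetric ℓ) (t : T)
    (i j : Fin (n + 1)) : G.metricDualGram t i j ℓ = dualGram (hℓ.affineIndependent t) i j :=
  dif_pos _

/-- For a vertex `k` other than `i` and `j` the entry is one of the inverse of the Gram matrix at
`k`, and the entries of the latter are polynomials in the lengths. -/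
theorem IsPolyhedralMetric.differentiableAt_metricDualGram [Finite T] (hn : 2 ≤ n)
    (hℓ : G.IsPolyhedralMetric ℓ) (t : T) (i j : Fin (n + 1)) :
    DifferentiableAt ℝ (G.metricDualGram t i j) ℓ := by
  obtain ⟨k, hki, hkj⟩ := exists_ne_ne hn i j
  have h1 : G.metricDualGram t i j =ᶠ[𝓝 ℓ] fun ℓ' =>
      (G.lenGram ℓ' t id k)⁻¹ ⟨i, hki.symm⟩ ⟨j, hkj.symm⟩ := by
    filter_upwards [eventually_isPolyhedralMetric hℓ] with ℓ' h
    rw [h.metricDualGram_eq, ← (h.isPlacement t).edgeGram_eq]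
    exact dualGram_eq_inv (h.affineIndependent t) ⟨i, hki.symm⟩ ⟨j, hkj.symm⟩
  refine h1.differentiableAt_iff.2 (DifferentiableAt.matrix_inv (fun a b => ?_) ?_ _ _)
  · exact (differentiable_lenGram _ _ _ a b).differentiableAt
  · exact (hℓ.det_lenGram_pos t Function.injective_id k).ne'

theorem IsPolyhedralMetric.dihedralAngle_eq (hn : 2 ≤ n) (hℓ : G.IsPolyhedralMetric ℓ) (t : T)
    {i j : Fin (n + 1)} (hij : i ≠ j) :
    dihedralAngle (G.placement ℓ t) i j = gramAngle (G.metricDualGram t) i j ℓ := by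
  rw [dihedralAngle_eq_arccos hn (hℓ.affineIndependent t) hij, gramAngle]
  simp only [hℓ.metricDualGram_eq]

theorem IsPolyhedralMetric.hasFDerivAt_dihedralAngle [Finite T] (hn : 2 ≤ n)
    (hℓ : G.IsPolyhedralMetric ℓ) (t : T) {i j : Fin (n + 1)} (hij : i ≠ j) :
    HasFDerivAt (fun ℓ' => dihedralAngle (G.placement ℓ' t) i j)
      (fderiv ℝ (gramAngle (G.metricDualGram t) i j) ℓ) ℓ := by
  have h1 : (fun ℓ' => dihedralAngle (G.placement ℓ' t) i j) =ᶠ[𝓝 ℓ]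
      gramAngle (G.metricDualGram t) i j := by
    filter_upwards [eventually_isPolyhedralMetric hℓ] with ℓ' h
    exact h.dihedralAngle_eq hn t hij
  refine HasFDerivAt.congr_of_eventuallyEq (DifferentiableAt.hasFDerivAt ?_) h1
  refine (hasFDerivAt_gramAngle (hℓ.differentiableAt_metricDualGram hn t) (fun i => ?_)
    ?_).differentiableAt
  · rw [hℓ.metricDualGram_eq]
    exact dualGram_self_pos (by omega) _ _
  · simp only [hℓ.metricDualGram_eq]
    exact dualGram_discr_pos hn _ hij

theorem IsPolyhedralMetric.sum_vol_smul_fderiv_gramAngle [Finite T] (hn : 2 ≤ n)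
    (hℓ : G.IsPolyhedralMetric ℓ) (t : T) :
    ∑ q : {q : Fin (n + 1) × Fin (n + 1) // q.1 < q.2},
      G.vol ℓ (G.hinge t q.1.1 q.1.2 q.2.ne) •
        fderiv ℝ (gramAngle (G.metricDualGram t) q.1.1 q.1.2) ℓ = 0 := by
  obtain ⟨c, hc⟩ := hℓ.vol_hinge hn t
  have h1 := schlaefli_formula (H := G.metricDualGram t) (x := ℓ)
    (hℓ.differentiableAt_metricDualGram hn t) (fun i j ℓ' => ?_) (fun i => ?_) (fun i => ?_)
    (fun i j hij => ?_)
  · simp only [hc, mul_smul, ← Finset.smul_sum]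
    simp only [hℓ.metricDualGram_eq] at h1
    rw [h1, smul_zero]
  · simp only [metricDualGram]
    split_ifs
    · exact dualGram_comm _ _ _
    · rfl
  · filter_upwards [eventually_isPolyhedralMetric hℓ] with ℓ' h
    simp only [h.metricDualGram_eq, sum_dualGram]
  · rw [hℓ.metricDualGram_eq]
    exact dualGram_self_pos (by omega) _ _
  · simp only [hℓ.metricDualGram_eq]
    exact dualGram_discr_pos hn _ hij

theorem IsPolyhedralMetric.hasFDerivAt_curvature [Fintype T] (hn : 2 ≤ n)
    (hℓ : G.IsPolyhedralMetric ℓ) (Q : G.Hinge) :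
    HasFDerivAt (fun ℓ' => G.curvature ℓ' Q)
      (-∑ t : T, ∑ q : {q : Fin (n + 1) × Fin (n + 1) // q.1 < q.2},
        if G.hinge t q.1.1 q.1.2 q.2.ne = Q then
          fderiv ℝ (gramAngle (G.metricDualGram t) q.1.1 q.1.2) ℓ else 0) ℓ := by
  unfold curvature coneAngle
  refine HasFDerivAt.const_sub (HasFDerivAt.fun_sum fun t _ => HasFDerivAt.fun_sum fun q _ => ?_) _
  split_ifs
  · exact hℓ.hasFDerivAt_dihedralAngle hn t q.2.ne
  · exact hasFDerivAt_const _ _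

/-- Product rule; the terms with the derivative of the curvature cancel within each simplex by
Schläfli's formula. -/
theorem IsPolyhedralMetric.hasFDerivAt_totalScalarCurvature [Fintype T] (hn : 2 ≤ n)
    (hℓ : G.IsPolyhedralMetric ℓ) (a : ℝ) :
    HasFDerivAt (G.totalScalarCurvature a)
      (a • ∑ Q : G.Hinge, G.curvature ℓ Q • fderiv ℝ (fun ℓ' => G.vol ℓ' Q) ℓ) ℓ := by
  have h1 := (HasFDerivAt.fun_sum (u := Finset.univ) fun (Q : G.Hinge) _ =>
    (hℓ.hasFDerivAt_curvature hn Q).fun_mul (hℓ.differentiableAt_vol hn Q).hasFDerivAt).const_smul a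
  have h2 : ∑ Q : G.Hinge, G.vol ℓ Q •
      (-∑ t : T, ∑ q : {q : Fin (n + 1) × Fin (n + 1) // q.1 < q.2},
        if G.hinge t q.1.1 q.1.2 q.2.ne = Q then
          fderiv ℝ (gramAngle (G.metricDualGram t) q.1.1 q.1.2) ℓ else 0) = 0 := by
    simp only [smul_neg, Finset.sum_neg_distrib, Finset.smul_sum, smul_ite, smul_zero]
    rw [Finset.sum_comm, neg_eq_zero]
    refine Finset.sum_eq_zero fun t _ => ?_
    -- Each dihedral angle of `t` enters the curvature of exactly one face, so the sum over all
    -- faces collapses to the Schläfli sum of `t`.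
    rw [Finset.sum_comm]
    simp only [Finset.sum_ite_eq, Finset.mem_univ, if_true]
    exact hℓ.sum_vol_smul_fderiv_gramAngle hn t
  rw [Finset.sum_add_distrib, h2, add_zero] at h1
  exact h1

theorem IsPolyhedralMetric.isCriticalMetric_iff [Fintype T] (hn : 2 ≤ n)
    (hℓ : G.IsPolyhedralMetric ℓ) {a : ℝ} (ha : a ≠ 0) :
    G.IsCriticalMetric a ℓ ↔ ∀ e : G.Edge, ∑ Q : G.Hinge, G.curvature ℓ Q *
        fderiv ℝ (fun ℓ' => G.vol ℓ' Q) ℓ (Pi.single e 1) = 0 := by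
  have h1 := hℓ.hasFDerivAt_totalScalarCurvature hn a
  set L := ∑ Q : G.Hinge, G.curvature ℓ Q • fderiv ℝ (fun ℓ' => G.vol ℓ' Q) ℓ with hL
  have h2 : G.IsCriticalMetric a ℓ ↔ L = 0 := by
    constructor
    · intro h
      exact (smul_eq_zero.1 (h1.unique h)).resolve_left ha
    · intro h
      rw [h, smul_zero] at h1
      exact h1
  have h3 : ∀ v, L v = ∑ Q : G.Hinge, G.curvature ℓ Q * fderiv ℝ (fun ℓ' => G.vol ℓ' Q) ℓ v := by
    intro v
    simp [hL]
  simp only [← h3]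
  rw [h2]
  constructor
  · intro h e
    rw [h, zero_apply]
  · intro h
    ext v
    have := LinearMap.pi_apply_eq_sum_univ (L : (G.Edge → ℝ) →ₗ[ℝ] ℝ) v
    rw [ContinuousLinearMap.coe_coe] at this
    rw [this, zero_apply]
    refine Finset.sum_eq_zero fun e _ => ?_
    have h4 : (fun j => if e = j then (1 : ℝ) else 0) = Pi.single e 1 := by
      funext j
      rw [Pi.single_apply]
      simp only [eq_comm]
    rw [h4, h e, smul_zero]

/-- In dimension three `Hinge` and `Edge` are the same type and the volume of an edge is a constant
times its length, so the criticality equation for `e` contains only the term of `e`. -/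
theorem IsPolyhedralMetric.curvature_eq_zero {G : FacetGluing T 3} {ℓ : G.Edge → ℝ} [Fintype T]
    (hℓ : G.IsPolyhedralMetric ℓ) {a : ℝ} (ha : a ≠ 0) (hc : G.IsCriticalMetric a ℓ)
    (e : G.Hinge) : G.curvature ℓ e = 0 := by
  rw [hℓ.isCriticalMetric_iff le_add_self ha] at hc
  have hvol : ∀ Q : G.Hinge, fderiv ℝ (fun ℓ' => G.vol ℓ' Q) ℓ (Pi.single e 1) =
      if Q = e then cornerVolume 1 else 0 := by
    intro Q
    have h1 : (fun ℓ' => G.vol ℓ' Q) =ᶠ[𝓝 ℓ] fun ℓ' => cornerVolume 1 * ℓ' Q := by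
      filter_upwards [eventually_isPolyhedralMetric hℓ] with ℓ' h
      obtain ⟨⟨t, s, hs⟩, rfl⟩ := Quot.exists_rep Q
      obtain ⟨x, y, hxy, rfl⟩ := Finset.card_eq_two.1 hs
      have hx : x ∈ ({x, y} : Finset (Fin 4)) := by simp
      have hy : y ∈ ({x, y} : Finset (Fin 4)) := by simp
      rw [h.vol_mk (by norm_num), h.faceVol_eq (by norm_num) _ ⟨x, hx⟩]
      congr 1
      -- The face is an edge `xy`: its Gram matrix at `x` has one entry, the squared length.
      rw [Matrix.det_eq_elem_of_card_eq_one (by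
        rw [Fintype.card_subtype_compl, Fintype.card_subtype_eq, Fintype.card_coe, hs])
        ⟨⟨y, hy⟩, fun hh => hxy (congrArg Subtype.val hh).symm⟩]
      simp only [lenGram, Matrix.of_apply, len_self]
      rw [show ∀ z : ℝ, (z ^ 2 + z ^ 2 - 0 ^ 2) / 2 = z ^ 2 by intro z; ring,
        Real.sqrt_sq (h.len_pos t hxy.symm).le, len_comm, len, dif_pos hxy]
      rfl
    have h2 : HasFDerivAt (fun ℓ' : G.Edge → ℝ => cornerVolume 1 * ℓ' Q)
        (cornerVolume 1 • ContinuousLinearMap.proj (R := ℝ) (φ := fun _ : G.Edge => ℝ) Q) ℓ :=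
      (hasFDerivAt_apply (𝕜 := ℝ) Q ℓ).const_mul _
    rw [h1.fderiv_eq, h2.fderiv, smul_apply, ContinuousLinearMap.proj_apply, Pi.single_apply,
      smul_eq_mul, mul_ite, mul_one, mul_zero]
  have h3 := hc e
  simp only [hvol, mul_ite, mul_zero, Finset.sum_ite_eq', Finset.mem_univ, if_true] at h3
  exact (mul_eq_zero.1 h3).resolve_right (cornerVolume_pos 1).ne'

end FirstVariation

end FacetGluing

/-! ### Coverings and flat bundles over punctured balls -/

section PuncturedBall

theorem StarConvex.contractibleSpace_coe {V : Type*} [NormedAddCommGroup V] [NormedSpace ℝ V]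
    {s : Set V} {x : V} (hs : StarConvex ℝ x s) (hx : x ∈ s) : ContractibleSpace s := by
  rw [contractible_iff_id_nullhomotopic]
  have hmem : ∀ (t : unitInterval) (y : s), (1 - (t : ℝ)) • (y : V) + (t : ℝ) • x ∈ s := by
    intro t y
    rw [add_comm]
    exact hs y.2 t.2.1 (sub_nonneg.2 t.2.2) (by ring)
  refine ⟨⟨x, hx⟩, ⟨⟨⟨fun z => ⟨_, hmem z.1 z.2⟩, ?_⟩, fun y => ?_, fun y => ?_⟩⟩⟩
  · exact Continuous.subtype_mk (by fun_prop) _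
  · simp
  · simp

variable {V : Type*} [NormedAddCommGroup V] [InnerProductSpace ℝ V]

/-- The ball of radius `r` around `o` without its centre. -/
def puncturedBall (o : V) (r : ℝ) : Set V := Metric.ball o r \ {o}

theorem isOpen_puncturedBall {V : Type*} [NormedAddCommGroup V] (o : V) (r : ℝ) : IsOpen (puncturedBall o r) :=
  Metric.isOpen_ball.sdiff isClosed_singleton

/-- The ball of radius `r` around `o` without the radius opposite to `e`. -/
def slitBall (o : V) (r : ℝ) (e : V) : Set V :=
  {v | v ∈ Metric.ball o r ∧ 0 < ‖v - o‖ + inner ℝ (v - o) e}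

theorem isOpen_slitBall (o : V) (r : ℝ) (e : V) : IsOpen (slitBall o r e) :=
  have h : Continuous fun v : V => ‖v - o‖ + inner ℝ (v - o) e := by fun_prop
  Metric.isOpen_ball.inter (isOpen_lt continuous_const h)

theorem slitBall_union (o : V) (r : ℝ) (e : V) :
    slitBall o r e ∪ slitBall o r (-e) = puncturedBall o r := by
  ext v
  simp only [slitBall, puncturedBall, Set.mem_union, Set.mem_ofPred_eq, Set.mem_sdiff,
    Set.mem_singleton_iff, inner_neg_right]
  constructor
  · rintro (⟨h1, h2⟩ | ⟨h1, h2⟩) <;>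
    · refine ⟨h1, ?_⟩
      rintro rfl
      simp at h2
  · rintro ⟨h1, h2⟩
    have h3 : 0 < ‖v - o‖ := norm_pos_iff.2 (sub_ne_zero.2 h2)
    rcases le_total 0 (inner ℝ (v - o) e) with h | h
    · exact .inl ⟨h1, by linarith⟩
    · exact .inr ⟨h1, by linarith⟩

/-- If a point on the way from the star centre to `v` lay on the closed ray opposite to `e`, then
`v` would be obtained by moving further away from the centre, and so would lie on that ray too. -/
theorem starConvex_slitBall (o : V) {r : ℝ} (hr : 0 < r) {e : V} (he : ‖e‖ = 1) :
    StarConvex ℝ (o + (r / 2) • e) (slitBall o r e) ∧ o + (r / 2) • e ∈ slitBall o r e := by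
  have hmem : o + (r / 2) • e ∈ slitBall o r e := by
    refine ⟨?_, ?_⟩
    · rw [mem_ball_iff_norm, add_sub_cancel_left, norm_smul, he, Real.norm_of_nonneg (by positivity)]
      linarith
    · rw [add_sub_cancel_left, inner_smul_left, real_inner_self_eq_norm_sq, he, norm_smul, he,
        Real.norm_of_nonneg (by positivity)]
      simp only [conj_trivial]
      linarith
  refine ⟨?_, hmem⟩
  intro v hv a b ha hb hab
  refine ⟨(convex_ball o r).starConvex hmem.1 hv.1 ha hb hab, ?_⟩
  have heq : a • (o + (r / 2) • e) + b • v - o = (a * (r / 2)) • e + b • (v - o) := by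
    have : o = (a + b) • o := by rw [hab, one_smul]
    nth_rewrite 2 [this]
    module
  rw [heq]
  set w := v - o with hw
  set c := a * (r / 2) with hc
  have hc0 : 0 ≤ c := by positivity
  by_contra hcon
  have h0 : ‖c • e + b • w‖ + inner ℝ (c • e + b • w) e = 0 := by
    have := neg_le_of_abs_le (abs_real_inner_le_norm (c • e + b • w) e)
    rw [he, mul_one] at this
    linarith
  set u := c • e + b • w with hu
  have h1 : u = -(‖u‖ • e) := by
    rw [← sub_eq_zero, sub_neg_eq_add, ← norm_eq_zero, ← sq_eq_zero_iff, norm_add_sq_real,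
      inner_smul_right, norm_smul, he, norm_norm, mul_one]
    have : inner ℝ u e = -‖u‖ := by linarith
    rw [this]
    ring
  have h2 : b • w = -((‖u‖ + c) • e) := by
    have : b • w = u - c • e := by rw [hu]; abel
    rw [this, add_smul]
    nth_rewrite 1 [h1]
    abel
  rcases hb.eq_or_lt with rfl | hb'
  · have ha1 : a = 1 := by linarith
    rw [zero_smul] at h2
    have h3 : (‖u‖ + c) • e = 0 := by rw [← neg_eq_zero, ← h2]
    have h4 : 0 < c := by rw [hc, ha1]; positivity
    rcases smul_eq_zero.1 h3 with h5 | h5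
    · linarith [norm_nonneg u]
    · rw [h5, norm_zero] at he; norm_num at he
  · have h3 : w = -(((‖u‖ + c) / b) • e) := by
      rw [div_eq_inv_mul, mul_smul, ← smul_neg, ← h2, inv_smul_smul₀ hb'.ne']
    have h4 := hv.2
    rw [← hw, h3, norm_neg, norm_smul, he, inner_neg_left, inner_smul_left,
      real_inner_self_eq_norm_sq, he, Real.norm_of_nonneg (by positivity)] at h4
    simp at h4

/-- The intersection is the ball without a diameter. It is a radial image of the complement of a
line, which is connected because the line has codimension at least two; this is where dimension
three is needed. -/
theorem isPreconnected_slitBall_inter (hV : 2 < Module.finrank ℝ V) (o : V) {r : ℝ}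
    (hr : 0 < r) {e : V} (he : ‖e‖ = 1) :
    (slitBall o r e ∩ slitBall o r (-e)).Nonempty ∧
      IsPreconnected (slitBall o r e ∩ slitBall o r (-e)) := by
  have : FiniteDimensional ℝ V := FiniteDimensional.of_finrank_pos (by omega)
  have h1 : IsConnected ((ℝ ∙ e : Submodule ℝ V) : Set V)ᶜ := by
    refine isConnected_compl_of_one_lt_codim ?_
    have h2 := Submodule.finrank_quotient_add_finrank (ℝ ∙ e)
    rw [finrank_span_singleton (by rintro rfl; simp at he)] at h2
    rw [← Module.finrank_eq_rank]
    exact_mod_cast (show 1 < Module.finrank ℝ (V ⧸ (ℝ ∙ e)) by omega)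
  -- Radial compression of the space to the ball; directions are kept, so the line goes to the
  -- diameter.
  let f : V → V := fun w => o + (r / (1 + ‖w‖)) • w
  have hf : Continuous f := by
    have : ∀ w : V, 1 + ‖w‖ ≠ 0 := fun w => by positivity
    fun_prop (disch := exact this _)
  have hkey : ∀ w : V, w ∉ (ℝ ∙ e) ↔ 0 < ‖w‖ + inner ℝ w e ∧ 0 < ‖w‖ - inner ℝ w e := by
    intro w
    have hle := abs_le.1 (abs_real_inner_le_norm w e)
    rw [he, mul_one] at hle
    constructor
    · intro h
      by_contra hcon
      have h3 : ‖w‖ = -inner ℝ w e ∨ ‖w‖ = inner ℝ w e := by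
        by_contra h4
        rw [not_or] at h4
        refine hcon ⟨lt_of_le_of_ne (by linarith) fun h => h4.1 (by linarith),
          lt_of_le_of_ne (by linarith) fun h => h4.2 (by linarith)⟩
      refine h (Submodule.mem_span_singleton.2 ⟨inner ℝ w e, ?_⟩)
      rw [eq_comm, ← sub_eq_zero, ← norm_eq_zero, ← sq_eq_zero_iff, norm_sub_sq_real,
        inner_smul_right, norm_smul, he, mul_one, Real.norm_eq_abs, sq_abs]
      rcases h3 with h3 | h3 <;> rw [h3] <;> ring
    · rintro ⟨h3, h4⟩ h
      obtain ⟨a, rfl⟩ := Submodule.mem_span_singleton.1 h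
      rw [norm_smul, he, inner_smul_left, real_inner_self_eq_norm_sq, he, Real.norm_eq_abs] at h3 h4
      simp only [conj_trivial, one_pow, mul_one] at h3 h4
      rcases abs_choice a with h5 | h5 <;> rw [h5] at h3 h4 <;> linarith
  have himg : f '' ((ℝ ∙ e : Submodule ℝ V) : Set V)ᶜ = slitBall o r e ∩ slitBall o r (-e) := by
    have hscale : ∀ (c : ℝ) (w : V), 0 < c → (c • w ∉ (ℝ ∙ e) ↔ w ∉ (ℝ ∙ e)) := by
      intro c w hc
      rw [Submodule.smul_mem_iff _ hc.ne']
    ext v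
    constructor
    · rintro ⟨w, hw, rfl⟩
      have hw' : w ∉ (ℝ ∙ e) := hw
      have hpos : 0 < r / (1 + ‖w‖) := by positivity
      have h3 := (hkey _).1 ((hscale _ w hpos).2 hw')
      have hball : f w ∈ Metric.ball o r := by
        rw [mem_ball_iff_norm, add_sub_cancel_left, norm_smul, Real.norm_of_nonneg hpos.le,
          div_mul_eq_mul_div, div_lt_iff₀ (by positivity)]
        nlinarith [norm_nonneg w]
      refine ⟨⟨hball, ?_⟩, hball, ?_⟩
      · rw [add_sub_cancel_left]; exact h3.1
      · rw [add_sub_cancel_left, inner_neg_right]; exact h3.2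
    · rintro ⟨⟨hb, h3⟩, -, h4⟩
      rw [inner_neg_right] at h4
      rw [mem_ball_iff_norm] at hb
      have hpos : 0 < (r - ‖v - o‖)⁻¹ := inv_pos.2 (by linarith)
      refine ⟨(r - ‖v - o‖)⁻¹ • (v - o), (hscale _ _ hpos).2 ((hkey _).2 ⟨h3, h4⟩), ?_⟩
      simp only [f, norm_smul, Real.norm_of_nonneg hpos.le, smul_smul]
      have h5 : r / (1 + (r - ‖v - o‖)⁻¹ * ‖v - o‖) * (r - ‖v - o‖)⁻¹ = 1 := by
        have : r - ‖v - o‖ ≠ 0 := by linarith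
        have h6 : r - ‖v - o‖ + ‖v - o‖ ≠ 0 := by linarith
        field_simp
        ring
      rw [h5, one_smul, add_sub_cancel]
  rw [← himg]
  exact ⟨h1.nonempty.image f, h1.isPreconnected.image f hf.continuousOn⟩

/-- Covering maps onto a punctured ball of dimension at least three have sections. -/
theorem IsCoveringMap.exists_section_puncturedBall (hV : 2 < Module.finrank ℝ V) {o : V} {r : ℝ}
    {E : Type*} [TopologicalSpace E] {p : E → puncturedBall o r} (hp : IsCoveringMap p) (y : E) :
    ∃ s : puncturedBall o r → E, Continuous s ∧ (∀ v, p (s v) = v) ∧ s (p y) = y := by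
  have hr : 0 < r := Metric.nonempty_ball.1 ⟨_, (p y).2.1⟩
  -- The slit is taken opposite to the base point, which then belongs to the first of the two slit
  -- balls.
  obtain ⟨e, he⟩ : ∃ e : V, ‖e‖ = 1 ∧ 0 < ‖(p y : V) - o‖ + inner ℝ ((p y : V) - o) e := by
    have h0 : (p y : V) - o ≠ 0 := sub_ne_zero.2 (p y).2.2
    refine ⟨‖(p y : V) - o‖⁻¹ • ((p y : V) - o), ?_, ?_⟩
    · rw [norm_smul, norm_inv, norm_norm, inv_mul_cancel₀ (norm_ne_zero_iff.2 h0)]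
    · rw [inner_smul_right, real_inner_self_eq_norm_sq]
      have := norm_pos_iff.2 h0
      positivity
  set A := slitBall o r e with hA
  set B := slitBall o r (-e) with hB
  have hAB : A ∪ B = puncturedBall o r := slitBall_union o r e
  have hAo : IsOpen A := isOpen_slitBall o r e
  have hBo : IsOpen B := isOpen_slitBall o r (-e)
  obtain ⟨⟨x, hxA, hxB⟩, hconn⟩ := isPreconnected_slitBall_inter hV o hr he.1
  have sA := starConvex_slitBall o hr he.1
  have sB := starConvex_slitBall o hr (e := -e) (by rw [norm_neg]; exact he.1)
  have : ContractibleSpace A := sA.1.contractibleSpace_coe sA.2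
  have : ContractibleSpace B := sB.1.contractibleSpace_coe sB.2
  have : LocallyPathConnectedSpace A := hAo.locallyPathConnectedSpace
  have : LocallyPathConnectedSpace B := hBo.locallyPathConnectedSpace
  have hmem : ∀ v : puncturedBall o r, (v : V) ∈ A ∪ B := fun v => by rw [hAB]; exact v.2
  have hAs : ∀ v : A, (v : V) ∈ puncturedBall o r := fun v => hAB ▸ Or.inl v.2
  have hBs : ∀ v : B, (v : V) ∈ puncturedBall o r := fun v => hAB ▸ Or.inr v.2
  let iA : C(A, puncturedBall o r) := ⟨fun v => ⟨v, hAs v⟩, by fun_prop⟩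
  let iB : C(B, puncturedBall o r) := ⟨fun v => ⟨v, hBs v⟩, by fun_prop⟩
  have hyA : (p y : V) ∈ A := ⟨(p y).2.1, he.2⟩
  obtain ⟨FA, ⟨hFA0, hFA⟩, -⟩ := hp.existsUnique_continuousMap_lifts iA ⟨p y, hyA⟩ y rfl
  -- The second lift is normalized to agree with the first at one point of the intersection;
  -- connectedness makes them agree on all of it.
  obtain ⟨FB, ⟨hFB0, hFB⟩, -⟩ := hp.existsUnique_continuousMap_lifts iB ⟨x, hxB⟩ (FA ⟨x, hxA⟩)
    (congrFun hFA ⟨x, hxA⟩)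
  classical
  let sA' : puncturedBall o r → E := fun v => if h : (v : V) ∈ A then FA ⟨v, h⟩ else y
  let sB' : puncturedBall o r → E := fun v => if h : (v : V) ∈ B then FB ⟨v, h⟩ else y
  have hcA : ContinuousOn sA' (Subtype.val ⁻¹' A) := by
    rw [continuousOn_iff_continuous_domRestrict]
    have : (Subtype.val ⁻¹' A).domRestrict sA' = fun v => FA ⟨v.1.1, v.2⟩ := by
      funext v
      exact dif_pos v.2
    rw [this]
    exact FA.continuous.comp (by fun_prop)
  have hcB : ContinuousOn sB' (Subtype.val ⁻¹' B) := by
    rw [continuousOn_iff_continuous_domRestrict]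
    have : (Subtype.val ⁻¹' B).domRestrict sB' = fun v => FB ⟨v.1.1, v.2⟩ := by
      funext v
      exact dif_pos v.2
    rw [this]
    exact FB.continuous.comp (by fun_prop)
  have hpA : ∀ v : puncturedBall o r, (v : V) ∈ A → p (sA' v) = v := by
    intro v hv
    simp only [sA', dif_pos hv]
    exact congrFun hFA ⟨v, hv⟩
  have hpB : ∀ v : puncturedBall o r, (v : V) ∈ B → p (sB' v) = v := by
    intro v hv
    simp only [sB', dif_pos hv]
    exact congrFun hFB ⟨v, hv⟩
  have hconn' : IsPreconnected (Subtype.val ⁻¹' (A ∩ B) : Set (puncturedBall o r)) := by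
    rw [← Topology.IsInducing.subtypeVal.isPreconnected_image, Subtype.image_preimage_coe,
      Set.inter_eq_right.2 (fun v hv => hAB ▸ Or.inl hv.1)]
    exact hconn
  have heq : Set.EqOn sA' sB' (Subtype.val ⁻¹' (A ∩ B)) := by
    refine hp.eqOn_of_comp_eqOn (a := ⟨x, hAs ⟨x, hxA⟩⟩) hconn' (hcA.mono fun v hv => hv.1)
      (hcB.mono fun v hv => hv.2) (fun v hv => ?_) ⟨hxA, hxB⟩ ?_
    · rw [Function.comp_apply, Function.comp_apply, hpA v hv.1, hpB v hv.2]
    · have h1 : sA' ⟨x, hAs ⟨x, hxA⟩⟩ = FA ⟨x, hxA⟩ := dif_pos hxA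
      have h2 : sB' ⟨x, hAs ⟨x, hxA⟩⟩ = FB ⟨x, hxB⟩ := dif_pos hxB
      rw [h1, h2, hFB0]
  refine ⟨fun v => if (v : V) ∈ A then sA' v else sB' v, ?_, ?_, ?_⟩
  · rw [continuous_iff_continuousAt]
    intro v
    rcases hmem v with hv | hv
    · have hn := (hAo.preimage continuous_subtype_val).mem_nhds hv
      refine (hcA.continuousAt hn).congr ?_
      filter_upwards [hn] with w hw
      exact (if_pos hw).symm
    · have hn := (hBo.preimage continuous_subtype_val).mem_nhds hv
      refine (hcB.continuousAt hn).congr ?_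
      filter_upwards [hn] with w hw
      by_cases hwA : (w : V) ∈ A
      · rw [if_pos hwA, heq ⟨hwA, hw⟩]
      · rw [if_neg hwA]
  · intro v
    by_cases hv : (v : V) ∈ A
    · simp only [if_pos hv, hpA v hv]
    · simp only [if_neg hv]
      exact hpB v ((hmem v).resolve_left hv)
  · simp only [if_pos hyA, sA', dif_pos hyA, hFA0]

/-- A flat bundle with discrete structure group over a punctured ball of dimension at least three
is trivial. -/
theorem exists_trivialization_puncturedBall (hV : 2 < Module.finrank ℝ V) {o : V} {r : ℝ}
    {Γ : Type*} [Group Γ] (U : puncturedBall o r → Set (puncturedBall o r))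
    (hU : ∀ y, IsOpen (U y)) (hmem : ∀ y, y ∈ U y)
    (τ : puncturedBall o r → puncturedBall o r → Γ)
    (hτ : ∀ y y' z, z ∈ U y → z ∈ U y' →
      ∀ᶠ z' in 𝓝 z, τ y z' * (τ y' z')⁻¹ = τ y z * (τ y' z)⁻¹) :
    ∃ κ : puncturedBall o r → Γ, ∀ y z, z ∈ U y → ∀ᶠ z' in 𝓝 z, τ y z' * κ z' = τ y z * κ z := by
  rcases isEmpty_or_nonempty (puncturedBall o r) with hem | ⟨⟨y₀⟩⟩
  · exact ⟨fun _ => 1, fun y => isEmptyElim y⟩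
  let _ : TopologicalSpace Γ := ⊥
  have : DiscreteTopology Γ := ⟨rfl⟩
  -- The bundle with transition functions `τ j * (τ i)⁻¹`. Its fibres are discrete, so its
  -- projection is a covering and has a section.
  let Z : FiberBundleCore (puncturedBall o r) (puncturedBall o r) Γ :=
    { baseSet := U
      isOpen_baseSet := hU
      indexAt := id
      mem_baseSet_at := hmem
      coordChange := fun i j x v => τ j x * (τ i x)⁻¹ * v
      coordChange_self := fun i x _ v => by simp
      continuousOn_coordChange := by
        rintro i j ⟨z, v⟩ ⟨⟨hi, hj⟩, -⟩
        refine ContinuousAt.continuousWithinAt ?_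
        have h1 : (fun p : puncturedBall o r × Γ => τ j z * (τ i z)⁻¹ * p.2) =ᶠ[𝓝 (z, v)]
            fun p => τ j p.1 * (τ i p.1)⁻¹ * p.2 := by
          filter_upwards [continuousAt_fst.eventually (hτ j i z hj hi)] with p hp
          rw [hp]
        refine ContinuousAt.congr ?_ h1
        exact ((continuous_of_discreteTopology (f := fun v : Γ => τ j z * (τ i z)⁻¹ * v)).comp
          continuous_snd).continuousAt
      coordChange_comp := fun i j k x _ v => by group }
  have hcov : IsCoveringMap (Bundle.TotalSpace.proj : Z.TotalSpace → puncturedBall o r) :=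
    FiberBundle.isCoveringMap (F := Γ) (E := Z.Fiber)
  obtain ⟨s, hs, hps, -⟩ := hcov.exists_section_puncturedBall hV ⟨y₀, (1 : Γ)⟩
  let snd : Z.TotalSpace → Γ := fun q => q.2
  -- The fibre over `z` is read in the chart with index `z`. Passing to the chart `y` multiplies by
  -- `τ y z * (τ z z)⁻¹`, and there the section is locally constant.
  refine ⟨fun z => (τ z z)⁻¹ * snd (s z), fun y z hz => ?_⟩
  have hsrc : s z ∈ (Z.localTriv y).source := by
    rw [Z.mem_localTriv_source, hps]; exact hz
  have h1 : ContinuousAt (fun z' => (Z.localTriv y (s z')).2) z :=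
    continuousAt_snd.comp (((Z.localTriv y).continuousAt hsrc).comp hs.continuousAt)
  have h2 : ∀ z', (Z.localTriv y (s z')).2 = τ y z' * ((τ z' z')⁻¹ * snd (s z')) := by
    intro z'
    have h5 : ∀ q : Z.TotalSpace,
        (Z.localTriv y q).2 = τ y q.1 * ((τ q.1 q.1)⁻¹ * snd q) := fun q => mul_assoc _ _ _
    rw [h5, hps]
  have h4 := h1.eventually (p := fun g => g = (Z.localTriv y (s z)).2)
    ((isOpen_discrete {(Z.localTriv y (s z)).2}).mem_nhds rfl)
  filter_upwards [h4] with z' hz'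
  rw [h2, h2] at hz'
  exact hz'

end PuncturedBall

/-! ### Points of the glued space and their representatives -/

theorem stdSimplex.map_perm_apply {ι : Type*} [Fintype ι] (π : Equiv.Perm ι)
    (u : stdSimplex ℝ ι) (j : ι) : stdSimplex.map π u (π j) = u j := by
  classical
  rw [stdSimplex.map_coe, FunOnFinite.linearMap_apply_apply]
  have : (Finset.univ.filter fun x => π x = π j) = {j} := by ext; simp
  rw [this, Finset.sum_singleton]

theorem stdSimplex.map_perm_apply' {ι : Type*} [Fintype ι] (π : Equiv.Perm ι)
    (u : stdSimplex ℝ ι) (j : ι) : stdSimplex.map π u j = u (π⁻¹ j) := by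
  rw [← stdSimplex.map_perm_apply π u]
  exact congrArg _ (π.apply_symm_apply j).symm

theorem stdSimplex.map_inv_map {ι : Type*} [Fintype ι] (π : Equiv.Perm ι)
    (u : stdSimplex ℝ ι) : stdSimplex.map (π⁻¹ : Equiv.Perm ι) (stdSimplex.map π u) = u := by
  ext j
  rw [stdSimplex.map_perm_apply', stdSimplex.map_perm_apply', inv_inv]
  exact congrArg u (π.symm_apply_apply j)

theorem stdSimplex.continuous_map_perm {ι : Type*} [Fintype ι] (π : Equiv.Perm ι) :
    Continuous (stdSimplex.map π : stdSimplex ℝ ι → stdSimplex ℝ ι) := by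
  rw [continuous_induced_rng]
  refine continuous_pi fun j => ?_
  have : (fun u : stdSimplex ℝ ι => (Subtype.val ∘ stdSimplex.map π) u j) =
      fun u => u.1 (π⁻¹ j) := by
    funext u
    exact stdSimplex.map_perm_apply' π u j
  rw [this]
  exact (continuous_apply _).comp continuous_subtype_val

namespace FacetGluing

variable {T : Type*} {n : ℕ} {G : FacetGluing T n}

section Points

theorem point_nbr (t : T) {u : stdSimplex ℝ (Fin (n + 1))} {i : Fin (n + 1)} (h : u i = 0) :
    G.point (G.nbr t i) (stdSimplex.map (G.perm t i) u) = G.point t u :=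
  (Quot.sound ⟨i, h, rfl⟩).symm

theorem PointStep.symm {c d : Σ _ : T, stdSimplex ℝ (Fin (n + 1))} (h : G.PointStep c d) :
    G.PointStep d c := by
  obtain ⟨i, h0, rfl⟩ := h
  refine ⟨G.perm c.1 i i, by rw [stdSimplex.map_perm_apply, h0], ?_⟩
  refine Sigma.ext (G.nbr_nbr _ _).symm (heq_of_eq ?_)
  change c.2 = stdSimplex.map (G.perm (G.nbr c.1 i) (G.perm c.1 i i)) (stdSimplex.map _ c.2)
  rw [G.perm_perm, stdSimplex.map_inv_map]

/-- Crossing a facet can be undone by crossing it back, so directed chains already generate the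
equivalence relation, and invariants have to be checked in one direction only. -/
theorem reflTransGen_of_point_eq {t t' : T} {u u' : stdSimplex ℝ (Fin (n + 1))}
    (h : G.point t u = G.point t' u') : Relation.ReflTransGen G.PointStep ⟨t, u⟩ ⟨t', u'⟩ := by
  have h1 := Quot.eqvGen_exact h
  generalize (⟨t, u⟩ : Σ _ : T, stdSimplex ℝ (Fin (n + 1))) = c at h1
  generalize (⟨t', u'⟩ : Σ _ : T, stdSimplex ℝ (Fin (n + 1))) = d at h1
  induction h1 with
  | rel _ _ h => exact .single h
  | refl _ => exact .refl
  | symm _ _ _ ih =>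
    have : Std.Symm G.PointStep := ⟨fun _ _ h => h.symm⟩
    exact Relation.ReflTransGen.stdSymm.symm _ _ ih
  | trans _ _ _ _ _ ih1 ih2 => exact ih1.trans ih2

/-- A property of points of simplices that passes through facet identifications depends only on
the represented point. -/
theorem point_induction {P : T → stdSimplex ℝ (Fin (n + 1)) → Prop}
    (hP : ∀ t u i, u i = 0 → P t u → P (G.nbr t i) (stdSimplex.map (G.perm t i) u))
    {t t' : T} {u u' : stdSimplex ℝ (Fin (n + 1))} (h : G.point t u = G.point t' u')
    (h0 : P t u) : P t' u' := by
  have h1 := reflTransGen_of_point_eq h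
  have h2 : ∀ d, Relation.ReflTransGen G.PointStep ⟨t, u⟩ d → P d.1 d.2 := by
    intro d hd
    induction hd with
    | refl => exact h0
    | tail _ hs ih =>
      obtain ⟨i, hi, rfl⟩ := hs
      exact hP _ _ i hi ih
  exact h2 _ h1

theorem exists_perm_of_point_eq {t t' : T} {u u' : stdSimplex ℝ (Fin (n + 1))}
    (h : G.point t u = G.point t' u') :
    ∃ π : Equiv.Perm (Fin (n + 1)), u' = stdSimplex.map π u := by
  refine point_induction (P := fun _ u' => ∃ π : Equiv.Perm (Fin (n + 1)),
    u' = stdSimplex.map π u) ?_ h ⟨1, ?_⟩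
  · rintro t _ i - ⟨π, rfl⟩
    exact ⟨G.perm t i * π, by rw [stdSimplex.map_comp_apply]; rfl⟩
  · exact (stdSimplex.map_id_apply u).symm

/-- All representatives of a point have the same barycentric coordinates up to a permutation. -/
theorem finite_point_fiber [Finite T] (y : G.Space) :
    {c : T × stdSimplex ℝ (Fin (n + 1)) | G.point c.1 c.2 = y}.Finite := by
  rcases Set.eq_empty_or_nonempty {c : T × stdSimplex ℝ (Fin (n + 1)) | G.point c.1 c.2 = y} with
    h | ⟨⟨t, u⟩, rfl⟩
  · rw [h]; exact Set.finite_empty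
  · refine (Set.finite_range fun c : T × Equiv.Perm (Fin (n + 1)) =>
      (c.1, stdSimplex.map c.2 u)).subset ?_
    rintro ⟨t', u'⟩ h
    obtain ⟨π, rfl⟩ := exists_perm_of_point_eq (G := G) (Eq.symm h : G.point t u = _)
    exact ⟨(t', π), rfl⟩

theorem exists_point_eq (y : G.Space) : ∃ t u, G.point t u = y := by
  obtain ⟨⟨t, u⟩, rfl⟩ := Quot.exists_rep y
  exact ⟨t, u, rfl⟩

theorem continuous_point (t : T) : Continuous (G.point t) :=
  continuous_quot_mk.comp continuous_sigmaMk

theorem isOpen_iff_point {W : Set G.Space} : IsOpen W ↔ ∀ t, IsOpen (G.point t ⁻¹' W) := by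
  rw [← isQuotientMap_quot_mk.isOpen_preimage, isOpen_sigma_iff]
  rfl


/-- A neighbourhood of all representatives of a point contains the representatives of all nearby
points. -/
theorem eventually_forall_point [Finite T] [T2Space G.Space] {y : G.Space}
    {P : T → stdSimplex ℝ (Fin (n + 1)) → Prop}
    (h : ∀ t u, G.point t u = y → ∀ᶠ w in 𝓝 u, P t w) :
    ∀ᶠ z in 𝓝 y, ∀ t w, G.point t w = z → P t w := by
  -- A simplex is compact and the glued space is Hausdorff.
  have hclosed : ∀ t, IsClosedMap (G.point t) := fun t => (continuous_point t).isClosedMap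
  have h1 : ∀ t, ∀ᶠ z in 𝓝 y, ∀ w, G.point t w = z → P t w := by
    intro t
    have h2 : ∀ u, G.point t u = y → u ∈ interior {w | P t w} := fun u hu =>
      mem_interior_iff_mem_nhds.2 (h t u hu)
    have h3 := (hclosed t _ (isOpen_interior (s := {w | P t w})).isClosed_compl).isOpen_compl
    have h4 : y ∈ (G.point t '' (interior {w | P t w})ᶜ)ᶜ := by
      rintro ⟨u, hu, hy⟩
      exact hu (h2 u hy)
    filter_upwards [h3.mem_nhds h4] with z hz w hw
    by_contra hcon
    exact hz ⟨w, fun hw' => hcon (interior_subset hw'), hw⟩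
  filter_upwards [Filter.eventually_all.2 h1] with z hz t w using hz t w

theorem compactSpace_space [Finite T] : CompactSpace G.Space :=
  inferInstanceAs (CompactSpace (Quot G.PointStep))

end Points

/-! ### Developments with values in a group -/

section Developments

variable {Γ : Type*} [Group Γ]

/-- A system `γ` of elements of `Γ`, one for each point of each simplex lying over the open set
`W`, that is locally constant on the simplices and changes by `h` across facets. -/
structure IsDevelopment (G : FacetGluing T n) (h : T → Fin (n + 1) → Γ) (W : Set G.Space)
    (γ : T → stdSimplex ℝ (Fin (n + 1)) → Γ) : Prop where
  isOpen : IsOpen W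
  eventually_eq : ∀ t u, G.point t u ∈ W → ∀ᶠ w in 𝓝 u, γ t w = γ t u
  crossing : ∀ t u i, G.point t u ∈ W → u i = 0 →
    γ (G.nbr t i) (stdSimplex.map (G.perm t i) u) = γ t u * h t i

variable {h : T → Fin (n + 1) → Γ} {W W' : Set G.Space}
  {γ γ' : T → stdSimplex ℝ (Fin (n + 1)) → Γ}

theorem IsDevelopment.mono (hγ : G.IsDevelopment h W γ) (hW' : IsOpen W') (h1 : W' ⊆ W) :
    G.IsDevelopment h W' γ :=
  ⟨hW', fun t u hu => hγ.eventually_eq t u (h1 hu), fun t u i hu => hγ.crossing t u i (h1 hu)⟩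

/-- Both systems are multiplied on the right by the same element when a facet is crossed, so the
left quotient depends on the point only, not on its representative. -/
theorem IsDevelopment.ratio_eq (hγ : G.IsDevelopment h W γ) (hγ' : G.IsDevelopment h W' γ')
    {t t' : T} {u u' : stdSimplex ℝ (Fin (n + 1))} (heq : G.point t u = G.point t' u')
    (hW : G.point t u ∈ W) (hW' : G.point t u ∈ W') :
    γ t' u' * (γ' t' u')⁻¹ = γ t u * (γ' t u)⁻¹ := by
  have := point_induction (G := G) (P := fun t' u' => (G.point t' u' ∈ W ∧ G.point t' u' ∈ W') ∧
    γ t' u' * (γ' t' u')⁻¹ = γ t u * (γ' t u)⁻¹) ?_ heq ⟨⟨hW, hW'⟩, rfl⟩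
  · exact this.2
  · rintro s v i hi ⟨⟨h1, h2⟩, h3⟩
    rw [point_nbr s hi]
    refine ⟨⟨h1, h2⟩, ?_⟩
    rw [hγ.crossing s v i h1 hi, hγ'.crossing s v i h2 hi, ← h3]
    group

/-- Two developments differ locally by a constant left factor. -/
theorem IsDevelopment.eventually_ratio_eq (hγ : G.IsDevelopment h W γ)
    (hγ' : G.IsDevelopment h W' γ') {t : T} {u : stdSimplex ℝ (Fin (n + 1))}
    (hW : G.point t u ∈ W) (hW' : G.point t u ∈ W') :
    ∀ᶠ z in 𝓝 (G.point t u), ∀ s w, G.point s w = z →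
      γ s w * (γ' s w)⁻¹ = γ t u * (γ' t u)⁻¹ := by
  set a := γ t u * (γ' t u)⁻¹ with ha
  set O : Set G.Space := {z | z ∈ W ∩ W' ∧ ∀ s w, G.point s w = z → γ s w * (γ' s w)⁻¹ = a}
  have hO : IsOpen O := by
    refine isOpen_iff_point.2 fun s => isOpen_iff_mem_nhds.2 fun w hw => ?_
    obtain ⟨⟨h1, h2⟩, h3⟩ := hw
    filter_upwards [hγ.eventually_eq s w h1, hγ'.eventually_eq s w h2,
      (continuous_point s).continuousAt.preimage_mem_nhds
        ((hγ.isOpen.inter hγ'.isOpen).mem_nhds ⟨h1, h2⟩)] with v hv hv' hvW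
    refine ⟨hvW, fun s' w' h4 => ?_⟩
    rw [hγ.ratio_eq hγ' h4.symm hvW.1 hvW.2, hv, hv', h3 s w rfl]
  have hu : G.point t u ∈ O := ⟨⟨hW, hW'⟩, fun s w h4 => hγ.ratio_eq hγ' h4.symm hW hW'⟩
  filter_upwards [hO.mem_nhds hu] with z hz using hz.2

end Developments

end FacetGluing

/-! ### Punctured neighbourhoods of boundary points of a simplex -/

namespace stdSimplex

variable {ι : Type*} [Fintype ι]

/-- The point dividing the segment from `u` to `v` in the ratio `s : 1 - s`. -/
def segment (u v : stdSimplex ℝ ι) (s : unitInterval) : stdSimplex ℝ ι :=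
  ⟨fun j => (1 - (s : ℝ)) * u j + s * v j,
    convex_stdSimplex ℝ ι u.2 v.2 (sub_nonneg.2 s.2.2) s.2.1 (by ring)⟩

theorem segment_apply (u v : stdSimplex ℝ ι) (s : unitInterval) (j : ι) :
    segment u v s j = (1 - (s : ℝ)) * u j + s * v j := rfl

theorem segment_zero (u v : stdSimplex ℝ ι) : segment u v 0 = u := by
  ext j; simp [segment_apply]

theorem segment_one (u v : stdSimplex ℝ ι) : segment u v 1 = v := by
  ext j; simp [segment_apply]

theorem continuous_segment (u v : stdSimplex ℝ ι) : Continuous (segment u v) := by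
  refine Continuous.subtype_mk (continuous_pi fun j => ?_) _
  fun_prop

theorem segment_ne {u v : stdSimplex ℝ ι} (h : u ≠ v) {s : unitInterval} (hs : s ≠ 0) :
    segment u v s ≠ u := by
  intro h1
  refine h (stdSimplex.ext (funext fun j => ?_))
  have h2 := congrArg (fun w : stdSimplex ℝ ι => w j) h1
  simp only [segment_apply] at h2
  have h3 : (s : ℝ) ≠ 0 := fun h => hs (Subtype.ext h)
  have h4 : (s : ℝ) * (v j - u j) = 0 := by linarith
  rcases mul_eq_zero.1 h4 with h5 | h5
  · exact absurd h5 h3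
  · linarith

/-- Near a point of a facet of dimension at least one there are other points of the facet. -/
theorem frequently_facet {n : ℕ} (hn : 2 ≤ n) (u : stdSimplex ℝ (Fin (n + 1))) {i : Fin (n + 1)}
    (hi : u i = 0) : ∃ᶠ w in 𝓝[≠] u, w i = 0 := by
  classical
  obtain ⟨k, hk, -⟩ := exists_ne_ne hn i i
  obtain ⟨k', hk', hkk'⟩ := exists_ne_ne hn i k
  have hv : ∀ m : Fin (n + 1), ∃ v : stdSimplex ℝ (Fin (n + 1)), v m = 1 ∧ ∀ j ≠ m, v j = 0 :=
    fun m => ⟨⟨_, single_mem_stdSimplex ℝ m⟩, Pi.single_eq_same m 1, fun j hj =>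
      Pi.single_eq_of_ne hj 1⟩
  obtain ⟨v, hv1, hv2⟩ : ∃ v : stdSimplex ℝ (Fin (n + 1)), u ≠ v ∧ v i = 0 := by
    obtain ⟨a, ha, ha'⟩ := hv k
    obtain ⟨b, hb, hb'⟩ := hv k'
    by_cases h : u = a
    · refine ⟨b, ?_, hb' i hk'.symm⟩
      rintro rfl
      rw [h, ha' _ hkk'] at hb
      norm_num at hb
    · exact ⟨a, h, ha' i hk.symm⟩
  have h1 : Filter.Tendsto (segment u v) (𝓝[≠] 0) (𝓝[≠] u) := by
    refine tendsto_nhdsWithin_iff.2 ⟨?_, ?_⟩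
    · have := (continuous_segment u v).tendsto 0
      rw [segment_zero] at this
      exact this.mono_left nhdsWithin_le_nhds
    · filter_upwards [self_mem_nhdsWithin] with s hs using segment_ne hv1 hs
  refine h1.frequently (Filter.Eventually.frequently (.of_forall fun s => ?_))
  rw [segment_apply, hi, hv2]
  ring

/-- A convex relatively open subset of a simplex stays connected when a boundary point of the
simplex is removed. -/
theorem isPreconnected_sdiff_singleton {u : stdSimplex ℝ ι} {i : ι} (hi : u i = 0)
    {B : Set (stdSimplex ℝ ι)} (hB : IsOpen B) (hconv : Convex ℝ (Subtype.val '' B)) :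
    IsPreconnected (B \ {u}) := by
  classical
  rw [← Topology.IsInducing.subtypeVal.isPreconnected_image]
  -- A convex set that misses `u`. The set in question lies between `C` and its closure, so it is
  -- connected as well.
  set C : Set (ι → ℝ) := (Subtype.val '' B) ∩ {x | 0 < x i}
  have hC : IsPreconnected C := by
    refine (hconv.inter ?_).isPreconnected
    intro x hx y hy a b ha hb hab
    rcases ha.eq_or_lt with rfl | ha'
    · have : b = 1 := by linarith
      simpa [this] using hy
    · have h1 : 0 < a * x i := mul_pos ha' hx
      have h2 : 0 ≤ b * y i := mul_nonneg hb (le_of_lt hy)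
      change 0 < a * x i + b * y i
      linarith
  refine hC.subset_closure ?_ ?_
  · rintro - ⟨⟨x, hx, rfl⟩, h0⟩
    refine ⟨x, ⟨hx, ?_⟩, rfl⟩
    rintro rfl
    exact (lt_irrefl (0 : ℝ)) (hi ▸ h0)
  · rintro - ⟨w, ⟨hw, -⟩, rfl⟩
    let e : stdSimplex ℝ ι := ⟨_, single_mem_stdSimplex ℝ i⟩
    have he : e i = 1 := Pi.single_eq_same i 1
    have h1 : Filter.Tendsto (segment w e) (𝓝[≠] 0) (𝓝 w) := by
      have := (continuous_segment w e).tendsto 0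
      rw [segment_zero] at this
      exact this.mono_left nhdsWithin_le_nhds
    refine mem_closure_of_tendsto ((continuous_subtype_val.tendsto _).comp h1) ?_
    filter_upwards [h1.eventually (hB.mem_nhds hw), self_mem_nhdsWithin] with s hs hs0
    refine ⟨⟨_, hs, rfl⟩, ?_⟩
    change 0 < (1 - (s : ℝ)) * w i + s * e i
    have h2 : 0 < (s : ℝ) := lt_of_le_of_ne s.2.1 fun h => hs0 (Subtype.ext h.symm)
    have h3 : 0 ≤ (1 - (s : ℝ)) * w i := mul_nonneg (sub_nonneg.2 s.2.2) (stdSimplex.zero_le w i)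
    rw [he]
    linarith

/-- A function on a simplex that is locally constant on a punctured neighbourhood of a boundary
point is constant on such a neighbourhood. -/
theorem eventually_const_of_boundary {α : Type*} {u : stdSimplex ℝ ι} {i : ι} (hi : u i = 0)
    {f : stdSimplex ℝ ι → α} (hf : ∀ᶠ w in 𝓝[≠] u, ∀ᶠ w' in 𝓝 w, f w' = f w) :
    ∃ a, ∀ᶠ w in 𝓝[≠] u, f w = a := by
  classical
  obtain ⟨ε, hε, hball⟩ := Metric.mem_nhdsWithin_iff.1 hf
  have himg : Subtype.val '' Metric.ball u ε = stdSimplex ℝ ι ∩ Metric.ball (u : ι → ℝ) ε := by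
    ext x
    constructor
    · rintro ⟨x, hx, rfl⟩
      exact ⟨x.2, hx⟩
    · rintro ⟨hx, hb⟩
      exact ⟨⟨x, hx⟩, hb, rfl⟩
  have hP := isPreconnected_sdiff_singleton hi (Metric.isOpen_ball (x := u) (ε := ε))
    (himg ▸ (convex_stdSimplex ℝ ι).inter (convex_ball _ _))
  set P : Set (stdSimplex ℝ ι) := Metric.ball u ε ∩ {u}ᶜ
  rcases P.eq_empty_or_nonempty with hem | ⟨p, hp⟩
  · exact ⟨f u, Metric.mem_nhdsWithin_iff.2 ⟨ε, hε, fun w hw => (hem ▸ hw : w ∈ (∅ : Set _)).elim⟩⟩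
  · refine ⟨f p, Metric.mem_nhdsWithin_iff.2 ⟨ε, hε, fun w hw => ?_⟩⟩
    let _ : TopologicalSpace α := ⊥
    have : DiscreteTopology α := ⟨rfl⟩
    refine hP.constant (f := f) (fun w hw => ContinuousAt.continuousWithinAt ?_) hw hp
    exact continuousAt_const.congr ((hball hw).mono fun _ h => h.symm)

end stdSimplex

/-! ### Existence of a development around an isolated point -/

namespace FacetGluing

variable {T : Type*} {n : ℕ} {G : FacetGluing T n} {Γ : Type*} [Group Γ]
  {h : T → Fin (n + 1) → Γ}

theorem exists_zero_of_point_eq {t t' : T} {u u' : stdSimplex ℝ (Fin (n + 1))}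
    (h : G.point t u = G.point t' u') (h0 : ∃ i, u i = 0) : ∃ i, u' i = 0 := by
  obtain ⟨π, rfl⟩ := exists_perm_of_point_eq h
  obtain ⟨i, hi⟩ := h0
  exact ⟨π i, by rw [stdSimplex.map_perm_apply, hi]⟩

theorem eventually_point_ne [Finite T] (t : T) (u : stdSimplex ℝ (Fin (n + 1))) (x : G.Space) :
    ∀ᶠ w in 𝓝[≠] u, G.point t w ≠ x := by
  have h1 : {w | G.point t w = x}.Finite :=
    ((finite_point_fiber x).preimage ((Prod.mk_right_injective t).injOn)).subset fun w hw => hw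
  have h2 := (h1.subset Set.sdiff_subset : ({w | G.point t w = x} \ {u}).Finite).isClosed
  filter_upwards [nhdsWithin_le_nhds (h2.isOpen_compl.mem_nhds (fun h => h.2 rfl)),
    self_mem_nhdsWithin] with w hw hne heq
  exact hw ⟨heq, hne⟩

/-- A development on a punctured neighbourhood of a boundary point extends to the point. -/
theorem IsDevelopment.extend [Finite T] [T2Space G.Space] (hn : 2 ≤ n) {W : Set G.Space}
    (hW : IsOpen W) {x : G.Space} {γ : T → stdSimplex ℝ (Fin (n + 1)) → Γ}
    (hγ : G.IsDevelopment h (W \ {x}) γ)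
    (hx : ∀ t u, G.point t u = x → ∃ i, u i = 0) : ∃ γ', G.IsDevelopment h W γ' := by
  classical
  rcases em (x ∈ W) with hxW | hxW
  swap
  · exact ⟨γ, hγ.mono hW fun z hz => ⟨hz, fun h => hxW (h ▸ hz)⟩⟩
  have hnear : ∀ t u, G.point t u = x → ∀ᶠ w in 𝓝[≠] u, G.point t w ∈ W \ {x} := by
    intro t u hu
    filter_upwards [eventually_point_ne t u x, nhdsWithin_le_nhds
      ((continuous_point t).continuousAt.preimage_mem_nhds (hW.mem_nhds (hu ▸ hxW)))]
      with w hw hw' using ⟨hw', hw⟩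
  have hconst : ∀ t u, ∃ a, G.point t u = x → ∀ᶠ w in 𝓝[≠] u, γ t w = a := by
    intro t u
    by_cases hu : G.point t u = x
    · obtain ⟨i, hi⟩ := hx t u hu
      obtain ⟨a, ha⟩ := stdSimplex.eventually_const_of_boundary hi (f := γ t)
        ((hnear t u hu).mono fun w hw => hγ.eventually_eq t w hw)
      exact ⟨a, fun _ => ha⟩
    · exact ⟨1, fun h => absurd h hu⟩
  choose a ha using hconst
  refine ⟨fun t w => if G.point t w = x then a t w else γ t w, hW, ?_, ?_⟩
  · intro t u hu
    by_cases hux : G.point t u = x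
    · have h1 := (ha t u hux).and (hnear t u hux)
      rw [eventually_nhdsWithin_iff] at h1
      filter_upwards [h1] with w hw
      by_cases hwu : w = u
      · rw [hwu]
      · rw [if_pos hux, if_neg (show G.point t w ≠ x from (hw hwu).2.2), (hw hwu).1]
    · filter_upwards [hγ.eventually_eq t u ⟨hu, hux⟩,
        (continuous_point t).continuousAt.preimage_mem_nhds (isOpen_ne.mem_nhds hux)] with w hw hwx
      rw [if_neg hwx, if_neg hux, hw]
  · intro t u i hu hi
    rw [point_nbr t hi]
    by_cases hux : G.point t u = x
    · rw [if_pos hux, if_pos hux]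
      have hcont : Filter.Tendsto (stdSimplex.map (G.perm t i)) (𝓝[≠] u)
          (𝓝[≠] (stdSimplex.map (G.perm t i) u)) := by
        refine tendsto_nhdsWithin_iff.2 ⟨((stdSimplex.continuous_map_perm _).tendsto u).mono_left
          nhdsWithin_le_nhds, ?_⟩
        filter_upwards [self_mem_nhdsWithin] with w hw heq
        refine hw ?_
        have := congrArg (stdSimplex.map ((G.perm t i)⁻¹ : Equiv.Perm _)) heq
        rwa [stdSimplex.map_inv_map, stdSimplex.map_inv_map] at this
      have h1 := hcont.eventually (ha (G.nbr t i) _ ((point_nbr t hi).trans hux))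
      -- The crossing relation at `x` is inherited from other points of the same facet close to `u`.
      obtain ⟨w, hw0, hw1, hw2, hw3⟩ := ((stdSimplex.frequently_facet hn u hi).and_eventually
        (h1.and ((ha t u hux).and (hnear t u hux)))).exists
      rw [← hw1, ← hw2, hγ.crossing t w i hw3 hw0]
    · rw [if_neg hux, if_neg hux, hγ.crossing t u i ⟨hu, hux⟩ hi]

/-- In a manifold of dimension at least three, a development near a point exists if developments
exist near all nearby points. -/
theorem exists_development_of_punctured [Finite T] [T2Space G.Space] (hn : 3 ≤ n) {x : G.Space}
    (φ : OpenPartialHomeomorph G.Space (EuclideanSpace ℝ (Fin n))) (hxφ : x ∈ φ.source)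
    (hx : ∀ t u, G.point t u = x → ∃ i, u i = 0)
    (hdev : ∀ᶠ y in 𝓝[≠] x, ∃ W γ, y ∈ W ∧ G.IsDevelopment h W γ) :
    ∃ W γ, x ∈ W ∧ G.IsDevelopment h W γ := by
  rw [eventually_nhdsWithin_iff] at hdev
  obtain ⟨r, hr, hball⟩ := Metric.mem_nhds_iff.1 (Filter.inter_mem
    (φ.open_target.mem_nhds (φ.map_source hxφ))
    ((φ.symm.continuousAt (φ.map_source hxφ)).preimage_mem_nhds
      (by rw [φ.left_inv hxφ]; exact hdev)))
  set o := φ x with ho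
  set X := puncturedBall o r with hX
  set N : Set G.Space := φ.source ∩ φ ⁻¹' Metric.ball o r with hN
  have hNo : IsOpen N := φ.isOpen_inter_preimage Metric.isOpen_ball
  have hxN : x ∈ N := ⟨hxφ, Metric.mem_ball_self hr⟩
  suffices hmain : ∃ γ, G.IsDevelopment h (N \ {x}) γ by
    obtain ⟨γ, hγ⟩ := hmain
    obtain ⟨γ', hγ'⟩ := hγ.extend (by omega) hNo hx
    exact ⟨N, γ', hxN, hγ'⟩
  have hNx : IsOpen (N \ {x}) := hNo.sdiff isClosed_singleton
  have hmem : ∀ z ∈ N \ {x}, φ z ∈ X := fun z hz =>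
    ⟨hz.1.2, fun h0 => hz.2 (φ.injOn hz.1.1 hxφ h0)⟩
  rcases isEmpty_or_nonempty X with hem | hne
  · have : N \ {x} = ∅ := Set.eq_empty_of_forall_notMem fun z hz => hem.false ⟨_, hmem z hz⟩
    rw [this]
    exact ⟨fun _ _ => 1, isOpen_empty, fun _ _ h => h.elim, fun _ _ _ h => h.elim⟩
  classical
  let ψ : X → G.Space := fun v => φ.symm v
  have hψ : Continuous ψ := by
    refine continuous_iff_continuousAt.2 fun v => ?_
    exact (φ.symm.continuousAt (hball v.2.1).1).comp continuous_subtype_val.continuousAt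
  have hψx : ∀ v, ψ v ≠ x := by
    intro v hv
    refine v.2.2 ?_
    rw [Set.mem_singleton_iff, ho, ← hv, φ.right_inv (hball v.2.1).1]
  have hex : ∀ v : X, ∃ W γ, ψ v ∈ W ∧ G.IsDevelopment h W γ := fun v =>
    (hball v.2.1).2 (hψx v)
  choose W γ hW hγ using hex
  have hrep := exists_point_eq (G := G)
  choose tt uu htu using hrep
  -- The development chosen at `v`, read at a fixed representative of the point over `v'`. Quotients
  -- of two such functions do not depend on the representative and are locally constant, as needed
  -- for a flat bundle.
  let τ : X → X → Γ := fun v v' => γ v (tt (ψ v')) (uu (ψ v'))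
  obtain ⟨κ, hκ⟩ := exists_trivialization_puncturedBall
    (by rw [finrank_euclideanSpace_fin]; exact hn)
    (fun v => ψ ⁻¹' W v) (fun v => (hγ v).isOpen.preimage hψ) hW τ (by
      intro v v' z hz hz'
      have h1 := (hγ v).eventually_ratio_eq (hγ v') (t := tt (ψ z)) (u := uu (ψ z))
        (by rw [htu]; exact hz) (by rw [htu]; exact hz')
      rw [htu] at h1
      filter_upwards [hψ.continuousAt.eventually h1] with z' hz'
      exact hz' _ _ (htu _))
  let V : G.Space → X := fun z => if hz : φ z ∈ X then ⟨φ z, hz⟩ else Classical.arbitrary X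
  have hV : ∀ z ∈ N \ {x}, ψ (V z) = z := by
    intro z hz
    simp only [ψ, V, dif_pos (hmem z hz)]
    exact φ.left_inv hz.1.1
  have hVc : ∀ z ∈ N \ {x}, ContinuousAt V z := by
    intro z hz
    refine tendsto_subtype_rng.2 ?_
    have h1 : (fun z => ((V z : X) : EuclideanSpace ℝ (Fin n))) =ᶠ[𝓝 z] φ := by
      filter_upwards [hNx.mem_nhds hz] with z' hz'
      simp only [V, dif_pos (hmem z' hz')]
    exact (φ.continuousAt hz.1.1).congr h1.symm
  -- The left factor depends on the point `z` alone, so the crossing rule survives. Compared with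
  -- one fixed local development it becomes the inverse of `τ * κ`, which is locally constant.
  let F : G.Space → T → stdSimplex ℝ (Fin (n + 1)) → Γ := fun z t w =>
    (κ (V z))⁻¹ * (τ (V z) (V z))⁻¹ * γ (V z) t w
  refine ⟨fun t w => F (G.point t w) t w, hNx, ?_, ?_⟩
  · intro t u hz
    have hkey : ∀ w, G.point t w ∈ N \ {x} → G.point t w ∈ W (V (G.point t u)) →
        F (G.point t w) t w = (τ (V (G.point t u)) (V (G.point t w)) * κ (V (G.point t w)))⁻¹ *
          γ (V (G.point t u)) t w := by
      intro w hw hw'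
      have h1 := hW (V (G.point t w))
      rw [hV _ hw] at h1
      have h2 := (hγ (V (G.point t w))).ratio_eq (hγ (V (G.point t u))) (htu (G.point t w)).symm
        h1 hw'
      have h3 : τ (V (G.point t w)) (V (G.point t w)) *
          (τ (V (G.point t u)) (V (G.point t w)))⁻¹ =
          γ (V (G.point t w)) t w * (γ (V (G.point t u)) t w)⁻¹ := by
        simp only [τ, hV _ hw]
        exact h2
      have h4 : γ (V (G.point t w)) t w = τ (V (G.point t w)) (V (G.point t w)) *
          (τ (V (G.point t u)) (V (G.point t w)))⁻¹ * γ (V (G.point t u)) t w := by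
        rw [h3]; group
      simp only [F]
      rw [h4]
      group
    have hWz := hW (V (G.point t u))
    rw [hV _ hz] at hWz
    have hc := (continuous_point (G := G) t).continuousAt (x := u)
    have h5 := hκ (V (G.point t u)) (V (G.point t u)) (hW _)
    filter_upwards [hc.eventually (hNx.mem_nhds hz),
      hc.eventually ((hγ _).isOpen.mem_nhds hWz),
      (hγ _).eventually_eq t u hWz,
      hc.eventually ((hVc _ hz).eventually h5)] with w hw1 hw2 hw3 hw4
    rw [hkey w hw1 hw2, hkey u hz hWz, hw3, hw4]
  · intro t u i hz hi
    have hWz := hW (V (G.point t u))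
    rw [hV _ hz] at hWz
    rw [point_nbr t hi]
    simp only [F]
    rw [(hγ _).crossing t u i hWz hi]
    group

end FacetGluing

/-! ### Placing congruent facets of two simplices against each other -/

section Crosses

variable {n : ℕ}

local notation "𝔼" => EuclideanSpace ℝ (Fin n)

/-- Two simplices with matching facets, opposite to the vertices `i` of `p` and `π i` of `q`, lie
on different sides of the common facet. -/
def Crosses (p q : Fin (n + 1) → 𝔼) (π : Equiv.Perm (Fin (n + 1))) (i : Fin (n + 1)) : Prop :=
  (∀ j, j ≠ i → q (π j) = p j) ∧
    ∃ a : 𝔼 →ᵃ[ℝ] ℝ, (∀ j, j ≠ i → a (p j) = 0) ∧ 0 < a (p i) ∧ a (q (π i)) < 0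

variable {p q : Fin (n + 1) → EuclideanSpace ℝ (Fin n)} {π : Equiv.Perm (Fin (n + 1))}
  {i : Fin (n + 1)}

theorem Crosses.symm (h : Crosses p q π i) : Crosses q p π⁻¹ (π i) := by
  obtain ⟨h1, a, h2, h3, h4⟩ := h
  have h5 : ∀ j, j ≠ π i → π⁻¹ j ≠ i := by
    rintro j hj rfl
    exact hj (π.apply_symm_apply j).symm
  have h6 : ∀ j, π (π⁻¹ j) = j := π.apply_symm_apply
  have h7 : π⁻¹ (π i) = i := π.symm_apply_apply i
  refine ⟨fun j hj => ?_, -a, fun j hj => ?_, ?_, ?_⟩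
  · rw [← h1 _ (h5 j hj), h6]
  · rw [← h6 j, h1 _ (h5 j hj)]
    exact neg_eq_zero.2 (h2 _ (h5 j hj))
  · simpa using h4
  · rw [h7]; simpa using h3

theorem Crosses.comp (h : Crosses p q π i) (g : 𝔼 ≃ᵃⁱ[ℝ] 𝔼) : Crosses (g ∘ p) (g ∘ q) π i := by
  obtain ⟨h1, a, h2, h3, h4⟩ := h
  exact ⟨fun j hj => congrArg g (h1 j hj), a.comp g.symm.toAffineEquiv.toAffineMap,
    fun j hj => by simpa using h2 j hj, by simpa using h3, by simpa using h4⟩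

theorem affineMap_sum_smul {V F ι : Type*} [AddCommGroup V] [Module ℝ V] [AddCommGroup F]
    [Module ℝ F] [Fintype ι] (f : V →ᵃ[ℝ] F) {c : ι → ℝ} (hc : ∑ i, c i = 1) (q : ι → V) :
    f (∑ i, c i • q i) = ∑ i, c i • f (q i) := by
  rw [← Finset.affineCombination_eq_linear_combination _ _ _ hc,
    ← Finset.affineCombination_eq_linear_combination _ _ _ hc, Finset.map_affineCombination _ _ _ hc]
  rfl

/-- A simplex on the other side of a facet is determined by its edge lengths. -/
theorem Crosses.unique (hn : n ≠ 0) (hp : AffineIndependent ℝ p)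
    {q' : Fin (n + 1) → 𝔼} (h : Crosses p q π i) (h' : Crosses p q' π i)
    (hd : ∀ j k, dist (q j) (q k) = dist (q' j) (q' k)) : q = q' := by
  have : Nontrivial (Fin (n + 1)) := Fin.nontrivial_iff_two_le.2 (by omega)
  obtain ⟨h1, a, h2, h3, h4⟩ := h
  obtain ⟨h1', a', h2', h3', h4'⟩ := h'
  obtain ⟨k, hk⟩ := exists_ne i
  set x := q (π i) with hx
  set x' := q' (π i) with hx'
  have hcoord : ∀ (b : 𝔼 →ᵃ[ℝ] ℝ) (v : 𝔼), (∀ j, j ≠ i → b (p j) = 0) →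
      b v = (simplexBasis hp).coord i v * b (p i) := by
    intro b v hb
    have h5 := affineMap_sum_smul b ((simplexBasis hp).sum_coord_apply_eq_one v) p
    have h6 : ∑ j, (simplexBasis hp).coord j v • p j = v :=
      (simplexBasis hp).linear_combination_coord_eq_self v
    rw [h6] at h5
    rw [h5, Finset.sum_eq_single i (fun j _ hj => by rw [hb j hj, smul_zero]) (by simp)]
    rfl
  have hneg : (simplexBasis hp).coord i x < 0 := by
    rw [hcoord a x h2] at h4; nlinarith
  have hneg' : (simplexBasis hp).coord i x' < 0 := by
    rw [hcoord a' x' h2'] at h4'; nlinarith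
  -- Both apexes have the same distance from each vertex of the facet, so they coincide or are
  -- mirror images; the rest excludes the mirror image because both lie strictly on the same side.
  have horth : ∀ j, j ≠ i → inner ℝ (x' - x) (x + x' - (2 : ℝ) • p j) = 0 := by
    intro j hj
    have h5 : dist x (p j) = dist x' (p j) := by
      rw [← h1 j hj, hd, h1 j hj, ← h1' j hj]
    rw [dist_eq_norm, dist_eq_norm] at h5
    have h6 : inner ℝ (x' - p j) (x' - p j) = inner ℝ (x - p j) (x - p j) := by
      rw [real_inner_self_eq_norm_sq, real_inner_self_eq_norm_sq, h5]
    have h7 : x' - x = (x' - p j) - (x - p j) := by abel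
    have h8 : x + x' - (2 : ℝ) • p j = (x' - p j) + (x - p j) := by rw [two_smul]; abel
    rw [h7, h8, inner_sub_left, inner_add_right, inner_add_right, h6,
      real_inner_comm (x - p j) (x' - p j)]
    ring
  have horth' : ∀ j, j ≠ i → inner ℝ (x' - x) (p j - p k) = 0 := by
    intro j hj
    have h5 := horth j hj
    have h6 := horth k hk
    have h7 : (2 : ℝ) • (p j - p k) = (x + x' - (2 : ℝ) • p k) - (x + x' - (2 : ℝ) • p j) := by
      rw [smul_sub]; abel
    have h8 : inner ℝ (x' - x) ((2 : ℝ) • (p j - p k)) = 0 := by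
      rw [h7, inner_sub_right, h5, h6, sub_zero]
    rw [inner_smul_right] at h8
    linarith
  have hexp : ∀ v : 𝔼, v - p k = ∑ j, (simplexBasis hp).coord j v • (p j - p k) := by
    intro v
    have h6 : ∑ j, (simplexBasis hp).coord j v • p j = v :=
      (simplexBasis hp).linear_combination_coord_eq_self v
    simp only [smul_sub, Finset.sum_sub_distrib, ← Finset.sum_smul, h6,
      (simplexBasis hp).sum_coord_apply_eq_one, one_smul]
  have hinner : ∀ v : 𝔼, inner ℝ (x' - x) (v - p k) =
      (simplexBasis hp).coord i v * inner ℝ (x' - x) (p i - p k) := by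
    intro v
    rw [hexp v, inner_sum, Finset.sum_eq_single i
      (fun j _ hj => by rw [inner_smul_right, horth' j hj, mul_zero]) (by simp), inner_smul_right]
  have hpi : inner ℝ (x' - x) (p i - p k) = 0 := by
    have h5 := horth k hk
    have h6 : x + x' - (2 : ℝ) • p k = (x - p k) + (x' - p k) := by rw [two_smul]; abel
    rw [h6, inner_add_right, hinner x, hinner x', ← add_mul] at h5
    exact (mul_eq_zero.1 h5).resolve_left (by linarith)
  have hxx : x' - x = 0 := by
    rw [← inner_self_eq_zero (𝕜 := ℝ)]
    nth_rewrite 2 [show x' - x = (x' - p k) - (x - p k) by abel]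
    rw [inner_sub_right, hinner x, hinner x', hpi, mul_zero, mul_zero, sub_zero]
  funext j
  obtain ⟨j, rfl⟩ := π.surjective j
  by_cases hj : j = i
  · rw [hj]; exact (sub_eq_zero.1 hxx).symm
  · rw [h1 j hj, h1' j hj]

/-- A simplex with a facet congruent to a facet of `p` can be moved to the other side of that
facet of `p`. -/
theorem exists_crosses (hn : n ≠ 0) (hp : AffineIndependent ℝ p) (hq : AffineIndependent ℝ q)
    (hd : ∀ j k, j ≠ i → k ≠ i → dist (q (π j)) (q (π k)) = dist (p j) (p k)) :
    ∃ g : 𝔼 ≃ᵃⁱ[ℝ] 𝔼, Crosses p (g ∘ q) π i := by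
  have : Nontrivial (Fin (n + 1)) := Fin.nontrivial_iff_two_le.2 (by omega)
  obtain ⟨k, hk⟩ := exists_ne i
  have : Nonempty {j // j ≠ i} := ⟨⟨k, hk⟩⟩
  obtain ⟨g, hg⟩ := exists_affineIsometryEquiv_of_dist_eq
    (q := fun j : {j // j ≠ i} => q (π j)) (q' := fun j => p j) fun j k => hd j k j.2 k.2
  set a := (simplexBasis hp).coord i with ha
  have ha0 : ∀ j, j ≠ i → a (p j) = 0 := fun j hj => by
    rw [ha, ← simplexBasis_apply hp j, AffineBasis.coord_apply, if_neg hj.symm]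
  have ha1 : a (p i) = 1 := by
    rw [ha, ← simplexBasis_apply hp i, AffineBasis.coord_apply, if_pos rfl]
  set x := g (q (π i)) with hx
  rcases lt_trichotomy (a x) 0 with hneg | hzero | hpos
  · exact ⟨g, fun j hj => hg ⟨j, hj⟩, a, ha0, by rw [ha1]; norm_num, hneg⟩
  -- An apex in the hyperplane of the facet would make the moved simplex degenerate.
  · exfalso
    have hgq : AffineIndependent ℝ (g ∘ q) :=
      hq.map' g.toAffineEquiv.toAffineMap g.injective
    have h1 : ∀ j, a (simplexBasis hgq j) = 0 := by
      intro j
      rw [simplexBasis_apply]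
      obtain ⟨j, rfl⟩ := π.surjective j
      by_cases hj : j = i
      · rw [hj]; exact hzero
      · exact (congrArg a (hg ⟨j, hj⟩)).trans (ha0 j hj)
    have h2 := affineMap_sum_smul a ((simplexBasis hgq).sum_coord_apply_eq_one (p i))
      (simplexBasis hgq)
    rw [(simplexBasis hgq).linear_combination_coord_eq_self, ha1] at h2
    simp [h1] at h2
  · set b := baryGrad hp i with hb
    have hb2 : 0 < inner ℝ b b := dualGram_self_pos hn hp i
    -- The apex came out on the wrong side; this is its reflection in the hyperplane of the facet.
    set x' := x - (2 * a x / inner ℝ b b) • b with hx'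
    have hax' : a x' = -a x := by
      have h1 := inner_baryGrad_sub hp i x x'
      rw [show x - x' = (2 * a x / inner ℝ b b) • b by rw [hx']; abel, inner_smul_right,
        ← hb, div_mul_cancel₀ _ hb2.ne', ← ha] at h1
      linarith
    have hdist : ∀ j, j ≠ i → dist x' (p j) = dist x (p j) := by
      intro j hj
      rw [dist_eq_norm, dist_eq_norm, ← sq_eq_sq₀ (norm_nonneg _) (norm_nonneg _),
        show x' - p j = (x - p j) - (2 * a x / inner ℝ b b) • b by rw [hx']; abel,
        norm_sub_sq_real, inner_smul_right, norm_smul, mul_pow, Real.norm_eq_abs, sq_abs,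
        ← real_inner_self_eq_norm_sq b, real_inner_comm b (x - p j), hb, inner_baryGrad_sub hp i x,
        ← hb, ← ha, ha0 j hj, sub_zero]
      field_simp
      ring
    set q' : Fin (n + 1) → 𝔼 := fun j => if j = π i then x' else g (q j) with hq'
    have hq'i : ∀ j, j ≠ i → q' (π j) = p j := fun j hj => by
      simp only [hq', if_neg (π.injective.ne hj)]
      exact hg ⟨j, hj⟩
    obtain ⟨g', hg'⟩ := exists_affineIsometryEquiv_of_dist_eq (q := q) (q' := q') (by
      intro j k
      obtain ⟨j, rfl⟩ := π.surjective j
      obtain ⟨k, rfl⟩ := π.surjective k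
      by_cases hj : j = i <;> by_cases hk : k = i
      · rw [hj, hk, dist_self, dist_self]
      · rw [hq'i k hk, hj]
        simp only [hq', if_true]
        rw [hdist k hk, hx, ← hg ⟨k, hk⟩, g.dist_map]
      · rw [hq'i j hj, hk]
        simp only [hq', if_true]
        rw [dist_comm (p j), hdist j hj, hx, ← hg ⟨j, hj⟩, g.dist_map, dist_comm]
      · rw [hq'i j hj, hq'i k hk, hd j k hj hk])
    refine ⟨g', fun j hj => (hg' _).trans (hq'i j hj), a, ha0, by rw [ha1]; norm_num, ?_⟩
    rw [Function.comp_apply, hg']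
    simp only [hq', if_true]
    linarith

theorem AffineIsometryEquiv.eq_of_comp_eq (hq : AffineIndependent ℝ q) {g g' : 𝔼 ≃ᵃⁱ[ℝ] 𝔼}
    (h : g ∘ q = g' ∘ q) : g = g' := by
  ext1 v
  have h1 := (simplexBasis hq).sum_coord_apply_eq_one v
  have h2 := affineMap_sum_smul g.toAffineEquiv.toAffineMap h1 q
  have h3 := affineMap_sum_smul g'.toAffineEquiv.toAffineMap h1 q
  have h4 : ∑ j, (simplexBasis hq).coord j v • q j = v :=
    (simplexBasis hq).linear_combination_coord_eq_self v
  rw [h4] at h2 h3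
  refine h2.trans (Eq.trans ?_ h3.symm)
  exact Finset.sum_congr rfl fun j _ => congrArg _ (congrFun h j)

end Crosses

/-! ### Transition motions and positions inside realized simplices -/

namespace FacetGluing

variable {T : Type*} {n : ℕ} {G : FacetGluing T n} {ℓ : G.Edge → ℝ}

section Transition

open Classical in
/-- The motion that places the neighbour of the simplex `t` across the facet `i` next to `t`. -/
noncomputable def transition (G : FacetGluing T n) (ℓ : G.Edge → ℝ) (t : T) (i : Fin (n + 1)) :
    EuclideanSpace ℝ (Fin n) ≃ᵃⁱ[ℝ] EuclideanSpace ℝ (Fin n) :=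
  if h : ∃ g : EuclideanSpace ℝ (Fin n) ≃ᵃⁱ[ℝ] EuclideanSpace ℝ (Fin n),
    Crosses (G.placement ℓ t) (g ∘ G.placement ℓ (G.nbr t i)) (G.perm t i) i
  then h.choose else 1

variable (hℓ : G.IsPolyhedralMetric ℓ)
include hℓ

theorem IsPolyhedralMetric.crosses_transition (hn : n ≠ 0) (t : T) (i : Fin (n + 1)) :
    Crosses (G.placement ℓ t) (G.transition ℓ t i ∘ G.placement ℓ (G.nbr t i)) (G.perm t i) i := by
  have h : ∃ g : EuclideanSpace ℝ (Fin n) ≃ᵃⁱ[ℝ] EuclideanSpace ℝ (Fin n),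
      Crosses (G.placement ℓ t) (g ∘ G.placement ℓ (G.nbr t i)) (G.perm t i) i :=
    exists_crosses hn (hℓ.affineIndependent t) (hℓ.affineIndependent _) fun j k hj hk => by
      rw [(hℓ.isPlacement _).dist_eq, (hℓ.isPlacement _).dist_eq, len_nbr t hj hk]
  rw [transition, dif_pos h]
  exact h.choose_spec

/-- A simplex across a given facet is unique once its lengths are known. So any geometrically
correct placement of a neighbour is automatically given by the transition motion. -/
theorem IsPolyhedralMetric.eq_mul_transition (hn : n ≠ 0) {t : T} {i : Fin (n + 1)}
    {g g' : EuclideanSpace ℝ (Fin n) ≃ᵃⁱ[ℝ] EuclideanSpace ℝ (Fin n)}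
    (h : Crosses (g ∘ G.placement ℓ t) (g' ∘ G.placement ℓ (G.nbr t i)) (G.perm t i) i) :
    g' = g * G.transition ℓ t i := by
  have h1 := (hℓ.crosses_transition hn t i).comp g
  refine AffineIsometryEquiv.eq_of_comp_eq (hℓ.affineIndependent (G.nbr t i)) ?_
  exact Crosses.unique hn ((hℓ.affineIndependent t).map' g.toAffineEquiv.toAffineMap g.injective)
    h h1 fun j k => by simp [AffineIsometryEquiv.dist_map]

theorem IsPolyhedralMetric.transition_mul_transition (hn : n ≠ 0) (t : T) (i : Fin (n + 1)) :
    G.transition ℓ t i * G.transition ℓ (G.nbr t i) (G.perm t i i) = 1 := by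
  refine (hℓ.eq_mul_transition hn (g := G.transition ℓ t i) (g' := 1) ?_).symm
  rw [G.nbr_nbr, G.perm_perm]
  exact (hℓ.crosses_transition hn t i).symm

end Transition

section Position

theorem affineIsometryEquiv_position (t : T) (u : stdSimplex ℝ (Fin (n + 1)))
    (g : EuclideanSpace ℝ (Fin n) ≃ᵃⁱ[ℝ] EuclideanSpace ℝ (Fin n)) :
    g (G.position ℓ t u) = ∑ i, u i • g (G.placement ℓ t i) :=
  affineMap_sum_smul g.toAffineEquiv.toAffineMap u.2.2 _

theorem affineMap_position (t : T) (u : stdSimplex ℝ (Fin (n + 1)))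
    (a : EuclideanSpace ℝ (Fin n) →ᵃ[ℝ] ℝ) :
    a (G.position ℓ t u) = ∑ i, u i * a (G.placement ℓ t i) :=
  affineMap_sum_smul a u.2.2 _

theorem continuous_position (t : T) : Continuous (G.position ℓ t) := by
  unfold position
  refine continuous_finsetSum _ fun i _ => ?_
  exact ((continuous_apply i).comp continuous_subtype_val).smul continuous_const

variable (hℓ : G.IsPolyhedralMetric ℓ)
include hℓ

theorem IsPolyhedralMetric.coord_position (t : T) (u : stdSimplex ℝ (Fin (n + 1)))
    (i : Fin (n + 1)) :
    (simplexBasis (hℓ.affineIndependent t)).coord i (G.position ℓ t u) = u i := by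
  rw [affineMap_position]
  simp only [← simplexBasis_apply (hℓ.affineIndependent t), AffineBasis.coord_apply]
  simp

theorem IsPolyhedralMetric.position_injective (t : T) :
    Function.Injective (G.position ℓ t) := fun u w h =>
  stdSimplex.ext (funext fun i => by rw [← hℓ.coord_position t u, ← hℓ.coord_position t w, h])

theorem IsPolyhedralMetric.nhds_eq_comap_position (t : T) (u : stdSimplex ℝ (Fin (n + 1))) :
    𝓝 u = Filter.comap (G.position ℓ t) (𝓝 (G.position ℓ t u)) :=
  ((continuous_position t).isClosedEmbedding (hℓ.position_injective t)).isInducing.nhds_eq_comap u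

theorem IsPolyhedralMetric.exists_position_eq (t : T) {v : EuclideanSpace ℝ (Fin n)}
    (h : ∀ i, 0 ≤ (simplexBasis (hℓ.affineIndependent t)).coord i v) :
    ∃ w, G.position ℓ t w = v :=
  ⟨⟨fun i => (simplexBasis (hℓ.affineIndependent t)).coord i v, h,
    (simplexBasis (hℓ.affineIndependent t)).sum_coord_apply_eq_one v⟩,
    (simplexBasis (hℓ.affineIndependent t)).linear_combination_coord_eq_self v⟩

/-- Close to a point of the simplex, only the coordinates that vanish at the point can become
negative. -/
theorem IsPolyhedralMetric.eventually_exists_position_eq (t : T)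
    (u : stdSimplex ℝ (Fin (n + 1))) :
    ∀ᶠ v in 𝓝 (G.position ℓ t u),
      (∀ i, u i = 0 → 0 ≤ (simplexBasis (hℓ.affineIndependent t)).coord i v) →
      ∃ w, G.position ℓ t w = v := by
  have h1 : ∀ i, ∀ᶠ v in 𝓝 (G.position ℓ t u), u i ≠ 0 →
      0 ≤ (simplexBasis (hℓ.affineIndependent t)).coord i v := by
    intro i
    by_cases hi : u i = 0
    · exact .of_forall fun v h => absurd hi h
    · have hc : Continuous ((simplexBasis (hℓ.affineIndependent t)).coord i) :=
        AffineMap.continuous_of_finiteDimensional _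
      have h2 : 0 < (simplexBasis (hℓ.affineIndependent t)).coord i (G.position ℓ t u) := by
        rw [hℓ.coord_position]
        exact lt_of_le_of_ne (stdSimplex.zero_le u i) (Ne.symm hi)
      filter_upwards [hc.continuousAt.eventually (lt_mem_nhds h2)] with v hv _ using le_of_lt hv
  filter_upwards [Filter.eventually_all.2 h1] with v hv hv'
  exact hℓ.exists_position_eq t fun i => by
    by_cases hi : u i = 0
    · exact hv' i hi
    · exact hv i hi

theorem IsPolyhedralMetric.transition_position (hn : n ≠ 0) (t : T)
    {u : stdSimplex ℝ (Fin (n + 1))} {i : Fin (n + 1)} (hi : u i = 0) :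
    G.transition ℓ t i (G.position ℓ (G.nbr t i) (stdSimplex.map (G.perm t i) u)) =
      G.position ℓ t u := by
  rw [affineIsometryEquiv_position, ← Equiv.sum_comp (G.perm t i), position]
  refine Finset.sum_congr rfl fun j _ => ?_
  rw [stdSimplex.map_perm_apply]
  by_cases hj : j = i
  · rw [hj, hi, zero_smul, zero_smul]
  · exact congrArg (u j • ·) ((hℓ.crosses_transition hn t i).1 j hj)

end Position

/-! ### Developments from their values at one point -/

section Compat

variable {Γ : Type*} [Group Γ] {h : T → Fin (n + 1) → Γ} {y : G.Space}

/-- A system of elements of `Γ`, one for each representative of the point `y`, that changes by `h`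
across facets. -/
def IsCompatible (G : FacetGluing T n) (h : T → Fin (n + 1) → Γ) (y : G.Space)
    (g : T → stdSimplex ℝ (Fin (n + 1)) → Γ) : Prop :=
  ∀ t u i, G.point t u = y → u i = 0 →
    g (G.nbr t i) (stdSimplex.map (G.perm t i) u) = g t u * h t i

theorem IsDevelopment.isCompatible {W : Set G.Space} {γ : T → stdSimplex ℝ (Fin (n + 1)) → Γ}
    (hγ : G.IsDevelopment h W γ) (hy : y ∈ W) : G.IsCompatible h y γ :=
  fun t u i hu hi => hγ.crossing t u i (hu ▸ hy) hi

/-- Extend each value to a constant on a small ball around its representative. Hence existence of a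
development near a point is a finite combinatorial question about its representatives. -/
theorem IsCompatible.exists_isDevelopment [Finite T] [T2Space G.Space]
    {g : T → stdSimplex ℝ (Fin (n + 1)) → Γ} (hg : G.IsCompatible h y g) :
    ∃ W γ, y ∈ W ∧ G.IsDevelopment h W γ ∧ ∀ t u, G.point t u = y → γ t u = g t u := by
  classical
  -- So small that the balls meet only the facets through their centres, and that balls around
  -- different representatives in one simplex are disjoint.
  obtain ⟨ε, hε0, hε1, hε2⟩ : ∃ ε : ℝ, 0 < ε ∧
      (∀ c ∈ {c : T × stdSimplex ℝ (Fin (n + 1)) | G.point c.1 c.2 = y},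
        ∀ w, dist w c.2 < ε → ∀ i, w i = 0 → c.2 i = 0) ∧
      (∀ c ∈ {c : T × stdSimplex ℝ (Fin (n + 1)) | G.point c.1 c.2 = y},
        ∀ c' ∈ {c : T × stdSimplex ℝ (Fin (n + 1)) | G.point c.1 c.2 = y},
        c.1 = c'.1 → dist c.2 c'.2 < ε + ε → c = c') := by
    have hfin := finite_point_fiber y
    have h1 : ∀ᶠ ε in 𝓝[>] (0 : ℝ),
        ∀ c ∈ {c : T × stdSimplex ℝ (Fin (n + 1)) | G.point c.1 c.2 = y},
        ∀ w, dist w c.2 < ε → ∀ i, w i = 0 → c.2 i = 0 := by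
      refine hfin.eventually_all.2 fun c _ => ?_
      have h2 : ∀ᶠ w in 𝓝 c.2, ∀ i, w i = 0 → c.2 i = 0 := by
        refine Filter.eventually_all.2 fun i => ?_
        by_cases hi : c.2 i = 0
        · exact .of_forall fun _ _ => hi
        · have hc : Continuous fun w : stdSimplex ℝ (Fin (n + 1)) => w i :=
            (continuous_apply i).comp continuous_subtype_val
          filter_upwards [hc.continuousAt.eventually (isOpen_ne.mem_nhds hi)] with w hw hw'
            using absurd hw' hw
      obtain ⟨δ, hδ, h3⟩ := Metric.eventually_nhds_iff.1 h2
      filter_upwards [nhdsWithin_le_nhds (gt_mem_nhds hδ)] with ε hε w hw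
      exact h3 (hw.trans hε)
    have h2 : ∀ᶠ ε in 𝓝[>] (0 : ℝ),
        ∀ c ∈ {c : T × stdSimplex ℝ (Fin (n + 1)) | G.point c.1 c.2 = y},
        ∀ c' ∈ {c : T × stdSimplex ℝ (Fin (n + 1)) | G.point c.1 c.2 = y},
        c.1 = c'.1 → dist c.2 c'.2 < ε + ε → c = c' := by
      refine hfin.eventually_all.2 fun c _ => hfin.eventually_all.2 fun c' _ => ?_
      by_cases hcc : c.2 = c'.2
      · exact .of_forall fun ε h1 _ => Prod.ext h1 hcc
      · have hd := dist_pos.2 hcc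
        filter_upwards [nhdsWithin_le_nhds (gt_mem_nhds (half_pos hd))] with ε hε _ h3
        linarith
    obtain ⟨ε, ⟨h1, h2⟩, h3⟩ := ((h1.and h2).and self_mem_nhdsWithin).exists
    exact ⟨ε, h3, h1, h2⟩
  let near : T → stdSimplex ℝ (Fin (n + 1)) → stdSimplex ℝ (Fin (n + 1)) → Prop :=
    fun t w u => G.point t u = y ∧ dist w u < ε
  let γ : T → stdSimplex ℝ (Fin (n + 1)) → Γ := fun t w =>
    if hw : ∃ u, near t w u then g t hw.choose else 1
  have hγ : ∀ t w u, near t w u → γ t w = g t u := by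
    intro t w u hu
    have hw : ∃ u, near t w u := ⟨u, hu⟩
    have h1 := hε2 (t, hw.choose) hw.choose_spec.1 (t, u) hu.1 rfl (by
      have h2 := dist_triangle_left hw.choose u w
      have h3 := hw.choose_spec.2
      have h4 := hu.2
      change dist hw.choose u < ε + ε
      linarith)
    simp only [γ, dif_pos hw]
    exact congrArg (fun c : T × stdSimplex ℝ (Fin (n + 1)) => g t c.2) h1
  have hev : ∀ᶠ z in 𝓝 y, ∀ t w, G.point t w = z → ∃ u, near t w u := by
    refine eventually_forall_point fun t u hu => ?_
    filter_upwards [Metric.ball_mem_nhds u hε0] with w hw using ⟨u, hu, hw⟩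
  obtain ⟨W, hW, hWo, hyW⟩ := mem_nhds_iff.1 hev
  refine ⟨W, γ, hyW, ⟨hWo, ?_, ?_⟩, fun t u hu => hγ t u u ⟨hu, by rwa [dist_self]⟩⟩
  · intro t w hw
    obtain ⟨u, hu⟩ := hW hw t w rfl
    filter_upwards [(isOpen_lt (continuous_id.dist continuous_const) continuous_const).mem_nhds
      (show dist w u < ε from hu.2)] with w' hw'
    rw [hγ t w u hu, hγ t w' u ⟨hu.1, hw'⟩]
  · intro t w i hw hi
    obtain ⟨u, hu⟩ := hW hw t w rfl
    have hui := hε1 (t, u) hu.1 w hu.2 i hi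
    have hd : dist (stdSimplex.map (G.perm t i) w) (stdSimplex.map (G.perm t i) u) < ε := by
      refine lt_of_le_of_lt ?_ hu.2
      rw [Subtype.dist_eq, dist_pi_le_iff dist_nonneg]
      intro j
      change dist (stdSimplex.map (G.perm t i) w j) (stdSimplex.map (G.perm t i) u j) ≤ _
      rw [stdSimplex.map_perm_apply', stdSimplex.map_perm_apply']
      exact dist_le_pi_dist w.1 u.1 _
    rw [hγ t w u hu, hγ _ _ (stdSimplex.map (G.perm t i) u) ⟨(point_nbr t hui).trans hu.1, hd⟩,
      hg t u i hu.1 hui]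

end Compat

end FacetGluing

/-! ### Developing maps and local flatness -/

/-- A continuous injective map of a compact set that maps neighbourhoods of a point to
neighbourhoods is a homeomorphism near the point. -/
theorem exists_openPartialHomeomorph {X Y : Type*} [TopologicalSpace X] [TopologicalSpace Y]
    [T2Space Y] {f : X → Y} {K : Set X} (hK : IsCompact K) (hf : ContinuousOn f K)
    (hinj : Set.InjOn f K) {x : X} (hx : f '' interior K ∈ 𝓝 (f x)) (hxK : x ∈ interior K) :
    ∃ φ : OpenPartialHomeomorph X Y, x ∈ φ.source ∧ φ.source ⊆ K ∧ ∀ z, φ z = f z := by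
  obtain ⟨B, hB, hBo, hxB⟩ := mem_nhds_iff.1 hx
  set S := interior K ∩ f ⁻¹' B with hS
  have hSo : IsOpen S := (hf.mono interior_subset).isOpen_inter_preimage isOpen_interior hBo
  have hbij : Set.BijOn f S B := by
    refine ⟨fun z hz => hz.2, hinj.mono (Set.inter_subset_left.trans interior_subset), ?_⟩
    intro v hv
    obtain ⟨z, hz, rfl⟩ := hB hv
    exact ⟨z, ⟨hz, hv⟩, rfl⟩
  have : Nonempty X := ⟨x⟩
  let e := hbij.toPartialEquiv
  have hsymm : ContinuousOn e.symm B := by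
    have : CompactSpace K := isCompact_iff_compactSpace.1 hK
    have hemb : Topology.IsClosedEmbedding (K.domRestrict f) :=
      (continuousOn_iff_continuous_domRestrict.1 hf).isClosedEmbedding
        (Set.injOn_iff_injective.1 hinj)
    rw [continuousOn_iff_continuous_domRestrict]
    have hmem : ∀ v : B, e.symm v ∈ K := fun v =>
      interior_subset (e.map_target v.2).1
    let g : B → K := fun v => ⟨e.symm v, hmem v⟩
    have hg : Continuous g := by
      rw [hemb.isInducing.continuous_iff]
      have : K.domRestrict f ∘ g = Subtype.val := by
        funext v
        exact e.right_inv v.2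
      rw [this]
      exact continuous_subtype_val
    exact continuous_subtype_val.comp hg
  refine ⟨⟨⟨e, hf.mono (Set.inter_subset_left.trans interior_subset), hsymm⟩, hSo, hBo⟩,
    ⟨hxK, hxB⟩, Set.inter_subset_left.trans interior_subset, fun z => rfl⟩

namespace FacetGluing

variable {T : Type*} {n : ℕ} {G : FacetGluing T n} {ℓ : G.Edge → ℝ}

/-- The map to Euclidean space that moves the simplices by the elements of `γ`. -/
noncomputable def developingMap (G : FacetGluing T n) (ℓ : G.Edge → ℝ)
    (γ : T → stdSimplex ℝ (Fin (n + 1)) →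
      (EuclideanSpace ℝ (Fin n) ≃ᵃⁱ[ℝ] EuclideanSpace ℝ (Fin n))) (z : G.Space) :
    EuclideanSpace ℝ (Fin n) :=
  γ (Quot.out z).1 (Quot.out z).2 (G.position ℓ (Quot.out z).1 (Quot.out z).2)

/-- The glued space is flat near `y`: some development near `y` is a homeomorphism onto an open
subset of Euclidean space. -/
def IsLocallyFlatAt (G : FacetGluing T n) (ℓ : G.Edge → ℝ) (y : G.Space) : Prop :=
  ∃ φ : OpenPartialHomeomorph G.Space (EuclideanSpace ℝ (Fin n)), y ∈ φ.source ∧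
    ∃ γ, G.IsDevelopment (G.transition ℓ) φ.source γ ∧ ∀ z, φ z = G.developingMap ℓ γ z

variable (hℓ : G.IsPolyhedralMetric ℓ) {W : Set G.Space}
  {γ : T → stdSimplex ℝ (Fin (n + 1)) →
    (EuclideanSpace ℝ (Fin n) ≃ᵃⁱ[ℝ] EuclideanSpace ℝ (Fin n))}
include hℓ

/-- The transition motion matches the two positions of a point of the common facet. So the
developing map is independent of the representatives used in its definition. -/
theorem IsCompatible.apply_position (hn : n ≠ 0) {y : G.Space}
    (hγ : G.IsCompatible (G.transition ℓ) y γ) {t t' : T} {u u' : stdSimplex ℝ (Fin (n + 1))}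
    (hu : G.point t u = y) (hu' : G.point t' u' = y) :
    γ t' u' (G.position ℓ t' u') = γ t u (G.position ℓ t u) := by
  have := point_induction (G := G) (P := fun t' u' => G.point t' u' = y ∧
    γ t' u' (G.position ℓ t' u') = γ t u (G.position ℓ t u)) ?_ (hu.trans hu'.symm) ⟨hu, rfl⟩
  · exact this.2
  · rintro s v i hi ⟨h1, h2⟩
    refine ⟨(point_nbr s hi).trans h1, ?_⟩
    rw [hγ s v i h1 hi, AffineIsometryEquiv.coe_mul, Function.comp_apply,
      hℓ.transition_position hn s hi, h2]

theorem IsDevelopment.developingMap_point (hn : n ≠ 0)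
    (hγ : G.IsDevelopment (G.transition ℓ) W γ) {t : T} {u : stdSimplex ℝ (Fin (n + 1))}
    (hu : G.point t u ∈ W) :
    G.developingMap ℓ γ (G.point t u) = γ t u (G.position ℓ t u) :=
  (hγ.isCompatible hu).apply_position hℓ hn rfl (Quot.out_eq _)

theorem IsDevelopment.continuousOn_developingMap [Finite T] [T2Space G.Space] (hn : n ≠ 0)
    (hγ : G.IsDevelopment (G.transition ℓ) W γ) : ContinuousOn (G.developingMap ℓ γ) W := by
  intro y hy
  refine ContinuousAt.continuousWithinAt fun N hN => ?_
  have h1 : ∀ᶠ z in 𝓝 y, ∀ t w, G.point t w = z → γ t w (G.position ℓ t w) ∈ N := by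
    refine eventually_forall_point fun t u hu => ?_
    subst hu
    rw [hγ.developingMap_point hℓ hn hy] at hN
    filter_upwards [hγ.eventually_eq t u hy,
      ((γ t u).continuous.comp (continuous_position t)).continuousAt.preimage_mem_nhds hN]
      with w hw hw'
    rw [hw]
    exact hw'
  change ∀ᶠ z in 𝓝 y, G.developingMap ℓ γ z ∈ N
  filter_upwards [h1, hγ.isOpen.mem_nhds hy] with z hz hzW
  obtain ⟨t, w, rfl⟩ := exists_point_eq z
  rw [hγ.developingMap_point hℓ hn hzW]
  exact hz t w rfl

theorem IsDevelopment.isLocallyFlatAt [Finite T] [T2Space G.Space] (hn : n ≠ 0)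
    (hγ : G.IsDevelopment (G.transition ℓ) W γ) {y : G.Space} (hy : y ∈ W)
    (hinj : ∃ N ∈ 𝓝 y, Set.InjOn (G.developingMap ℓ γ) N)
    (hsurj : ∀ N ∈ 𝓝 y, G.developingMap ℓ γ '' N ∈ 𝓝 (G.developingMap ℓ γ y)) :
    G.IsLocallyFlatAt ℓ y := by
  have : CompactSpace G.Space := compactSpace_space
  obtain ⟨N, hN, hinj⟩ := hinj
  obtain ⟨K, hK, hKN, hKc⟩ :=
    LocallyCompactSpace.local_compact_nhds y (N ∩ W) (Filter.inter_mem hN (hγ.isOpen.mem_nhds hy))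
  obtain ⟨φ, hφ, hφK, hφf⟩ := exists_openPartialHomeomorph hKc
    ((hγ.continuousOn_developingMap hℓ hn).mono fun z hz => (hKN hz).2)
    (hinj.mono fun z hz => (hKN hz).1) (hsurj _ (interior_mem_nhds.2 hK))
    (mem_interior_iff_mem_nhds.2 hK)
  exact ⟨φ, hφ, γ, hγ.mono φ.open_source fun z hz => (hKN (hφK hz)).2, hφf⟩

/-- The glued space is flat near a point if the simplices around it can be fitted together. -/
theorem IsCompatible.isLocallyFlatAt [Finite T] [T2Space G.Space] (hn : n ≠ 0)
    {t₀ : T} {u₀ : stdSimplex ℝ (Fin (n + 1))}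
    {g : T → stdSimplex ℝ (Fin (n + 1)) →
      (EuclideanSpace ℝ (Fin n) ≃ᵃⁱ[ℝ] EuclideanSpace ℝ (Fin n))}
    (hg : G.IsCompatible (G.transition ℓ) (G.point t₀ u₀) g)
    (hcov : ∀ᶠ v in 𝓝 (g t₀ u₀ (G.position ℓ t₀ u₀)), ∃ t u w, G.point t u = G.point t₀ u₀ ∧
      g t u (G.position ℓ t w) = v)
    (hinj : ∀ᶠ v in 𝓝 (g t₀ u₀ (G.position ℓ t₀ u₀)), ∀ t u w t' u' w',
      G.point t u = G.point t₀ u₀ → G.point t' u' = G.point t₀ u₀ →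
      g t u (G.position ℓ t w) = v → g t' u' (G.position ℓ t' w') = v →
      G.point t w = G.point t' w') : G.IsLocallyFlatAt ℓ (G.point t₀ u₀) := by
  set y := G.point t₀ u₀ with hy
  set o := g t₀ u₀ (G.position ℓ t₀ u₀) with ho
  obtain ⟨W, γ, hyW, hγ, hγg⟩ := hg.exists_isDevelopment
  have ho' : ∀ t u, G.point t u = y → g t u (G.position ℓ t u) = o := fun t u hu =>
    hg.apply_position hℓ hn rfl hu
  have hfy : G.developingMap ℓ γ y = o := by
    rw [hy, hγ.developingMap_point hℓ hn (by rwa [← hy]), hγg _ _ rfl]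
  refine hγ.isLocallyFlatAt hℓ hn hyW ?_ ?_
  · have h1 : ∀ᶠ z in 𝓝 y, ∀ t w, G.point t w = z → ∃ u, G.point t u = y ∧ γ t w = g t u := by
      refine eventually_forall_point fun t u hu => ?_
      filter_upwards [hγ.eventually_eq t u (by rwa [hu])] with w hw
      exact ⟨u, hu, hw.trans (hγg t u hu)⟩
    have h2 := ((hγ.continuousOn_developingMap hℓ hn).continuousAt
      (hγ.isOpen.mem_nhds hyW)).eventually (hfy.symm ▸ hinj)
    refine ⟨_, Filter.inter_mem (Filter.inter_mem h1 h2) (hγ.isOpen.mem_nhds hyW), ?_⟩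
    rintro z ⟨⟨hz1, hz2⟩, hzW⟩ z' ⟨⟨hz1', hz2'⟩, hzW'⟩ heq
    obtain ⟨t, w, rfl⟩ := exists_point_eq z
    obtain ⟨t', w', rfl⟩ := exists_point_eq z'
    obtain ⟨u, hu, hgu⟩ := hz1 t w rfl
    obtain ⟨u', hu', hgu'⟩ := hz1' t' w' rfl
    refine hz2 t u w t' u' w' hu hu' ?_ ?_
    · rw [hγ.developingMap_point hℓ hn hzW, hgu]
    · rw [heq, hγ.developingMap_point hℓ hn hzW', hgu']
  · intro N hN
    rw [hfy]
    have h1 : ∀ᶠ v in 𝓝 o, ∀ c ∈ {c : T × stdSimplex ℝ (Fin (n + 1)) | G.point c.1 c.2 = y},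
        ∀ w, g c.1 c.2 (G.position ℓ c.1 w) = v →
          (G.point c.1 w ∈ N ∧ G.point c.1 w ∈ W) ∧ γ c.1 w = g c.1 c.2 := by
      refine (finite_point_fiber y).eventually_all.2 fun c hc => ?_
      have h2 : ∀ᶠ w in 𝓝 c.2, (G.point c.1 w ∈ N ∧ G.point c.1 w ∈ W) ∧ γ c.1 w = g c.1 c.2 := by
        have hcy : G.point c.1 c.2 = y := hc
        have hcont := (continuous_point (G := G) c.1).continuousAt (x := c.2)
        filter_upwards [hcont.preimage_mem_nhds (hcy.symm ▸ hN),
          hcont.preimage_mem_nhds (hcy.symm ▸ hγ.isOpen.mem_nhds hyW),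
          hγ.eventually_eq c.1 c.2 (by rwa [hcy])] with w h3 h4 h5
        exact ⟨⟨h3, h4⟩, h5.trans (hγg _ _ hcy)⟩
      rw [hℓ.nhds_eq_comap_position, Filter.eventually_comap] at h2
      have h3 : Filter.Tendsto (g c.1 c.2).symm (𝓝 o) (𝓝 (G.position ℓ c.1 c.2)) := by
        have := (g c.1 c.2).symm.continuous.tendsto (g c.1 c.2 (G.position ℓ c.1 c.2))
        rwa [AffineIsometryEquiv.symm_apply_apply, ho' _ _ hc] at this
      filter_upwards [h3.eventually h2] with v hv w hw
      exact hv w (by rw [← hw, AffineIsometryEquiv.symm_apply_apply])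
    filter_upwards [hcov, h1] with v hv hv'
    obtain ⟨t, u, w, hu, hw⟩ := hv
    obtain ⟨⟨h2, h3⟩, h4⟩ := hv' (t, u) hu w hw
    refine ⟨G.point t w, h2, ?_⟩
    rw [hγ.developingMap_point hℓ hn h3, h4, hw]

theorem IsPolyhedralMetric.isLocallyFlatAt_interior [Finite T] [T2Space G.Space] (hn : n ≠ 0)
    (t : T) {u : stdSimplex ℝ (Fin (n + 1))} (hu : ∀ i, u i ≠ 0) :
    G.IsLocallyFlatAt ℓ (G.point t u) := by
  have hrep : ∀ t' u', G.point t' u' = G.point t u → t' = t ∧ u' = u := by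
    intro t' u' h
    have := point_induction (G := G) (P := fun t' u' => t' = t ∧ u' = u) ?_ h.symm ⟨rfl, rfl⟩
    · exact this
    · rintro s v i hi ⟨rfl, rfl⟩
      exact absurd hi (hu i)
  have hg : G.IsCompatible (G.transition ℓ) (G.point t u) fun _ _ => 1 := by
    intro t' u' i h hi
    obtain ⟨rfl, rfl⟩ := hrep t' u' h
    exact absurd hi (hu i)
  refine hg.isLocallyFlatAt hℓ hn ?_ ?_
  · filter_upwards [hℓ.eventually_exists_position_eq t u] with v hv
    obtain ⟨w, hw⟩ := hv fun i hi => absurd hi (hu i)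
    exact ⟨t, u, w, rfl, hw⟩
  · refine .of_forall fun v t1 u1 w1 t2 u2 w2 h1 h2 h3 h4 => ?_
    obtain ⟨rfl, rfl⟩ := hrep _ _ h1
    obtain ⟨rfl, rfl⟩ := hrep _ _ h2
    rw [hℓ.position_injective _ (h3.trans h4.symm)]

/-- Only two representatives exist, and the two simplices lie on opposite sides of the hyperplane of
the facet: together they cover a neighbourhood, and they overlap only in the facet. -/
theorem IsPolyhedralMetric.isLocallyFlatAt_facet [Finite T] [T2Space G.Space] (hn : n ≠ 0)
    (t : T) {u : stdSimplex ℝ (Fin (n + 1))} {i : Fin (n + 1)} (hi : u i = 0)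
    (hu : ∀ j, j ≠ i → u j ≠ 0) : G.IsLocallyFlatAt ℓ (G.point t u) := by
  classical
  set t' := G.nbr t i with ht'
  set π := G.perm t i with hπ
  set u' := stdSimplex.map π u with hu'
  have hmap : ∀ j, u' (π j) = u j := stdSimplex.map_perm_apply π u
  have hu'0 : ∀ j, j ≠ π i → u' j ≠ 0 := by
    intro j hj
    obtain ⟨j, rfl⟩ := π.surjective j
    rw [hmap]
    exact hu j fun h => hj (by rw [h])
  have hback : G.nbr t' (π i) = t := G.nbr_nbr t i
  have hback' : stdSimplex.map (G.perm t' (π i)) u' = u := by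
    rw [ht', hπ, G.perm_perm]
    exact stdSimplex.map_inv_map _ _
  have hrep : ∀ s v, G.point s v = G.point t u → (s = t ∧ v = u) ∨ (s = t' ∧ v = u') := by
    intro s v h
    have := point_induction (G := G)
      (P := fun s v => (s = t ∧ v = u) ∨ (s = t' ∧ v = u')) ?_ h.symm (.inl ⟨rfl, rfl⟩)
    · exact this
    · rintro s v j hj (⟨rfl, rfl⟩ | ⟨rfl, rfl⟩)
      · have : j = i := by by_contra h; exact hu j h hj
        rw [this]; exact .inr ⟨rfl, rfl⟩
      · have : j = π i := by by_contra h; exact hu'0 j h hj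
        rw [this]; exact .inl ⟨hback, hback'⟩
  -- The neighbour may be the same simplex. The representatives still differ, because no facet is
  -- paired with itself, so the case distinction in `g` is legitimate.
  have hne : ¬(t' = t ∧ u' = u) := by
    rintro ⟨h1, h2⟩
    refine G.no_fixed_facet t i ⟨h1, ?_⟩
    by_contra h
    exact hu _ h (by rw [← h2, hmap, hi])
  set h := G.transition ℓ t i with hh
  set g : T → stdSimplex ℝ (Fin (n + 1)) →
    (EuclideanSpace ℝ (Fin n) ≃ᵃⁱ[ℝ] EuclideanSpace ℝ (Fin n)) :=
    fun s v => if s = t ∧ v = u then 1 else h with hg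
  have hg0 : g t u = 1 := if_pos ⟨rfl, rfl⟩
  have hg1 : g t' u' = h := if_neg hne
  have hcompat : G.IsCompatible (G.transition ℓ) (G.point t u) g := by
    intro s v j hs hj
    rcases hrep s v hs with ⟨rfl, rfl⟩ | ⟨rfl, rfl⟩
    · have : j = i := by by_contra h; exact hu j h hj
      rw [this, hg0, one_mul]
      exact hg1
    · have : j = π i := by by_contra h; exact hu'0 j h hj
      rw [this, hback, hback', hg0, hg1]
      exact (hℓ.transition_mul_transition hn t i).symm
  obtain ⟨hc1, a, ha0, hai, hai'⟩ := hℓ.crosses_transition hn t i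
  have haw : ∀ w, a (G.position ℓ t w) = w i * a (G.placement ℓ t i) := by
    intro w
    rw [affineMap_position, Finset.sum_eq_single i
      (fun j _ hj => by rw [ha0 j hj, mul_zero]) (by simp)]
  have haw' : ∀ w, a (h (G.position ℓ t' w)) = w (π i) * a (h (G.placement ℓ t' (π i))) := by
    intro w
    have h1 := affineMap_position (ℓ := ℓ) t' w (a.comp h.toAffineEquiv.toAffineMap)
    rw [Finset.sum_eq_single (π i) (fun j _ hj => ?_) (by simp)] at h1
    · exact h1
    · obtain ⟨j, rfl⟩ := π.surjective j
      have h2 := hc1 j fun h => hj (by rw [h])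
      have h3 : a (h (G.placement ℓ t' (π j))) = 0 := by
        rw [← ha0 j fun h => hj (by rw [h]), ← h2]; rfl
      exact mul_eq_zero_of_right _ h3
  have hcoord : ∀ v, a v = (simplexBasis (hℓ.affineIndependent t)).coord i v *
      a (G.placement ℓ t i) := by
    intro v
    have h1 := (affineMap_sum_smul a
      ((simplexBasis (hℓ.affineIndependent t)).sum_coord_apply_eq_one v) (G.placement ℓ t)).trans
      (Finset.sum_eq_single i (fun j _ hj => by rw [ha0 j hj, smul_zero]) (by simp))
    rw [← smul_eq_mul, ← h1]
    exact congrArg a ((simplexBasis (hℓ.affineIndependent t)).linear_combination_coord_eq_self v).symm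
  have hcoord' : ∀ v, a (h v) = (simplexBasis (hℓ.affineIndependent t')).coord (π i) v *
      a (h (G.placement ℓ t' (π i))) := by
    intro v
    have h1 := affineMap_sum_smul (a.comp h.toAffineEquiv.toAffineMap)
      ((simplexBasis (hℓ.affineIndependent t')).sum_coord_apply_eq_one v) (G.placement ℓ t')
    refine Eq.trans ?_ (h1.trans (Finset.sum_eq_single (π i) (fun j _ hj => ?_) (by simp)))
    · exact congrArg (fun v => a (h v))
        ((simplexBasis (hℓ.affineIndependent t')).linear_combination_coord_eq_self v).symm
    · obtain ⟨j, rfl⟩ := π.surjective j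
      have h2 := hc1 j fun h => hj (by rw [h])
      have h3 : a (h (G.placement ℓ t' (π j))) = 0 := by
        rw [← ha0 j fun h => hj (by rw [h]), ← h2]; rfl
      exact smul_eq_zero_of_right _ h3
  change a (h (G.placement ℓ t' (π i))) < 0 at hai'
  refine hcompat.isLocallyFlatAt hℓ hn ?_ ?_
  · rw [hg0, AffineIsometryEquiv.coe_one, id_eq]
    have h1 : Filter.Tendsto h.symm (𝓝 (G.position ℓ t u)) (𝓝 (G.position ℓ t' u')) := by
      have := h.symm.continuous.tendsto (h (G.position ℓ t' u'))
      rwa [AffineIsometryEquiv.symm_apply_apply, hh, hℓ.transition_position hn t hi] at this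
    filter_upwards [hℓ.eventually_exists_position_eq t u,
      h1.eventually (hℓ.eventually_exists_position_eq t' u')] with v hv hv'
    rcases le_total 0 (a v) with h2 | h2
    · obtain ⟨w, hw⟩ := hv fun j hj => by
        have : j = i := by by_contra h; exact hu j h hj
        rw [this]
        rw [hcoord] at h2
        exact nonneg_of_mul_nonneg_left h2 hai
      exact ⟨t, u, w, rfl, by rw [hg0]; exact hw⟩
    · obtain ⟨w, hw⟩ := hv' fun j hj => by
        have : j = π i := by by_contra h; exact hu'0 j h hj
        rw [this]
        have h3 := hcoord' (h.symm v)
        rw [AffineIsometryEquiv.apply_symm_apply] at h3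
        rw [h3] at h2
        by_contra h4
        exact absurd h2 (not_le.2 (mul_pos_of_neg_of_neg (not_le.1 h4) hai'))
      exact ⟨t', u', w, point_nbr t hi, by rw [hg1, hw, AffineIsometryEquiv.apply_symm_apply]⟩
  · have hmix : ∀ w w', G.position ℓ t w = h (G.position ℓ t' w') →
        G.point t w = G.point t' w' := by
      intro w w' heq
      have h1 : w i * a (G.placement ℓ t i) = w' (π i) * a (h (G.placement ℓ t' (π i))) := by
        rw [← haw, ← haw', heq]
      have h2 : 0 ≤ w i * a (G.placement ℓ t i) := mul_nonneg (stdSimplex.zero_le w i) hai.le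
      have h3 : w' (π i) * a (h (G.placement ℓ t' (π i))) ≤ 0 :=
        mul_nonpos_of_nonneg_of_nonpos (stdSimplex.zero_le w' _) hai'.le
      have h4 : w i = 0 :=
        (mul_eq_zero.1 (le_antisymm (h1.trans_le h3) h2)).resolve_right hai.ne'
      rw [← point_nbr t h4]
      congr 1
      refine hℓ.position_injective t' (h.injective ?_)
      rw [← heq]
      exact hℓ.transition_position hn t h4
    refine .of_forall fun v s1 u1 w1 s2 u2 w2 h1 h2 h3 h4 => ?_
    rcases hrep _ _ h1 with ⟨rfl, rfl⟩ | ⟨rfl, rfl⟩ <;>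
      rcases hrep _ _ h2 with ⟨rfl, rfl⟩ | ⟨rfl, rfl⟩
    · rw [hℓ.position_injective _ ((g _ _).injective (h3.trans h4.symm))]
    · rw [hg0] at h3
      rw [hg1] at h4
      exact hmix _ _ (h3.trans h4.symm)
    · rw [hg1] at h3
      rw [hg0] at h4
      exact (hmix _ _ (h4.trans h3.symm)).symm
    · rw [hℓ.position_injective _ ((g _ _).injective (h3.trans h4.symm))]

end FacetGluing

/-! ### Intrinsic distance in a locally flat space -/

/-- A local Lipschitz bound along a segment integrates to a global one: the set of parameters
reached with the right bound is closed and can always be continued. It serves both comparisons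
between the intrinsic and the Euclidean distance. -/
theorem le_of_locally_le_mul_edist {D : ℝ → ℝ → ℝ≥0∞} {L : ℝ≥0∞} (hL : L ≠ ∞)
    (htri : ∀ a b c, D a c ≤ D a b + D b c) (hsymm : ∀ a b, D a b = D b a)
    (hself : ∀ a, D a a = 0)
    (hloc : ∀ s ∈ Set.Icc (0 : ℝ) 1, ∀ᶠ s' in 𝓝[Set.Icc 0 1] s, D s s' ≤ edist s s' * L) :
    D 0 1 ≤ L := by
  set A : Set ℝ := {s | D 0 s ≤ edist 0 s * L} with hA
  have hlim : ∀ s ∈ Set.Icc (0 : ℝ) 1, (∃ᶠ s' in 𝓝[Set.Icc 0 1] s, s' ∈ A) → s ∈ A := by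
    intro s hs hf
    by_contra hcon
    have hcon' : edist 0 s * L < D 0 s := not_le.1 hcon
    have hc : Filter.Tendsto (fun s' : ℝ => edist 0 s' * L + edist s s' * L) (𝓝 s)
        (𝓝 (edist 0 s * L)) := by
      have h1 : Continuous fun s' : ℝ => edist 0 s' * L + edist s s' * L :=
        ((ENNReal.continuous_mul_const hL).comp (by fun_prop)).add
          ((ENNReal.continuous_mul_const hL).comp (by fun_prop))
      have := h1.tendsto s
      simpa using this
    obtain ⟨s', h1, h2, h3⟩ := (hf.and_eventually ((hloc s hs).and
      (nhdsWithin_le_nhds (hc.eventually (gt_mem_nhds hcon'))))).exists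
    refine absurd (htri 0 s' s) (not_le.2 (lt_of_le_of_lt ?_ h3))
    rw [hsymm s' s]
    exact add_le_add h1 h2
  have hclosed : IsClosed (A ∩ Set.Icc 0 1) := by
    refine isClosed_of_closure_subset fun s hs => ?_
    have hsI : s ∈ Set.Icc (0 : ℝ) 1 :=
      isClosed_Icc.closure_subset (closure_mono Set.inter_subset_right hs)
    refine ⟨hlim s hsI ?_, hsI⟩
    have h1 := mem_closure_iff_frequently.1 hs
    rw [frequently_nhdsWithin_iff]
    exact h1
  have hsub : Set.Icc (0 : ℝ) 1 ⊆ A := by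
    refine hclosed.Icc_subset_of_forall_exists_gt ?_ ?_
    · change D 0 0 ≤ _
      rw [hself]
      exact zero_le
    · rintro s ⟨hs, hs0, hs1⟩ y hy
      have hev : ∀ᶠ s' in 𝓝[>] s, D s s' ≤ edist s s' * L := by
        have h2 : Set.Icc (0 : ℝ) 1 ∈ 𝓝[>] s :=
          Filter.mem_of_superset (Ioo_mem_nhdsGT hs1) fun x hx => ⟨hs0.trans hx.1.le, hx.2.le⟩
        exact (nhdsWithin_le_of_mem h2) (hloc s ⟨hs0, hs1.le⟩)
      obtain ⟨s', h1, h2⟩ := (hev.and (Ioc_mem_nhdsGT (show s < y from hy))).exists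
      refine ⟨s', ?_, h2⟩
      change D 0 s' ≤ edist 0 s' * L
      refine (htri 0 s s').trans ((add_le_add hs h1).trans (le_of_eq ?_))
      rw [← add_mul]
      congr 1
      rw [edist_dist, edist_dist, edist_dist, ← ENNReal.ofReal_add dist_nonneg dist_nonneg]
      congr 1
      rw [Real.dist_eq, Real.dist_eq, Real.dist_eq, abs_of_nonpos (by linarith),
        abs_of_nonpos (by linarith [h2.1]), abs_of_nonpos (by linarith [h2.1])]
      ring
  have h1 := hsub (Set.right_mem_Icc.2 zero_le_one)
  have h2 : edist (0 : ℝ) 1 = 1 := by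
    rw [edist_dist, Real.dist_eq]; norm_num
  change D 0 1 ≤ edist (0 : ℝ) 1 * L at h1
  rwa [h2, one_mul] at h1

namespace FacetGluing

variable {T : Type*} {n : ℕ} {G : FacetGluing T n} {ℓ : G.Edge → ℝ}

section Distance

theorem IsChain.append {x y z : G.Space} {L L' : ℝ≥0∞} (h : G.IsChain ℓ x y L)
    (h' : G.IsChain ℓ y z L') : G.IsChain ℓ x z (L + L') := by
  induction h with
  | nil => rwa [zero_add]
  | cons t u v y L _ ih =>
    rw [add_assoc]
    exact .cons t u v z _ (ih h')

theorem isChain_single (t : T) (u v : stdSimplex ℝ (Fin (n + 1))) :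
    G.IsChain ℓ (G.point t u) (G.point t v) (edist (G.position ℓ t u) (G.position ℓ t v)) := by
  simpa using IsChain.cons t u v _ 0 (.nil (G.point t v))

theorem IsChain.reverse {x y : G.Space} {L : ℝ≥0∞} (h : G.IsChain ℓ x y L) :
    G.IsChain ℓ y x L := by
  induction h with
  | nil => exact .nil _
  | cons t u v y L _ ih =>
    rw [add_comm, edist_comm]
    exact ih.append (isChain_single t v u)

theorem intrinsicDist_self (x : G.Space) : G.intrinsicDist ℓ x x = 0 :=
  le_antisymm (sInf_le (IsChain.nil x)) zero_le

theorem intrinsicDist_comm (x y : G.Space) :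
    G.intrinsicDist ℓ x y = G.intrinsicDist ℓ y x := by
  have : ∀ L, G.IsChain ℓ x y L ↔ G.IsChain ℓ y x L := fun L => ⟨.reverse, .reverse⟩
  simp only [intrinsicDist, this]

theorem intrinsicDist_triangle (x y z : G.Space) :
    G.intrinsicDist ℓ x z ≤ G.intrinsicDist ℓ x y + G.intrinsicDist ℓ y z := by
  rw [intrinsicDist, intrinsicDist, intrinsicDist, ENNReal.sInf_add]
  refine le_iInf₂ fun L hL => ?_
  rw [add_comm, ENNReal.sInf_add]
  refine le_iInf₂ fun L' hL' => ?_
  rw [add_comm]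
  exact sInf_le (IsChain.append hL hL')

theorem intrinsicDist_point_le (t : T) (u v : stdSimplex ℝ (Fin (n + 1))) :
    G.intrinsicDist ℓ (G.point t u) (G.point t v) ≤
      edist (G.position ℓ t u) (G.position ℓ t v) :=
  sInf_le (isChain_single t u v)

theorem position_segment (t : T) (u v : stdSimplex ℝ (Fin (n + 1))) (s : unitInterval) :
    G.position ℓ t (stdSimplex.segment u v s) =
      AffineMap.lineMap (G.position ℓ t u) (G.position ℓ t v) (s : ℝ) := by
  rw [AffineMap.lineMap_apply_module]
  simp only [position, stdSimplex.segment_apply, add_smul, mul_smul, Finset.sum_add_distrib,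
    Finset.smul_sum]

/-- A function that is locally short on each simplex is short. -/
theorem edist_le_intrinsicDist {F : G.Space → ℝ}
    (hF : ∀ t u, ∀ᶠ w in 𝓝 u, edist (F (G.point t u)) (F (G.point t w)) ≤
      edist (G.position ℓ t u) (G.position ℓ t w)) (x y : G.Space) :
    edist (F x) (F y) ≤ G.intrinsicDist ℓ x y := by
  have hseg : ∀ t u v, edist (F (G.point t u)) (F (G.point t v)) ≤
      edist (G.position ℓ t u) (G.position ℓ t v) := by
    intro t u v
    let c : ℝ → stdSimplex ℝ (Fin (n + 1)) := fun s =>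
      stdSimplex.segment u v (Set.projIcc 0 1 zero_le_one s)
    have hc : Continuous c := (stdSimplex.continuous_segment u v).comp continuous_projIcc
    have h := le_of_locally_le_mul_edist
      (D := fun s s' => edist (F (G.point t (c s))) (F (G.point t (c s'))))
      (edist_ne_top (G.position ℓ t u) (G.position ℓ t v)) (fun _ _ _ => edist_triangle _ _ _)
      (fun _ _ => edist_comm _ _) (fun _ => edist_self _) (fun s hs => ?_)
    · have h0 : c 0 = u := by
        simp only [c, Set.projIcc_left]
        exact stdSimplex.segment_zero u v
      have h1 : c 1 = v := by
        simp only [c, Set.projIcc_right]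
        exact stdSimplex.segment_one u v
      simpa only [h0, h1] using h
    · filter_upwards [nhdsWithin_le_nhds (hc.continuousAt.eventually (hF t (c s))),
        self_mem_nhdsWithin] with s' h1 hs'
      refine h1.trans (le_of_eq ?_)
      simp only [c, Set.projIcc_of_mem zero_le_one hs, Set.projIcc_of_mem zero_le_one hs',
        position_segment]
      rw [edist_dist, dist_lineMap_lineMap, ENNReal.ofReal_mul dist_nonneg, ← edist_dist,
        ← edist_dist]
  refine le_sInf fun L hL => ?_
  induction hL with
  | nil => simp
  | cons t u v y L _ ih =>
    exact (edist_triangle _ _ _).trans (add_le_add (hseg t u v) ih)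

end Distance

/-- A locally flat metric is flat. -/
theorem IsLocallyFlatAt.exists_ball [Finite T] [T2Space G.Space]
    (hℓ : G.IsPolyhedralMetric ℓ) (hn : n ≠ 0) {x : G.Space} (hx : G.IsLocallyFlatAt ℓ x) :
    ∃ r : ℝ≥0∞, 0 < r ∧ r < ∞ ∧ ∃ f : G.Space → EuclideanSpace ℝ (Fin n),
      Set.BijOn f {y | G.intrinsicDist ℓ x y < r} (Metric.eball (f x) r) ∧
      ∀ y z, G.intrinsicDist ℓ x y < r → G.intrinsicDist ℓ x z < r →
        edist (f y) (f z) = G.intrinsicDist ℓ y z := by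
  classical
  obtain ⟨φ, hxφ, γ, hγ, hφ⟩ := hx
  have hlocal : ∀ t u, G.point t u ∈ φ.source → ∀ᶠ w in 𝓝 u, G.point t w ∈ φ.source ∧
      edist (φ (G.point t u)) (φ (G.point t w)) =
        edist (G.position ℓ t u) (G.position ℓ t w) := by
    intro t u hu
    filter_upwards [hγ.eventually_eq t u hu,
      (continuous_point t).continuousAt.preimage_mem_nhds (φ.open_source.mem_nhds hu)] with w hw hws
    refine ⟨hws, ?_⟩
    rw [hφ, hφ, hγ.developingMap_point hℓ hn hu, hγ.developingMap_point hℓ hn hws, hw,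
      AffineIsometryEquiv.edist_map]
  set o := φ x with ho
  obtain ⟨R, hR, hball⟩ := Metric.isOpen_iff.1 φ.open_target o (φ.map_source hxφ)
  -- The ball has radius `r`, distances are truncated at `2 * r`, and the compact set `C` and the
  -- open set `S` have radii `3 * r` and `4 * r`.
  obtain ⟨r, hr, hrR⟩ : ∃ r, 0 < r ∧ 4 * r < R := ⟨R / 5, by positivity, by linarith⟩
  -- upper bound
  have hupper : ∀ v ∈ Metric.ball o R, ∀ v' ∈ Metric.ball o R,
      G.intrinsicDist ℓ (φ.symm v) (φ.symm v') ≤ edist v v' := by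
    intro v hv v' hv'
    have hmem : ∀ s ∈ Set.Icc (0 : ℝ) 1, AffineMap.lineMap v v' s ∈ Metric.ball o R := by
      intro s hs
      exact (convex_ball o R).lineMap_mem hv hv' hs
    have h := le_of_locally_le_mul_edist
      (D := fun s s' => G.intrinsicDist ℓ (φ.symm (AffineMap.lineMap v v' s))
        (φ.symm (AffineMap.lineMap v v' s')))
      (edist_ne_top v v') (fun _ _ _ => intrinsicDist_triangle _ _ _)
      (fun _ _ => intrinsicDist_comm _ _) (fun _ => intrinsicDist_self _) (fun s hs => ?_)
    · simpa using h
    · have hs1 := hball (hmem s hs)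
      set z := φ.symm (AffineMap.lineMap v v' s) with hz
      have hzs : z ∈ φ.source := φ.map_target hs1
      have h1 : ∀ᶠ z' in 𝓝 z, ∀ t w, G.point t w = z' →
          G.intrinsicDist ℓ z z' ≤ edist (φ z) (φ z') := by
        have h2 : ∀ᶠ z' in 𝓝 z, ∀ t w, G.point t w = z' →
            G.intrinsicDist ℓ z (G.point t w) ≤ edist (φ z) (φ (G.point t w)) := by
          refine eventually_forall_point fun t u hu => ?_
          filter_upwards [hlocal t u (by rwa [hu])] with w hw
          rw [← hu, hw.2]
          exact intrinsicDist_point_le t u w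
        filter_upwards [h2] with z' hz' t w hw
        rw [← hw]
        exact hz' t w hw
      have hc : ContinuousAt (fun s => φ.symm (AffineMap.lineMap v v' s)) s :=
        ContinuousAt.comp (f := fun s : ℝ => AffineMap.lineMap v v' s)
          (φ.symm.continuousAt hs1) (by
            have : Continuous fun s : ℝ => AffineMap.lineMap v v' s :=
              AffineMap.lineMap_continuous
            exact this.continuousAt)
      filter_upwards [nhdsWithin_le_nhds (hc.eventually h1), self_mem_nhdsWithin] with s' h2 hs'
      obtain ⟨t, w, htw⟩ := exists_point_eq (φ.symm (AffineMap.lineMap v v' s'))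
      refine (h2 t w htw).trans (le_of_eq ?_)
      rw [hz, φ.right_inv hs1, φ.right_inv (hball (hmem s' hs')), edist_dist,
        dist_lineMap_lineMap, ENNReal.ofReal_mul dist_nonneg, ← edist_dist, ← edist_dist]
  -- lower bound
  set S : Set G.Space := φ.source ∩ φ ⁻¹' Metric.ball o (4 * r) with hS
  have hSo : IsOpen S := φ.isOpen_inter_preimage Metric.isOpen_ball
  set C : Set G.Space := φ.symm '' Metric.closedBall o (3 * r) with hC
  have hsub3 : Metric.closedBall o (3 * r) ⊆ φ.target :=
    (Metric.closedBall_subset_ball (by linarith)).trans hball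
  have hCc : IsClosed C :=
    ((isCompact_closedBall o (3 * r)).image_of_continuousOn
      (φ.continuousOn_symm.mono hsub3)).isClosed
  have hCS : C ⊆ S := by
    rintro - ⟨v, hv, rfl⟩
    refine ⟨φ.map_target (hsub3 hv), ?_⟩
    rw [Set.mem_preimage, φ.right_inv (hsub3 hv)]
    exact Metric.closedBall_subset_ball (by linarith) hv
  have hlower : ∀ y ∈ φ.source, φ y ∈ Metric.ball o r → ∀ z,
      ENNReal.ofReal (if z ∈ S then min (dist (φ z) (φ y)) (2 * r) else 2 * r) ≤
        G.intrinsicDist ℓ y z := by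
    intro y hy hyb z
    -- Euclidean distance from `y`, truncated so that it extends to a locally short function on the
    -- whole space; paths leaving the chart are thereby controlled too. The truncation is not felt
    -- by two points of the ball of radius `r`.
    set F : G.Space → ℝ := fun z => if z ∈ S then min (dist (φ z) (φ y)) (2 * r) else 2 * r with hF
    have h1 := edist_le_intrinsicDist (ℓ := ℓ) (F := F) (fun t u => ?_) y z
    · have h2 : F y = 0 := by
        have hyS : y ∈ S := ⟨hy, Metric.ball_subset_ball (by linarith) hyb⟩
        simp only [hF, if_pos hyS, dist_self]
        exact min_eq_left (by linarith)
      have h3 : 0 ≤ F z := by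
        simp only [hF]
        split_ifs <;> positivity
      rw [h2, edist_comm, edist_dist, Real.dist_eq, sub_zero, abs_of_nonneg h3] at h1
      exact h1
    · by_cases hu : G.point t u ∈ S
      · filter_upwards [hlocal t u hu.1,
          (continuous_point t).continuousAt.preimage_mem_nhds (hSo.mem_nhds hu)] with w hw hwS
        rw [← hw.2]
        have hwS' : G.point t w ∈ S := hwS
        simp only [hF, if_pos hu, if_pos hwS']
        rw [edist_dist, edist_dist]
        refine ENNReal.ofReal_le_ofReal ?_
        rw [Real.dist_eq]
        refine (abs_min_sub_min_le_max _ _ _ _).trans ?_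
        rw [sub_self, abs_zero, max_eq_left (abs_nonneg _)]
        exact abs_dist_sub_le _ _ _
      · have huC : G.point t u ∈ Cᶜ := fun h => hu (hCS h)
        filter_upwards [(continuous_point t).continuousAt.preimage_mem_nhds
          (hCc.isOpen_compl.mem_nhds huC)] with w hw
        -- Outside `C` but inside `S` the image is more than `3 * r` away from `o`, hence more than
        -- `2 * r` away from `φ y`; the two branches of `F` match.
        have h4 : ∀ z, z ∉ C → F z = 2 * r := by
          intro z hz
          simp only [hF]
          split_ifs with hzS
          · refine min_eq_right ?_
            by_contra hcon
            refine hz ⟨φ z, ?_, φ.left_inv hzS.1⟩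
            rw [Metric.mem_closedBall]
            have h5 := dist_triangle (φ z) (φ y) o
            have h6 := Metric.mem_ball.1 hyb
            linarith
          · rfl
        rw [h4 _ huC, h4 _ hw, edist_self]
        exact zero_le
  have hr0 : 0 < ENNReal.ofReal r := ENNReal.ofReal_pos.2 hr
  have hiff : ∀ y, G.intrinsicDist ℓ x y < ENNReal.ofReal r ↔
      y ∈ φ.source ∧ φ y ∈ Metric.ball o r := by
    intro y
    constructor
    · intro hy
      have h1 := (hlower x hxφ (Metric.mem_ball_self hr) y).trans_lt hy
      rw [ENNReal.ofReal_lt_ofReal_iff hr] at h1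
      split_ifs at h1 with hyS
      · refine ⟨hyS.1, ?_⟩
        rcases min_lt_iff.1 h1 with h2 | h2
        · exact h2
        · linarith
      · linarith
    · rintro ⟨hy, hyb⟩
      have h1 := hupper o (Metric.mem_ball_self hR) (φ y)
        (Metric.ball_subset_ball (by linarith) hyb)
      rw [ho, φ.left_inv hxφ, φ.left_inv hy] at h1
      refine h1.trans_lt ?_
      rw [edist_dist, dist_comm]
      exact (ENNReal.ofReal_lt_ofReal_iff hr).2 hyb
  refine ⟨ENNReal.ofReal r, hr0, ENNReal.ofReal_lt_top, φ, ?_, ?_⟩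
  · rw [Metric.eball_ofReal]
    refine ⟨fun y hy => ((hiff y).1 hy).2, fun y hy z hz h => ?_, fun v hv => ?_⟩
    · exact φ.injOn ((hiff y).1 hy).1 ((hiff z).1 hz).1 h
    · have hvt : v ∈ φ.target := hball (Metric.ball_subset_ball (by linarith) hv)
      refine ⟨φ.symm v, (hiff _).2 ⟨φ.map_target hvt, ?_⟩, φ.right_inv hvt⟩
      rw [φ.right_inv hvt]
      exact hv
  · intro y z hy hz
    obtain ⟨hys, hyb⟩ := (hiff y).1 hy
    obtain ⟨hzs, hzb⟩ := (hiff z).1 hz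
    refine le_antisymm ?_ ?_
    · have h1 := hlower y hys hyb z
      have hzS : z ∈ S := ⟨hzs, Metric.ball_subset_ball (by linarith) hzb⟩
      rw [if_pos hzS, min_eq_left] at h1
      · rwa [edist_comm, edist_dist]
      · have h2 := dist_triangle_right (φ z) (φ y) o
        have h3 := Metric.mem_ball.1 hyb
        have h4 := Metric.mem_ball.1 hzb
        linarith
    · have h1 := hupper (φ y) (Metric.ball_subset_ball (by linarith) hyb) (φ z)
        (Metric.ball_subset_ball (by linarith) hzb)
      rwa [φ.left_inv hys, φ.left_inv hzs] at h1

end FacetGluing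

/-! ### Flatness at a point with a flat punctured neighbourhood -/

namespace FacetGluing

variable {T : Type*} {n : ℕ} {G : FacetGluing T n} {ℓ : G.Edge → ℝ}

/-- Two developments differ locally by a fixed motion on the left, so near a flat point every
developing map is a motion composed with a chart. -/
theorem IsDevelopment.isLocalHomeomorphOn_developingMap [Finite T] [T2Space G.Space]
    (hℓ : G.IsPolyhedralMetric ℓ) (hn : n ≠ 0) {W S : Set G.Space}
    {γ : T → stdSimplex ℝ (Fin (n + 1)) →
      (EuclideanSpace ℝ (Fin n) ≃ᵃⁱ[ℝ] EuclideanSpace ℝ (Fin n))}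
    (hγ : G.IsDevelopment (G.transition ℓ) W γ) (hS : S ⊆ W)
    (h : ∀ y ∈ S, G.IsLocallyFlatAt ℓ y) : IsLocalHomeomorphOn (G.developingMap ℓ γ) S := by
  refine IsLocalHomeomorphOn.mk _ _ fun y hy => ?_
  obtain ⟨φ, hyφ, γ', hγ', hφ⟩ := h y hy
  obtain ⟨t, u, rfl⟩ := exists_point_eq y
  set a := γ t u * (γ' t u)⁻¹ with ha
  have h1 := hγ.eventually_ratio_eq hγ' (hS hy) hyφ
  obtain ⟨O, hO, hOo, huO⟩ := mem_nhds_iff.1 (Filter.inter_mem h1 (hγ.isOpen.mem_nhds (hS hy)))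
  refine ⟨(φ.restr O).trans a.toHomeomorph.toOpenPartialHomeomorph, ?_, ?_⟩
  · simpa [hOo.interior_eq] using ⟨hyφ, huO⟩
  · intro z hz
    have hz' : z ∈ φ.source ∧ z ∈ O := by simpa [hOo.interior_eq] using hz
    obtain ⟨s, w, rfl⟩ := exists_point_eq z
    obtain ⟨h2, h3⟩ := hO hz'.2
    have h4 : γ s w = a * γ' s w := mul_inv_eq_iff_eq_mul.1 (h2 s w rfl)
    rw [hγ.developingMap_point hℓ hn h3, h4]
    change a (γ' s w (G.position ℓ s w)) = a (φ (G.point s w))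
    rw [hφ, hγ'.developingMap_point hℓ hn hz'.1]

/-- In a manifold of dimension at least three, flatness near all points near a point implies
flatness near the point. -/
theorem isLocallyFlatAt_of_punctured [Finite T] [T2Space G.Space] (hn : 3 ≤ n)
    (hℓ : G.IsPolyhedralMetric ℓ) {x : G.Space}
    (φ : OpenPartialHomeomorph G.Space (EuclideanSpace ℝ (Fin n))) (hxφ : x ∈ φ.source)
    (hx : ∀ t u, G.point t u = x → ∃ i, u i = 0)
    (hflat : ∀ᶠ y in 𝓝[≠] x, G.IsLocallyFlatAt ℓ y) : G.IsLocallyFlatAt ℓ x := by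
  have hn0 : n ≠ 0 := by omega
  have : CompactSpace G.Space := compactSpace_space
  obtain ⟨W, γ, hxW, hγ⟩ := exists_development_of_punctured (h := G.transition ℓ) hn φ hxφ hx
    (by
      filter_upwards [hflat] with y hy
      obtain ⟨φ, hy, γ, hγ, -⟩ := hy
      exact ⟨_, γ, hy, hγ⟩)
  set f := G.developingMap ℓ γ with hf
  set o := f x with ho
  have hfc : ContinuousOn f W := hγ.continuousOn_developingMap hℓ hn0
  have hpt : ∀ t w, G.point t w ∈ W → f (G.point t w) = γ t w (G.position ℓ t w) := fun t w hw =>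
    hγ.developingMap_point hℓ hn0 hw
  have hrep : ∀ t u, G.point t u = x → γ t u (G.position ℓ t u) = o := by
    rintro t u rfl
    rw [ho, hpt t u hxW]
  have hsmall : ∀ N ∈ 𝓝 x, ∃ ρ > 0, ∀ t u, G.point t u = x → ∀ w,
      dist (G.position ℓ t w) (G.position ℓ t u) < ρ → G.point t w ∈ N ∧ γ t w = γ t u := by
    intro N hN
    have h1 : ∀ᶠ ρ in 𝓝[>] (0 : ℝ), ∀ c ∈ {c : T × stdSimplex ℝ (Fin (n + 1)) |
        G.point c.1 c.2 = x}, ∀ w, dist (G.position ℓ c.1 w) (G.position ℓ c.1 c.2) < ρ →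
          G.point c.1 w ∈ N ∧ γ c.1 w = γ c.1 c.2 := by
      refine (finite_point_fiber x).eventually_all.2 fun c hc => ?_
      have hcx : G.point c.1 c.2 = x := hc
      have h2 : ∀ᶠ w in 𝓝 c.2, G.point c.1 w ∈ N ∧ γ c.1 w = γ c.1 c.2 :=
        Filter.inter_mem
          ((continuous_point (G := G) c.1).continuousAt.preimage_mem_nhds (hcx.symm ▸ hN))
          (hγ.eventually_eq c.1 c.2 (hcx.symm ▸ hxW))
      rw [hℓ.nhds_eq_comap_position c.1, Filter.eventually_comap] at h2
      obtain ⟨δ, hδ, h3⟩ := Metric.eventually_nhds_iff.1 h2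
      filter_upwards [nhdsWithin_le_nhds (gt_mem_nhds hδ)] with ρ hρ w hw
      exact h3 (hw.trans hρ) w rfl
    obtain ⟨ρ, h2, h3⟩ := (h1.and self_mem_nhdsWithin).exists
    exact ⟨ρ, h3, fun t u hu w hw => h2 (t, u) hu w hw⟩
  have hnear : ∀ᶠ z in 𝓝 x, ∀ t w, G.point t w = z → ∃ u, G.point t u = x ∧ γ t w = γ t u := by
    refine eventually_forall_point fun t u hu => ?_
    filter_upwards [hγ.eventually_eq t u (hu.symm ▸ hxW)] with w hw using ⟨u, hu, hw⟩
  rw [eventually_nhdsWithin_iff] at hflat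
  obtain ⟨K, hK, hKV, hKc⟩ := LocallyCompactSpace.local_compact_nhds x _
    (Filter.inter_mem (Filter.inter_mem hnear hflat) (hγ.isOpen.mem_nhds hxW))
  have hKW : K ⊆ W := fun z hz => (hKV hz).2
  obtain ⟨ρ, hρ, hρK⟩ := hsmall (interior K) (interior_mem_nhds.2 hK)
  have hdist : ∀ t u w, γ t w = γ t u → G.point t u = x → G.point t w ∈ W →
      dist (f (G.point t w)) o = dist (G.position ℓ t w) (G.position ℓ t u) := by
    intro t u w h1 h2 h3
    rw [hpt t w h3, ← hrep t u h2, h1, AffineIsometryEquiv.dist_map]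
  -- The developing map preserves the distance from the centre. So points of `K` with image in the
  -- `ρ`-ball stay away from the boundary of `K`, which makes the map over this ball proper.
  have hball : ∀ z ∈ K, f z ∈ Metric.ball o ρ → ∃ t u w, G.point t u = x ∧ G.point t w = z ∧
      γ t w = γ t u ∧ dist (G.position ℓ t w) (G.position ℓ t u) = dist (f z) o ∧
        z ∈ interior K := by
    intro z hz hzb
    obtain ⟨t, w, rfl⟩ := exists_point_eq z
    obtain ⟨u, hu, hwu⟩ := (hKV hz).1.1 t w rfl
    have h1 := hdist t u w hwu hu (hKW hz)
    refine ⟨t, u, w, hu, rfl, hwu, h1.symm, (hρK t u hu w ?_).1⟩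
    rw [← h1]
    exact hzb
  set B := puncturedBall o ρ with hB
  set S : Set G.Space := K ∩ f ⁻¹' B with hS
  have hSint : S = interior K ∩ f ⁻¹' B := by
    ext z
    constructor
    · rintro ⟨hz, hzB⟩
      obtain ⟨-, -, -, -, -, -, -, h1⟩ := hball z hz hzB.1
      exact ⟨h1, hzB⟩
    · rintro ⟨hz, hzB⟩
      exact ⟨interior_subset hz, hzB⟩
  have hSo : IsOpen S := by
    rw [hSint]
    exact (hfc.mono (interior_subset.trans hKW)).isOpen_inter_preimage isOpen_interior
      (isOpen_puncturedBall o ρ)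
  have hSx : ∀ z ∈ S, z ≠ x := by
    rintro z hz rfl
    exact hz.2.2 rfl
  -- the punctured tiles
  let P : T → stdSimplex ℝ (Fin (n + 1)) → Set G.Space := fun t u =>
    G.point t '' ((G.position ℓ t ⁻¹' Metric.ball (G.position ℓ t u) ρ) \ {u})
  have hPS : ∀ t u, G.point t u = x → P t u ⊆ S := by
    rintro t u hu - ⟨w, ⟨hw, hwu⟩, rfl⟩
    obtain ⟨h1, h2⟩ := hρK t u hu w hw
    have h3 := hdist t u w h2 hu (hKW (interior_subset h1))
    refine ⟨interior_subset h1, ?_, fun h4 => hwu ?_⟩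
    · rw [Metric.mem_ball, h3]; exact hw
    · have h5 : f (G.point t w) = o := h4
      rw [h5, dist_self] at h3
      exact hℓ.position_injective t (dist_eq_zero.1 h3.symm)
  have hPconn : ∀ t u, G.point t u = x → IsPreconnected (P t u) := by
    intro t u hu
    obtain ⟨i, hi⟩ := hx t u hu
    refine IsPreconnected.image (stdSimplex.isPreconnected_sdiff_singleton hi
      (Metric.isOpen_ball.preimage (continuous_position t)) ?_) _ (continuous_point t).continuousOn
    have : Subtype.val '' (G.position ℓ t ⁻¹' Metric.ball (G.position ℓ t u) ρ) =
        stdSimplex ℝ (Fin (n + 1)) ∩ (Fintype.linearCombination ℝ (G.placement ℓ t)) ⁻¹'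
          Metric.ball (G.position ℓ t u) ρ := by
      ext v
      constructor
      · rintro ⟨v, hv, rfl⟩
        exact ⟨v.2, hv⟩
      · rintro ⟨hv, hv'⟩
        exact ⟨⟨v, hv⟩, hv', rfl⟩
    rw [this]
    exact (convex_stdSimplex ℝ _).inter ((convex_ball _ _).linear_preimage _)
  have hfreq : ∀ t u, G.point t u = x → ∀ i, u i = 0 →
      ∃ w, w i = 0 ∧ w ≠ u ∧ G.position ℓ t w ∈ Metric.ball (G.position ℓ t u) ρ := by
    intro t u _ i hi
    obtain ⟨w, h1, h2, h3⟩ := ((stdSimplex.frequently_facet (by omega) u hi).and_eventually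
      (Filter.inter_mem (self_mem_nhdsWithin : _ ∈ 𝓝[≠] u) (nhdsWithin_le_nhds
        ((continuous_position (ℓ := ℓ) t).continuousAt.preimage_mem_nhds
          (Metric.ball_mem_nhds _ hρ))))).exists
    exact ⟨w, h1, h2, h3⟩
  obtain ⟨t₀, u₀, hu₀⟩ := exists_point_eq x
  obtain ⟨i₀, hi₀⟩ := hx t₀ u₀ hu₀
  obtain ⟨w₀, -, hw₀, hw₀'⟩ := hfreq t₀ u₀ hu₀ i₀ hi₀
  have hz₀ : G.point t₀ w₀ ∈ P t₀ u₀ := ⟨w₀, ⟨hw₀', hw₀⟩, rfl⟩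
  -- Neighbouring tiles share points of their common facet other than `x`, and facet crossings join
  -- any two representatives of `x`; so the union of the punctured tiles is connected.
  have hlink : ∀ t u, G.point t u = x → ∃ Q ⊆ S, IsPreconnected Q ∧ G.point t₀ w₀ ∈ Q ∧
      P t u ⊆ Q := by
    intro t u hu
    have := point_induction (G := G) (P := fun t u => G.point t u = x ∧ ∃ Q ⊆ S,
      IsPreconnected Q ∧ G.point t₀ w₀ ∈ Q ∧ P t u ⊆ Q) ?_ (hu₀.trans hu.symm)
      ⟨hu₀, P t₀ u₀, hPS t₀ u₀ hu₀, hPconn t₀ u₀ hu₀, hz₀, subset_rfl⟩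
    · exact this.2
    · rintro t u i hi ⟨hu, Q, hQS, hQ, hQ0, hPQ⟩
      have hu' := (point_nbr t hi).trans hu
      obtain ⟨w, hwi, hwu, hwb⟩ := hfreq t u hu i hi
      refine ⟨hu', Q ∪ P (G.nbr t i) (stdSimplex.map (G.perm t i) u),
        Set.union_subset hQS (hPS _ _ hu'), ?_, .inl hQ0, Set.subset_union_right⟩
      refine IsPreconnected.union (G.point t w) (hPQ ⟨w, ⟨hwb, hwu⟩, rfl⟩) ?_ hQ (hPconn _ _ hu')
      refine ⟨stdSimplex.map (G.perm t i) w, ⟨?_, ?_⟩, point_nbr t hwi⟩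
      · have h1 : dist (G.position ℓ t w) (G.position ℓ t u) < ρ := hwb
        rw [← hℓ.transition_position hn0 t hwi, ← hℓ.transition_position hn0 t hi,
          AffineIsometryEquiv.dist_map] at h1
        exact h1
      · intro h1
        refine hwu ?_
        have := congrArg (stdSimplex.map ((G.perm t i)⁻¹ : Equiv.Perm _)) h1
        rwa [stdSimplex.map_inv_map, stdSimplex.map_inv_map] at this
  have hSconn : IsPreconnected S := by
    refine isPreconnected_of_forall (G.point t₀ w₀) fun z hz => ?_
    obtain ⟨t, u, w, hu, rfl, hwu, hd, -⟩ := hball z hz.1 hz.2.1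
    obtain ⟨Q, hQS, hQ, hQ0, hPQ⟩ := hlink t u hu
    refine ⟨Q, hQS, hQ0, hPQ ⟨w, ⟨?_, ?_⟩, rfl⟩, hQ⟩
    · rw [Set.mem_preimage, Metric.mem_ball, hd]
      exact hz.2.1
    · rintro rfl
      exact hSx _ hz hu
  -- the covering
  let p : S → B := fun z => ⟨f z, z.2.2⟩
  have hpc : Continuous p :=
    Continuous.subtype_mk ((hfc.mono fun z hz => hKW hz.1).comp_continuous continuous_subtype_val
      fun z => z.2) _
  have hpl : IsLocalHomeomorph p := by
    have h1 : IsLocalHomeomorph (Subtype.val : B → EuclideanSpace ℝ (Fin n)) :=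
      (isOpen_puncturedBall o ρ).isOpenEmbedding_subtypeVal.isLocalHomeomorph
    refine IsLocalHomeomorph.of_comp (g := Subtype.val) ?_ h1 hpc
    have h2 : IsLocalHomeomorphOn f S := hγ.isLocalHomeomorphOn_developingMap hℓ hn0
      (fun z hz => hKW hz.1) fun z hz => (hKV hz.1).1.2 (hSx z hz)
    have h3 : IsLocalHomeomorph (Subtype.val : S → G.Space) :=
      hSo.isOpenEmbedding_subtypeVal.isLocalHomeomorph
    rw [isLocalHomeomorph_iff_isLocalHomeomorphOn_univ] at h3 ⊢
    exact h2.comp h3 fun z _ => z.2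
  have hpclosed : IsClosedMap p := by
    intro A hA
    obtain ⟨A', hA', rfl⟩ := isClosed_induced_iff.1 hA
    have h1 : IsClosed (f '' (K ∩ A')) :=
      ((hKc.inter_right hA').image_of_continuousOn (hfc.mono fun z hz => hKW hz.1)).isClosed
    have h2 : p '' (Subtype.val ⁻¹' A') = Subtype.val ⁻¹' (f '' (K ∩ A')) := by
      ext v
      constructor
      · rintro ⟨z, hz, rfl⟩
        exact ⟨z, ⟨z.2.1, hz⟩, rfl⟩
      · rintro ⟨z, ⟨hzK, hzA⟩, hzv⟩
        exact ⟨⟨z, hzK, by rw [Set.mem_preimage, hzv]; exact v.2⟩, hzA, Subtype.ext hzv⟩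
    rw [h2]
    exact h1.preimage continuous_subtype_val
  have hpfin : ∀ v : B, (p ⁻¹' {v}).Finite := by
    intro v
    refine Set.Finite.of_finite_image ?_ Subtype.val_injective.injOn
    refine Set.Finite.subset (s := ⋃ c ∈ {c : T × stdSimplex ℝ (Fin (n + 1)) |
      G.point c.1 c.2 = x}, G.point c.1 '' (G.position ℓ c.1 ⁻¹' {(γ c.1 c.2).symm v})) ?_ ?_
    · refine (finite_point_fiber x).biUnion fun c _ => Set.Finite.image _ ?_
      exact (Set.finite_singleton _).preimage (hℓ.position_injective c.1).injOn
    · rintro - ⟨z, hz, rfl⟩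
      have hz' : f z = v := congrArg Subtype.val hz
      obtain ⟨t, u, w, hu, hw, hwu, -, -⟩ := hball z z.2.1 z.2.2.1
      refine Set.mem_biUnion (x := (t, u)) hu ⟨w, ?_, hw⟩
      rw [Set.mem_preimage, Set.mem_singleton_iff, ← hz', ← hw, hpt t w (by
        rw [hw]; exact hKW z.2.1), hwu, AffineIsometryEquiv.symm_apply_apply]
  -- A closed local homeomorphism with finite fibres is a covering.
  have hcov : IsCoveringMap p := by
    rw [isCoveringMap_iff_isCoveringMapOn_univ]
    refine hpclosed.isCoveringMapOn_of_isLocalHomeomorphOn (fun v _ => hpfin v) ?_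
    rw [Set.preimage_univ, ← isLocalHomeomorph_iff_isLocalHomeomorphOn_univ]
    exact hpl
  obtain ⟨s, hs, hps, hs0⟩ := hcov.exists_section_puncturedBall
    (by rw [finrank_euclideanSpace_fin]; exact hn) ⟨_, hPS t₀ u₀ hu₀ hz₀⟩
  have : PreconnectedSpace S := isPreconnected_iff_preconnectedSpace.1 hSconn
  -- Both sides lift `p` and agree at one point of the connected space `S`. So the section inverts
  -- the covering, which has a single sheet.
  have hsp : s ∘ p = id := by
    refine hcov.eq_of_comp_eq (hs.comp hpc) continuous_id ?_ ⟨_, hPS t₀ u₀ hu₀ hz₀⟩ hs0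
    funext z
    exact hps (p z)
  have hpinj : Function.Injective p := fun z z' h => by
    have := congrArg s h
    rwa [← Function.comp_apply (f := s), ← Function.comp_apply (f := s), hsp] at this
  refine hγ.isLocallyFlatAt hℓ hn0 hxW ?_ ?_
  · refine ⟨K ∩ f ⁻¹' Metric.ball o ρ, Filter.inter_mem hK
      ((hfc.continuousAt (hγ.isOpen.mem_nhds hxW)).preimage_mem_nhds (Metric.ball_mem_nhds _ hρ)), ?_⟩
    have hzero : ∀ z ∈ K, f z = o → z = x := by
      intro z hz hzo
      obtain ⟨t, u, w, hu, rfl, -, hd, -⟩ := hball z hz (by rw [hzo]; exact Metric.mem_ball_self hρ)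
      rw [hzo, dist_self] at hd
      rw [hℓ.position_injective t (dist_eq_zero.1 hd), hu]
    rintro z ⟨hzK, hzb⟩ z' ⟨hzK', hzb'⟩ heq
    have heq' : f z = f z' := heq
    by_cases hzo : f z = o
    · rw [hzero z hzK hzo, hzero z' hzK' (heq' ▸ hzo)]
    · have h1 : z ∈ S := ⟨hzK, hzb, hzo⟩
      have h2 : z' ∈ S := ⟨hzK', hzb', fun h => hzo (heq'.trans h)⟩
      exact congrArg Subtype.val (hpinj (a₁ := ⟨z, h1⟩) (a₂ := ⟨z', h2⟩) (Subtype.ext heq'))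
  · intro N hN
    obtain ⟨ρ', hρ', hρN⟩ := hsmall N hN
    filter_upwards [Metric.ball_mem_nhds o hρ, Metric.ball_mem_nhds o hρ'] with v hv hv'
    by_cases hvo : v = o
    · exact ⟨x, mem_of_mem_nhds hN, hvo.symm⟩
    · have h1 : f (s ⟨v, hv, hvo⟩) = v := congrArg Subtype.val (hps ⟨v, hv, hvo⟩)
      have h2 := (s ⟨v, hv, hvo⟩).2
      obtain ⟨t, u, w, hu, hw, hwu, hd, -⟩ := hball _ h2.1 h2.2.1
      refine ⟨s ⟨v, hv, hvo⟩, ?_, h1⟩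
      rw [← hw]
      refine (hρN t u hu w ?_).1
      rw [hd, h1]
      exact hv'

end FacetGluing

/-! ### Corners around a codimension-two face -/

namespace FacetGluing

variable {T : Type*} {n : ℕ}

/-- A simplex with an ordered pair of its facets, given by the opposite vertices. -/
abbrev Corner (T : Type*) (n : ℕ) : Type _ :=
  {s : T × Fin (n + 1) × Fin (n + 1) // s.2.1 ≠ s.2.2}

namespace Corner

/-- The corner with its two facets interchanged. -/
def flip : Equiv.Perm (Corner T n) :=
  Function.Involutive.toPerm (fun s => ⟨(s.1.1, s.1.2.2, s.1.2.1), s.2.symm⟩) fun _ => rfl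

/-- The corner on the other side of the first facet. -/
def cross (G : FacetGluing T n) : Equiv.Perm (Corner T n) :=
  Function.Involutive.toPerm (fun s => ⟨(G.nbr s.1.1 s.1.2.1, G.perm s.1.1 s.1.2.1 s.1.2.1,
    G.perm s.1.1 s.1.2.1 s.1.2.2), (G.perm _ _).injective.ne s.2⟩) fun s => by
      refine Subtype.ext (Prod.ext (G.nbr_nbr _ _) (Prod.ext ?_ ?_)) <;>
      · change G.perm (G.nbr s.1.1 s.1.2.1) (G.perm s.1.1 s.1.2.1 s.1.2.1) _ = _
        rw [G.perm_perm]
        exact Equiv.symm_apply_apply _ _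

/-- The next corner around the common codimension-two face of the two facets. -/
def turn (G : FacetGluing T n) : Equiv.Perm (Corner T n) := flip * cross G

variable (G : FacetGluing T n)

theorem flip_mul_flip : (flip : Equiv.Perm (Corner T n)) * flip = 1 := rfl

/-- The two involutions `flip` and `cross` generate a dihedral action in which `turn` is the
rotation and `flip` reverses the sense of rotation. -/
theorem semiconjBy_flip : SemiconjBy flip (turn G) (turn G)⁻¹ := by
  have h1 : (flip : Equiv.Perm (Corner T n))⁻¹ = flip := rfl
  have h2 : (cross G)⁻¹ = cross G := rfl
  change flip * (flip * cross G) = (flip * cross G)⁻¹ * flip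
  rw [mul_inv_rev, h1, h2, mul_assoc, flip_mul_flip, mul_one, ← mul_assoc, flip_mul_flip, one_mul]

theorem flip_turn_zpow (m : ℤ) (s : Corner T n) :
    flip ((turn G ^ m) s) = (turn G ^ (-m)) (flip s) := by
  have h := ((semiconjBy_flip G).zpow_right m).eq
  rw [inv_zpow'] at h
  exact Equiv.congr_fun h s

theorem flip_ne (s : Corner T n) : flip s ≠ s := fun h =>
  s.2 (congrArg (fun s : Corner T n => s.1.2.1) h).symm

theorem cross_ne (s : Corner T n) : cross G s ≠ s := fun h =>
  G.no_fixed_facet s.1.1 s.1.2.1 ⟨congrArg (fun s : Corner T n => s.1.1) h,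
    congrArg (fun s : Corner T n => s.1.2.1) h⟩

/-- Otherwise, at half the way, one of the two reflections would have a fixed corner: `flip` for
even `m`, `cross` for odd `m`. The latter is excluded since no facet is paired with itself. Hence
the two senses of rotation around a face give disjoint orbits. -/
theorem turn_zpow_ne_flip (m : ℤ) (s : Corner T n) : (turn G ^ m) s ≠ flip s := by
  intro h
  rcases Int.even_or_odd' m with ⟨l, rfl | rfl⟩
  · refine flip_ne ((turn G ^ l) s) ?_
    rw [flip_turn_zpow, ← h, ← Equiv.Perm.mul_apply, ← zpow_add]
    congr 2
    ring
  · refine cross_ne G ((turn G ^ l) s) ?_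
    have h1 : flip (cross G ((turn G ^ l) s)) = flip ((turn G ^ l) s) := by
      rw [flip_turn_zpow, ← h]
      change (turn G) ((turn G ^ l) s) = _
      rw [← Equiv.Perm.mul_apply, ← Equiv.Perm.mul_apply, ← zpow_one_add, ← zpow_add]
      congr 2
      ring
    exact flip.injective h1

/-- The codimension-two face at a corner. -/
def hinge (s : Corner T n) : G.Hinge := G.hinge s.1.1 s.1.2.1 s.1.2.2 s.2

/-- The face of a simplex at a corner. -/
def face (s : Corner T n) : T × {s : Finset (Fin (n + 1)) // s.card = n - 1} :=
  (s.1.1, ⟨{s.1.2.1, s.1.2.2}ᶜ, by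
    rw [Finset.card_compl, Finset.card_pair s.2, Fintype.card_fin]; omega⟩)

theorem hinge_eq_mk (s : Corner T n) : hinge G s = Quot.mk _ (face s) := rfl

theorem face_flip (s : Corner T n) : face (flip s) = face s :=
  Prod.ext rfl (Subtype.ext (by
    change ({s.1.2.2, s.1.2.1}ᶜ : Finset (Fin (n + 1))) = {s.1.2.1, s.1.2.2}ᶜ
    rw [Finset.pair_comm]))

theorem face_eq_iff {s s' : Corner T n} : face s = face s' ↔ s = s' ∨ s = flip s' := by
  constructor
  · rintro h
    have h1 : s.1.1 = s'.1.1 := (congrArg Prod.fst h : (face s).1 = (face s').1)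
    have h2 : ({s.1.2.1, s.1.2.2} : Finset (Fin (n + 1))) = {s'.1.2.1, s'.1.2.2} :=
      compl_injective (congrArg (fun c => c.2.1) h)
    have h3 : s.1.2.1 ∈ ({s'.1.2.1, s'.1.2.2} : Finset (Fin (n + 1))) := by
      rw [← h2]; simp
    have h4 : s.1.2.2 ∈ ({s'.1.2.1, s'.1.2.2} : Finset (Fin (n + 1))) := by
      rw [← h2]; simp
    rw [Finset.mem_insert, Finset.mem_singleton] at h3 h4
    have h5 := s.2
    rcases h3 with h3 | h3 <;> rcases h4 with h4 | h4
    · exact absurd (h3.trans h4.symm) h5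
    · exact .inl (Subtype.ext (Prod.ext h1 (Prod.ext h3 h4)))
    · exact .inr (Subtype.ext (Prod.ext h1 (Prod.ext h3 h4)))
    · exact absurd (h3.trans h4.symm) h5
  · rintro (rfl | rfl)
    · rfl
    · exact face_flip _

theorem faceStep_iff {s : Corner T n} {d : T × {s : Finset (Fin (n + 1)) // s.card = n - 1}} :
    G.FaceStep (n - 1) (face s) d ↔ d = face (cross G s) ∨ d = face (cross G (flip s)) := by
  have hmap : ∀ s : Corner T n, (face s).2.1.map (G.perm s.1.1 s.1.2.1).toEmbedding =
      (face (cross G s)).2.1 := by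
    intro s
    ext a
    obtain ⟨b, rfl⟩ := (G.perm s.1.1 s.1.2.1).surjective a
    change _ ↔ G.perm s.1.1 s.1.2.1 b ∈ ({G.perm s.1.1 s.1.2.1 s.1.2.1,
      G.perm s.1.1 s.1.2.1 s.1.2.2}ᶜ : Finset (Fin (n + 1)))
    simp [face]
  constructor
  · rintro ⟨i, hi, h1, h2⟩
    have hi' : i = s.1.2.1 ∨ i = s.1.2.2 := by
      change i ∉ ({s.1.2.1, s.1.2.2}ᶜ : Finset (Fin (n + 1))) at hi
      rwa [Finset.mem_compl, not_not, Finset.mem_insert, Finset.mem_singleton] at hi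
    rcases hi' with rfl | rfl
    · exact .inl (Prod.ext h1 (Subtype.ext (h2.trans (hmap s))))
    · refine .inr (Prod.ext h1 (Subtype.ext (h2.trans ?_)))
      have h3 := hmap (flip s)
      rw [face_flip] at h3
      exact h3
  · rintro (rfl | rfl)
    · exact ⟨s.1.2.1, by simp [face], rfl, (hmap s).symm⟩
    · refine ⟨s.1.2.2, by simp [face], rfl, ?_⟩
      have h3 := hmap (flip s)
      rw [face_flip] at h3
      exact h3.symm

theorem hinge_flip (s : Corner T n) : hinge G (flip s) = hinge G s := by
  rw [hinge_eq_mk, face_flip, ← hinge_eq_mk]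

theorem hinge_turn (s : Corner T n) : hinge G (turn G s) = hinge G s := by
  change hinge G (flip (cross G s)) = _
  rw [hinge_flip, hinge_eq_mk, hinge_eq_mk]
  exact (Quot.sound ((faceStep_iff G).2 (.inl rfl))).symm

theorem hinge_turn_zpow (m : ℤ) (s : Corner T n) : hinge G ((turn G ^ m) s) = hinge G s := by
  induction m with
  | zero => rfl
  | succ m ih => rw [add_comm, zpow_one_add, Equiv.Perm.mul_apply, hinge_turn, ih]
  | pred m ih =>
    rw [← hinge_turn G, ← Equiv.Perm.mul_apply, ← zpow_one_add, add_sub_cancel, ih]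

/-- A codimension-two face of a simplex lies in exactly two facets, so its identifications lead only
one step forward or backward along the rotation. -/
theorem hinge_eq_iff {s s' : Corner T n} :
    hinge G s' = hinge G s ↔ ∃ m : ℤ, s' = (turn G ^ m) s ∨ s' = flip ((turn G ^ m) s) := by
  constructor
  · intro h
    have h1 := Quot.eqvGen_exact h.symm
    let P : T × {s : Finset (Fin (n + 1)) // s.card = n - 1} → Prop := fun c =>
      ∃ m : ℤ, c = face ((turn G ^ m) s)
    have hcross : ∀ s : Corner T n, face (cross G s) = face (turn G s) := fun s =>
      (face_flip _).symm
    have hturn : ∀ m : ℤ, turn G ((turn G ^ m) s) = (turn G ^ (1 + m)) s := fun m => by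
      rw [zpow_one_add, Equiv.Perm.mul_apply]
    have hstep : ∀ c d, P c → G.FaceStep (n - 1) c d → P d := by
      rintro _ d ⟨m, rfl⟩ h
      rcases (faceStep_iff G).1 h with rfl | rfl
      · exact ⟨1 + m, by rw [hcross, hturn]⟩
      · refine ⟨m - 1, ?_⟩
        rw [hcross, flip_turn_zpow, ← Equiv.Perm.mul_apply, ← zpow_one_add,
          show 1 + -m = -(m - 1) by ring, ← flip_turn_zpow, face_flip]
    have hstep' : ∀ c d, P d → G.FaceStep (n - 1) c d → P c := by
      rintro c _ ⟨m, rfl⟩ ⟨i, hi, h1, h2⟩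
      refine hstep _ _ ⟨m, rfl⟩ ⟨G.perm c.1 i i, ?_, ?_, ?_⟩
      · rw [h2]; simpa using hi
      · rw [h1, G.nbr_nbr]
      · rw [h1, h2, G.perm_perm, Finset.map_map]
        ext a
        simp
    have hall : ∀ c d, Relation.EqvGen (G.FaceStep (n - 1)) c d → (P c ↔ P d) := by
      intro c d h
      induction h with
      | rel c d h => exact ⟨fun hc => hstep c d hc h, fun hd => hstep' c d hd h⟩
      | refl => rfl
      | symm _ _ _ ih => exact ih.symm
      | trans _ _ _ _ _ ih1 ih2 => exact ih1.trans ih2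
    obtain ⟨m, hm⟩ := (hall _ _ h1).1 ⟨0, rfl⟩
    exact ⟨m, face_eq_iff.1 hm⟩
  · rintro ⟨m, rfl | rfl⟩
    · exact hinge_turn_zpow G m s
    · rw [hinge_flip, hinge_turn_zpow]

/-- The dihedral angle at a corner. -/
noncomputable def angle (ℓ : G.Edge → ℝ) (s : Corner T n) : ℝ :=
  dihedralAngle (G.placement ℓ s.1.1) s.1.2.1 s.1.2.2

theorem angle_flip (ℓ : G.Edge → ℝ) (s : Corner T n) : angle G ℓ (flip s) = angle G ℓ s :=
  InnerProductGeometry.angle_comm _ _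

/-- The cone angle is the sum of the dihedral angles of the corners met in one turn. -/
theorem coneAngle_hinge [Fintype T] (ℓ : G.Edge → ℝ) (s : Corner T n) :
    G.coneAngle ℓ (hinge G s) =
      ∑ m ∈ Finset.range (Function.minimalPeriod (turn G) s), angle G ℓ ((turn G)^[m] s) := by
  classical
  set k := Function.minimalPeriod (turn G) s with hk
  let A : Finset (Corner T n) := (Finset.range k).image fun m => (turn G)^[m] s
  have hA : ∀ s', s' ∈ A ↔ ∃ m : ℤ, s' = (turn G ^ m) s := by
    intro s'
    rw [Finset.mem_image]
    constructor
    · rintro ⟨m, -, rfl⟩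
      exact ⟨m, by rw [zpow_natCast, ← Equiv.Perm.iterate_eq_pow]⟩
    · rintro ⟨m, rfl⟩
      have hper : s ∈ Function.periodicPts (turn G) := (turn G).injective.mem_periodicPts s
      have h1 : (turn G).SameCycle s ((turn G ^ m) s) := ⟨m, rfl⟩
      obtain ⟨l, -, hl⟩ := h1.exists_pow_eq'
      refine ⟨l % k, Finset.mem_range.2 (Nat.mod_lt _ (Function.minimalPeriod_pos_of_mem_periodicPts hper)), ?_⟩
      rw [Function.iterate_mod_minimalPeriod_eq, Equiv.Perm.iterate_eq_pow, hl]
  have hsum : ∑ s' : Corner T n, (if hinge G s' = hinge G s then angle G ℓ s' else 0) =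
      2 * ∑ m ∈ Finset.range k, angle G ℓ ((turn G)^[m] s) := by
    rw [← Finset.sum_filter]
    -- The corners at the face form two disjoint orbits exchanged by `flip`. Each face of a simplex
    -- is counted once in each orbit, which accounts for the factor 2.
    have h1 : (Finset.univ.filter fun s' => hinge G s' = hinge G s) =
        A ∪ A.map flip.toEmbedding := by
      ext s'
      rw [Finset.mem_filter, hinge_eq_iff, Finset.mem_union, hA, Finset.mem_map_equiv, hA]
      constructor
      · rintro ⟨-, m, rfl | rfl⟩
        · exact .inl ⟨m, rfl⟩
        · exact .inr ⟨m, rfl⟩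
      · rintro (⟨m, rfl⟩ | ⟨m, hm⟩)
        · exact ⟨Finset.mem_univ _, m, .inl rfl⟩
        · exact ⟨Finset.mem_univ _, m, .inr (by rw [← hm]; exact (flip.apply_symm_apply _).symm)⟩
    have h2 : Disjoint A (A.map flip.toEmbedding) := by
      rw [Finset.disjoint_left]
      intro s' h3 h4
      rw [Finset.mem_map_equiv, hA] at h4
      rw [hA] at h3
      obtain ⟨m, rfl⟩ := h3
      obtain ⟨l, hl⟩ := h4
      have h5 : flip ((turn G ^ m) s) = (turn G ^ l) s := hl
      refine turn_zpow_ne_flip G (l - m) ((turn G ^ m) s) ?_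
      rw [h5, ← Equiv.Perm.mul_apply, ← zpow_add, sub_add_cancel]
    have h3 : ∑ s' ∈ A, angle G ℓ s' = ∑ m ∈ Finset.range k, angle G ℓ ((turn G)^[m] s) := by
      refine Finset.sum_image fun a ha b hb h => ?_
      exact Function.iterate_injOn_Iio_minimalPeriod (Finset.mem_range.1 ha)
        (Finset.mem_range.1 hb) h
    rw [h1, Finset.sum_union h2, Finset.sum_map]
    simp only [Equiv.toEmbedding_apply, angle_flip]
    rw [h3, two_mul]
  have hcone : 2 * G.coneAngle ℓ (hinge G s) =
      ∑ s' : Corner T n, (if hinge G s' = hinge G s then angle G ℓ s' else 0) := by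
    let f : T → Fin (n + 1) → Fin (n + 1) → ℝ := fun t i j =>
      if h : i ≠ j then
        if G.hinge t i j h = hinge G s then dihedralAngle (G.placement ℓ t) i j else 0
      else 0
    have hf : ∀ t i j, f t i j = f t j i := by
      intro t i j
      by_cases h : i = j
      · rw [h]
      · have h1 : G.hinge t j i (Ne.symm h) = G.hinge t i j h := hinge_flip G ⟨(t, i, j), h⟩
        have h2 : dihedralAngle (G.placement ℓ t) j i = dihedralAngle (G.placement ℓ t) i j :=
          angle_flip G ℓ ⟨(t, i, j), h⟩
        simp only [f, dif_pos h, dif_pos (Ne.symm h), h1, h2]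
    have h1 : ∑ s' : Corner T n, (if hinge G s' = hinge G s then angle G ℓ s' else 0) =
        ∑ t, ∑ x : Fin (n + 1) × Fin (n + 1) with x.1 ≠ x.2, f t x.1 x.2 := by
      have h2 : ∀ s' : Corner T n, (if hinge G s' = hinge G s then angle G ℓ s' else 0) =
          f s'.1.1 s'.1.2.1 s'.1.2.2 := fun s' => by
        simp only [f, dif_pos s'.2]
        rfl
      rw [Finset.sum_congr rfl fun s' _ => h2 s', ← Finset.sum_subtype
        (Finset.univ.filter fun c : T × Fin (n + 1) × Fin (n + 1) => c.2.1 ≠ c.2.2)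
        (by simp) (fun c => f c.1 c.2.1 c.2.2), Finset.sum_filter, Fintype.sum_prod_type]
      simp only [Finset.sum_filter]
    rw [h1, coneAngle, Finset.mul_sum]
    refine Finset.sum_congr rfl fun t _ => ?_
    rw [sum_ne_eq_two_nsmul_sum_lt (f t) (hf t), nsmul_eq_mul, Nat.cast_two]
    congr 1
    refine Finset.sum_congr rfl fun q _ => ?_
    simp only [f, dif_pos q.2.ne]
  linarith

end Corner

end FacetGluing

/-! ### Tetrahedra in sectors around an axis -/

section Cylindrical

/-- The point with cylindrical coordinates `r`, `φ`, `z`. -/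
noncomputable def cylPoint (r φ z : ℝ) : EuclideanSpace ℝ (Fin 3) :=
  !₂[r * Real.cos φ, r * Real.sin φ, z]

/-- A linear form that vanishes on the half-plane at angle `φ` and is positive just before it. -/
noncomputable def halfPlaneForm (φ : ℝ) : EuclideanSpace ℝ (Fin 3) →ₗ[ℝ] ℝ :=
  Real.sin φ • (EuclideanSpace.proj (𝕜 := ℝ) (0 : Fin 3)).toLinearMap -
    Real.cos φ • (EuclideanSpace.proj (𝕜 := ℝ) (1 : Fin 3)).toLinearMap

theorem halfPlaneForm_cylPoint (r φ z ψ : ℝ) :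
    halfPlaneForm ψ (cylPoint r φ z) = r * Real.sin (ψ - φ) := by
  simp only [halfPlaneForm, cylPoint, Real.sin_sub]
  simp
  ring

theorem halfPlaneForm_axis (ψ z : ℝ) : halfPlaneForm ψ !₂[0, 0, z] = 0 := by
  simp [halfPlaneForm]

theorem cylPoint_add_two_pi_mul (r φ z : ℝ) (m : ℤ) :
    cylPoint r (φ + m * (2 * Real.pi)) z = cylPoint r φ z := by
  rw [cylPoint, cylPoint, Real.cos_add_int_mul_two_pi, Real.sin_add_int_mul_two_pi]

theorem exists_eq_cylPoint (v : EuclideanSpace ℝ (Fin 3)) (a : ℝ) :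
    ∃ r φ, 0 ≤ r ∧ a ≤ φ ∧ φ < a + 2 * Real.pi ∧ v = cylPoint r φ (v 2) := by
  set ζ : ℂ := ⟨v 0, v 1⟩ with hζ
  set m := toIcoDiv Real.two_pi_pos a ζ.arg with hm
  have h1 := sub_toIcoDiv_zsmul_mem_Ico Real.two_pi_pos a ζ.arg
  rw [← hm, zsmul_eq_mul] at h1
  have h0 : v 0 = ‖ζ‖ * Real.cos ζ.arg := (Complex.norm_mul_cos_arg ζ).symm
  have h0' : v 1 = ‖ζ‖ * Real.sin ζ.arg := (Complex.norm_mul_sin_arg ζ).symm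
  refine ⟨‖ζ‖, _, norm_nonneg _, h1.1, h1.2, ?_⟩
  have h2 := cylPoint_add_two_pi_mul ‖ζ‖ (ζ.arg - m * (2 * Real.pi)) (v 2) m
  rw [sub_add_cancel] at h2
  rw [← h2, cylPoint]
  ext i
  fin_cases i
  exacts [h0, h0', rfl]

theorem dist_cylPoint_axis_sq (r φ z c : ℝ) :
    dist (cylPoint r φ z) !₂[0, 0, c] ^ 2 = r ^ 2 + (z - c) ^ 2 := by
  rw [EuclideanSpace.dist_eq, Real.sq_sqrt (Finset.sum_nonneg fun _ _ => sq_nonneg _),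
    Fin.sum_univ_three]
  simp only [cylPoint, Real.dist_eq, sq_abs]
  simp
  linear_combination r ^ 2 * Real.cos_sq_add_sin_sq φ

/-- The distances from two different points of the axis determine height and radius. -/
theorem cylPoint_eq_of_dist {r r' φ z z' L : ℝ} (hr : 0 < r) (hr' : 0 < r') (hL : 0 < L)
    (h0 : dist (cylPoint r φ z) 0 = dist (cylPoint r' φ z') 0)
    (h1 : dist (cylPoint r φ z) !₂[0, 0, L] = dist (cylPoint r' φ z') !₂[0, 0, L]) :
    cylPoint r φ z = cylPoint r' φ z' := by
  have hz : (0 : EuclideanSpace ℝ (Fin 3)) = !₂[0, 0, 0] := by ext i; fin_cases i <;> rfl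
  have h2 := congrArg (fun x : ℝ => x ^ 2) h0
  have h3 := congrArg (fun x : ℝ => x ^ 2) h1
  simp only [hz, dist_cylPoint_axis_sq] at h2 h3
  have h4 : z = z' := by
    have : L * (z - z') = 0 := by linear_combination (h2 - h3) / 2
    rcases mul_eq_zero.1 this with h | h <;> linarith
  subst h4
  have h5 : r = r' := by
    rw [add_left_inj] at h2
    exact (pow_left_inj₀ hr.le hr'.le two_ne_zero).1 h2
  rw [h5]

/-- The vertices of the tetrahedron `q`, in the order `β`, lie in the half-planes at angles `Θ` and
`Θ'`, at the origin, and on the positive axis. -/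
structure IsAxial (q : Fin 4 → EuclideanSpace ℝ (Fin 3)) (β : Equiv.Perm (Fin 4))
    (Θ Θ' : ℝ) : Prop where
  fst : ∃ r z, 0 < r ∧ q (β 0) = cylPoint r Θ z
  snd : ∃ r z, 0 < r ∧ q (β 1) = cylPoint r Θ' z
  zero : q (β 2) = 0
  top : ∃ L, 0 < L ∧ q (β 3) = !₂[0, 0, L]

variable {p q q' : Fin 4 → EuclideanSpace ℝ (Fin 3)} {β : Equiv.Perm (Fin 4)} {Θ Θ' : ℝ}

theorem IsAxial.add_two_pi (h : IsAxial q β Θ Θ') (m : ℤ) :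
    IsAxial q β (Θ + m * (2 * Real.pi)) (Θ' + m * (2 * Real.pi)) := by
  obtain ⟨⟨r, z, hr, h0⟩, ⟨r', z', hr', h1⟩, h2, h3⟩ := h
  exact ⟨⟨r, z, hr, by rw [h0, cylPoint_add_two_pi_mul]⟩,
    ⟨r', z', hr', by rw [h1, cylPoint_add_two_pi_mul]⟩, h2, h3⟩

/-- The axis vertices are fixed by the edge length, and each of the other two is located in a known
half-plane by its distances from them. -/
theorem IsAxial.unique (h : IsAxial q β Θ Θ') (h' : IsAxial q' β Θ Θ')
    (hd : ∀ i j, dist (q i) (q j) = dist (q' i) (q' j)) : q = q' := by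
  obtain ⟨⟨r, z, hr, h0⟩, ⟨r1, z1, hr1, h1⟩, h2, L, hL, h3⟩ := h
  obtain ⟨⟨r', z', hr', h0'⟩, ⟨r1', z1', hr1', h1'⟩, h2', L', hL', h3'⟩ := h'
  have hLL : q (β 3) = q' (β 3) := by
    have h4 := hd (β 3) (β 2)
    rw [h2, h2', h3, h3', dist_zero_right, dist_zero_right, EuclideanSpace.norm_eq,
      EuclideanSpace.norm_eq] at h4
    simp [Fin.sum_univ_three, Real.sqrt_sq_eq_abs, abs_of_pos hL, abs_of_pos hL'] at h4
    rw [h3, h3', h4]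
  have h5 : q (β 0) = q' (β 0) := by
    have h4 := hd (β 0) (β 2)
    have h4' := hd (β 0) (β 3)
    rw [← hLL, h3, h0, h0'] at h4'
    rw [h2, h2', h0, h0'] at h4
    rw [h0, h0']
    exact cylPoint_eq_of_dist hr hr' hL h4 h4'
  have h6 : q (β 1) = q' (β 1) := by
    have h4 := hd (β 1) (β 2)
    have h4' := hd (β 1) (β 3)
    rw [← hLL, h3, h1, h1'] at h4'
    rw [h2, h2', h1, h1'] at h4
    rw [h1, h1']
    exact cylPoint_eq_of_dist hr1 hr1' hL h4 h4'
  funext a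
  obtain ⟨a, rfl⟩ := β.surjective a
  fin_cases a
  exacts [h5, h6, h2.trans h2'.symm, hLL]

/-- Tetrahedra in adjacent sectors around an axis lie on different sides of their common face. -/
theorem IsAxial.crosses {π : Equiv.Perm (Fin 4)} {Θ'' : ℝ} (h : IsAxial p β Θ Θ')
    (h' : IsAxial q (π * β * Equiv.swap 0 1) Θ' Θ'') (h1 : Θ < Θ') (h1' : Θ' < Θ + Real.pi)
    (h2 : Θ' < Θ'') (h2' : Θ'' < Θ' + Real.pi)
    (hd : ∀ i j, i ≠ β 0 → j ≠ β 0 → dist (q (π i)) (q (π j)) = dist (p i) (p j)) :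
    Crosses p q π (β 0) := by
  obtain ⟨⟨r, z, hr, h0⟩, ⟨r1, z1, hr1, hp1⟩, hp2, L, hL, hp3⟩ := h
  obtain ⟨⟨r', z', hr', h0'⟩, ⟨r1', z1', hr1', hq1⟩, hq2, L', hL', hq3⟩ := h'
  have e0 : (π * β * Equiv.swap 0 1 : Equiv.Perm (Fin 4)) 0 = π (β 1) := rfl
  -- The swap makes the half-plane that ends one sector begin the next; the apex of the neighbour is
  -- placed at the new final angle.
  have e1 : (π * β * Equiv.swap 0 1 : Equiv.Perm (Fin 4)) 1 = π (β 0) := rfl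
  have e2 : (π * β * Equiv.swap 0 1 : Equiv.Perm (Fin 4)) 2 = π (β 2) := rfl
  have e3 : (π * β * Equiv.swap 0 1 : Equiv.Perm (Fin 4)) 3 = π (β 3) := rfl
  rw [e0] at h0'
  rw [e1] at hq1
  rw [e2] at hq2
  rw [e3] at hq3
  have n1 : β 1 ≠ β 0 := β.injective.ne (by decide)
  have n2 : β 2 ≠ β 0 := β.injective.ne (by decide)
  have n3 : β 3 ≠ β 0 := β.injective.ne (by decide)
  have hLL : q (π (β 3)) = p (β 3) := by
    have h4 := hd (β 3) (β 2) n3 n2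
    rw [hp2, hq2, hp3, hq3, dist_zero_right, dist_zero_right, EuclideanSpace.norm_eq,
      EuclideanSpace.norm_eq] at h4
    simp [Fin.sum_univ_three, Real.sqrt_sq_eq_abs, abs_of_pos hL, abs_of_pos hL'] at h4
    rw [hp3, hq3, h4]
  have h5 : q (π (β 1)) = p (β 1) := by
    have h4 := hd (β 1) (β 2) n1 n2
    have h4' := hd (β 1) (β 3) n1 n3
    rw [hLL, hp3, h0', hp1] at h4'
    rw [hp2, hq2, h0', hp1] at h4
    rw [h0', hp1]
    exact cylPoint_eq_of_dist hr' hr1 hL h4 h4'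
  have key : ∀ a, a ≠ β 0 → q (π a) = p a ∧ halfPlaneForm Θ' (p a) = 0 := by
    intro a ha
    obtain ⟨a, rfl⟩ := β.surjective a
    fin_cases a
    · exact absurd rfl ha
    · refine ⟨h5, ?_⟩
      change halfPlaneForm Θ' (p (β 1)) = 0
      rw [hp1, halfPlaneForm_cylPoint, sub_self, Real.sin_zero, mul_zero]
    · refine ⟨hq2.trans hp2.symm, ?_⟩
      change halfPlaneForm Θ' (p (β 2)) = 0
      rw [hp2, map_zero]
    · refine ⟨hLL, ?_⟩
      change halfPlaneForm Θ' (p (β 3)) = 0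
      rw [hp3, halfPlaneForm_axis]
  refine ⟨fun a ha => (key a ha).1, (halfPlaneForm Θ').toAffineMap, fun a ha => (key a ha).2, ?_, ?_⟩
  · change 0 < halfPlaneForm Θ' (p (β 0))
    rw [h0, halfPlaneForm_cylPoint]
    exact mul_pos hr (Real.sin_pos_of_pos_of_lt_pi (by linarith) (by linarith))
  · change halfPlaneForm Θ' (q (π (β 0))) < 0
    rw [hq1, halfPlaneForm_cylPoint]
    exact mul_neg_of_pos_of_neg hr1' (Real.sin_neg_of_neg_of_neg_pi_lt (by linarith) (by linarith))

end Cylindrical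

/-! ### Dihedral angles as sector angles -/

section DihedralAngle

variable {n : ℕ} {p : Fin (n + 1) → EuclideanSpace ℝ (Fin n)} {i j : Fin (n + 1)}

theorem dihedralAngle_pos (hn : 2 ≤ n) (h : AffineIndependent ℝ p) (hij : i ≠ j) :
    0 < dihedralAngle p i j := by
  rw [dihedralAngle_eq_arccos hn h hij, Real.arccos_pos]
  exact neg_lt.1 (abs_lt.1 (abs_dualGram_div_lt_one hn h hij)).1

theorem dihedralAngle_lt_pi (hn : 2 ≤ n) (h : AffineIndependent ℝ p) (hij : i ≠ j) :
    dihedralAngle p i j < Real.pi := by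
  refine lt_of_le_of_ne (InnerProductGeometry.angle_le_pi _ _) fun h1 => ?_
  change dihedralAngle p i j = Real.pi at h1
  rw [dihedralAngle_eq_arccos hn h hij, Real.arccos_eq_pi] at h1
  have := (abs_lt.1 (abs_dualGram_div_lt_one hn h hij)).2
  linarith

theorem simplexConormal_mem (p : Fin (n + 1) → EuclideanSpace ℝ (Fin n)) (i j : Fin (n + 1)) :
    simplexConormal p i j ∈
      (vectorSpan ℝ (p '' (({i, j}ᶜ : Finset (Fin (n + 1))) : Set (Fin (n + 1)))))ᗮ :=
  Submodule.starProjection_apply_mem _ _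

theorem inner_simplexConormal_right (p : Fin (n + 1) → EuclideanSpace ℝ (Fin n))
    {k : Fin (n + 1)} (hi : k ≠ i) (hj : k ≠ j) {x : EuclideanSpace ℝ (Fin n)}
    (hx : x ∈ (vectorSpan ℝ (p '' (({i, j}ᶜ : Finset (Fin (n + 1))) : Set (Fin (n + 1)))))ᗮ) :
    inner ℝ x (p i - p k) = inner ℝ x (simplexConormal p i j) := by
  have hk : k ∈ ({i, j}ᶜ : Finset (Fin (n + 1))) := by simp [hi, hj]
  rw [simplexConormal]
  set W := vectorSpan ℝ (p '' (({i, j}ᶜ : Finset (Fin (n + 1))) : Set (Fin (n + 1)))) with hW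
  have hc : p k - Finset.centroid ℝ ({i, j}ᶜ : Finset (Fin (n + 1))) p ∈ W := by
    refine vsub_mem_vectorSpan_of_mem_affineSpan_of_mem_affineSpan
      (subset_affineSpan ℝ _ ⟨k, hk, rfl⟩) ?_
    have := affineCombination_mem_affineSpan_image (k := ℝ) (p := p)
      (w := Finset.centroidWeights ℝ ({i, j}ᶜ : Finset (Fin (n + 1)))) (s := {i, j}ᶜ)
      (s' := (({i, j}ᶜ : Finset (Fin (n + 1))) : Set (Fin (n + 1))))
      (Finset.sum_centroidWeights_eq_one_of_nonempty ℝ _ ⟨k, hk⟩) (fun a ha ha' => absurd ha ha')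
    exact this
  rw [← Submodule.inner_starProjection_left_eq_right, Submodule.starProjection_eq_self_iff.2 hx,
    ← sub_add_sub_cancel (p i) (p k) (Finset.centroid ℝ _ p), inner_add_right,
    Submodule.inner_left_of_mem_orthogonal hc hx,
    add_zero]

end DihedralAngle

section Axial

/-- Complete `e` to an orthonormal pair by the normalized component of `f` orthogonal to it, and
rotate the pair backwards by `Θ`: in the new frame `e` and `f` appear at the angles `Θ` and `Θ + θ`.
-/
theorem exists_orthonormalBasis_of_angle {e f g : EuclideanSpace ℝ (Fin 3)} (he : ‖e‖ = 1)
    (hf : ‖f‖ = 1) (hg : ‖g‖ = 1) (heg : inner ℝ e g = 0) (hfg : inner ℝ f g = 0) {θ : ℝ}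
    (hef : inner ℝ e f = Real.cos θ) (hθ : Real.sin θ ≠ 0) (Θ : ℝ) :
    ∃ b : OrthonormalBasis (Fin 3) ℝ (EuclideanSpace ℝ (Fin 3)), b 2 = g ∧
      b 0 ∈ Submodule.span ℝ {e, f} ∧ b 1 ∈ Submodule.span ℝ {e, f} ∧
      inner ℝ (b 0) e = Real.cos Θ ∧ inner ℝ (b 1) e = Real.sin Θ ∧
      inner ℝ (b 0) f = Real.cos (Θ + θ) ∧ inner ℝ (b 1) f = Real.sin (Θ + θ) := by
  have hee : inner ℝ e e = (1 : ℝ) := by rw [real_inner_self_eq_norm_sq, he, one_pow]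
  have hff : inner ℝ f f = (1 : ℝ) := by rw [real_inner_self_eq_norm_sq, hf, one_pow]
  have hgg : inner ℝ g g = (1 : ℝ) := by rw [real_inner_self_eq_norm_sq, hg, one_pow]
  have hfe : inner ℝ f e = Real.cos θ := by rw [real_inner_comm, hef]
  set d := (Real.sin θ)⁻¹ • (f - Real.cos θ • e) with hd
  have hsc := Real.sin_sq_add_cos_sq θ
  have hed : inner ℝ e d = 0 := by
    rw [hd, inner_smul_right, inner_sub_right, inner_smul_right, hee, hef]; ring
  have hde : inner ℝ d e = 0 := by rw [real_inner_comm, hed]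
  have hdf : inner ℝ d f = Real.sin θ := by
    rw [hd, inner_smul_left, inner_sub_left, inner_smul_left, hff, hef]
    simp only [conj_trivial]
    field_simp
    linear_combination -hsc
  have hdd : inner ℝ d d = 1 := by
    nth_rw 2 [hd]
    rw [inner_smul_right, inner_sub_right, inner_smul_right, hdf, hde, mul_zero, sub_zero,
      inv_mul_cancel₀ hθ]
  have hdg : inner ℝ d g = 0 := by
    rw [hd, inner_smul_left, inner_sub_left, inner_smul_left, heg, hfg]; simp
  have hgd : inner ℝ g d = 0 := by rw [real_inner_comm, hdg]
  have hge : inner ℝ g e = 0 := by rw [real_inner_comm, heg]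
  set v : Fin 3 → EuclideanSpace ℝ (Fin 3) :=
    ![Real.cos Θ • e - Real.sin Θ • d, Real.sin Θ • e + Real.cos Θ • d, g] with hv
  have hSC := Real.sin_sq_add_cos_sq Θ
  have hon : Orthonormal ℝ v := by
    rw [orthonormal_iff_ite]
    intro a b
    fin_cases a <;> fin_cases b <;>
      simp [hv, inner_add_left, inner_add_right, inner_sub_left, inner_sub_right,
        inner_smul_left, inner_smul_right, hee, hdd, hgg, hed, hde, heg, hge, hdg, hgd, -inner_self_eq_norm_sq_to_K] <;>
      first | linear_combination hSC | ring
  have hon' : Orthonormal ℝ (Set.univ.domRestrict v) := hon.comp _ Subtype.val_injective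
  obtain ⟨b, hb⟩ := hon'.exists_orthonormalBasis_extension_of_card_eq (by simp)
  have h0 : b 0 = Real.cos Θ • e - Real.sin Θ • d := hb 0 trivial
  have h1 : b 1 = Real.sin Θ • e + Real.cos Θ • d := hb 1 trivial
  have hme : e ∈ Submodule.span ℝ {e, f} := Submodule.subset_span (by simp)
  have hmf : f ∈ Submodule.span ℝ {e, f} := Submodule.subset_span (by simp)
  have hmd : d ∈ Submodule.span ℝ {e, f} :=
    Submodule.smul_mem _ _ (Submodule.sub_mem _ hmf (Submodule.smul_mem _ _ hme))
  refine ⟨b, hb 2 trivial, ?_, ?_, ?_, ?_, ?_, ?_⟩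
  · rw [h0]; exact Submodule.sub_mem _ (Submodule.smul_mem _ _ hme) (Submodule.smul_mem _ _ hmd)
  · rw [h1]; exact Submodule.add_mem _ (Submodule.smul_mem _ _ hme) (Submodule.smul_mem _ _ hmd)
  · rw [h0, inner_sub_left, inner_smul_left, inner_smul_left, hee, hde]; simp
  · rw [h1, inner_add_left, inner_smul_left, inner_smul_left, hee, hde]; simp
  · rw [h0, inner_sub_left, inner_smul_left, inner_smul_left, hef, hdf, Real.cos_add]; simp
  · rw [h1, inner_add_left, inner_smul_left, inner_smul_left, hef, hdf, Real.sin_add]; simp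

/-- Apply the preceding basis to the two unit conormals and the direction of the edge. Motions may
reverse orientation, so either order of the two facets can be realized. -/
theorem exists_isAxial {p : Fin 4 → EuclideanSpace ℝ (Fin 3)} (h : AffineIndependent ℝ p)
    (β : Equiv.Perm (Fin 4)) (Θ : ℝ) :
    ∃ g : EuclideanSpace ℝ (Fin 3) ≃ᵃⁱ[ℝ] EuclideanSpace ℝ (Fin 3),
      IsAxial (g ∘ p) β Θ (Θ + dihedralAngle p (β 0) (β 1)) := by
  have n01 : β 0 ≠ β 1 := β.injective.ne (by decide)
  have n20 : β 2 ≠ β 0 := β.injective.ne (by decide)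
  have n21 : β 2 ≠ β 1 := β.injective.ne (by decide)
  have n30 : β 3 ≠ β 0 := β.injective.ne (by decide)
  have n31 : β 3 ≠ β 1 := β.injective.ne (by decide)
  have n32 : β 3 ≠ β 2 := β.injective.ne (by decide)
  set W := vectorSpan ℝ (p '' (({β 0, β 1}ᶜ : Finset (Fin 4)) : Set (Fin 4))) with hW
  have hW' : vectorSpan ℝ (p '' (({β 1, β 0}ᶜ : Finset (Fin 4)) : Set (Fin 4))) = W := by
    rw [Finset.pair_comm]
  set N := simplexConormal p (β 0) (β 1) with hN
  set N' := simplexConormal p (β 1) (β 0) with hN'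
  have hNW : N ∈ Wᗮ := simplexConormal_mem p _ _
  have hN'W : N' ∈ Wᗮ := hW' ▸ simplexConormal_mem p _ _
  set θ := dihedralAngle p (β 0) (β 1) with hθ
  have hθ0 : 0 < θ := dihedralAngle_pos (by norm_num) h n01
  have hθ1 : θ < Real.pi := dihedralAngle_lt_pi (by norm_num) h n01
  have hN0 : 0 < ‖N‖ := by
    rw [hN, norm_simplexConormal (by norm_num) h n01]
    exact div_pos (Real.sqrt_pos.2 (dualGram_self_pos (by norm_num) h _))
      (Real.sqrt_pos.2 (dualGram_discr_pos (by norm_num) h n01))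
  have hN'0 : 0 < ‖N'‖ := by
    rw [hN', norm_simplexConormal (by norm_num) h n01.symm]
    exact div_pos (Real.sqrt_pos.2 (dualGram_self_pos (by norm_num) h _))
      (Real.sqrt_pos.2 (dualGram_discr_pos (by norm_num) h n01.symm))
  set w := p (β 3) - p (β 2) with hw
  have hw0 : 0 < ‖w‖ := norm_pos_iff.2 (sub_ne_zero.2 (h.injective.ne n32))
  have hwW : w ∈ W := vsub_mem_vectorSpan ℝ ⟨β 3, by simp [n30, n31], rfl⟩
    ⟨β 2, by simp [n20, n21], rfl⟩
  have hNw : inner ℝ N w = 0 := Submodule.inner_left_of_mem_orthogonal hwW hNW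
  have hN'w : inner ℝ N' w = 0 := Submodule.inner_left_of_mem_orthogonal hwW hN'W
  have hunit : ∀ x : EuclideanSpace ℝ (Fin 3), 0 < ‖x‖ → ‖‖x‖⁻¹ • x‖ = 1 := fun x hx => by
    rw [norm_smul, norm_inv, norm_norm, inv_mul_cancel₀ hx.ne']
  have hNN' : inner ℝ N N' = ‖N‖ * ‖N'‖ * Real.cos θ := by
    rw [mul_comm, ← InnerProductGeometry.cos_angle_mul_norm_mul_norm]; rfl
  obtain ⟨b, hb2, hb0, hb1, h0, h1, h2, h3⟩ := exists_orthonormalBasis_of_angle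
    (hunit N hN0) (hunit N' hN'0) (hunit w hw0) (by simp [inner_smul_left, inner_smul_right, hNw])
    (by simp [inner_smul_left, inner_smul_right, hN'w]) (θ := θ)
    (by simp only [inner_smul_left, inner_smul_right, hNN', conj_trivial]; field_simp)
    (Real.sin_pos_of_pos_of_lt_pi hθ0 hθ1).ne' Θ
  have hspan : Submodule.span ℝ {‖N‖⁻¹ • N, ‖N'‖⁻¹ • N'} ≤ Wᗮ := by
    rw [Submodule.span_le]
    rintro x (rfl | rfl)
    exacts [Submodule.smul_mem _ _ hNW, Submodule.smul_mem _ _ hN'W]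
  replace hb0 := hspan hb0
  replace hb1 := hspan hb1
  have hscale : ∀ {x y : EuclideanSpace ℝ (Fin 3)} {c : ℝ}, 0 < ‖y‖ →
      inner ℝ x (‖y‖⁻¹ • y) = c → inner ℝ x y = ‖y‖ * c := by
    intro x y c hy hc
    rw [← hc, inner_smul_right]
    field_simp
  refine ⟨(AffineIsometryEquiv.vaddConst ℝ (p (β 2))).symm.trans
    b.repr.toAffineIsometryEquiv, ⟨‖N‖, inner ℝ (b 2) (p (β 0) - p (β 2)), hN0, ?_⟩,
    ⟨‖N'‖, inner ℝ (b 2) (p (β 1) - p (β 2)), hN'0, ?_⟩, ?_, ‖w‖, hw0, ?_⟩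
  · change b.repr (p (β 0) - p (β 2)) = _
    ext a
    rw [b.repr_apply_apply]
    fin_cases a
    · exact (inner_simplexConormal_right p n20 n21 hb0).trans (hscale hN0 h0)
    · exact (inner_simplexConormal_right p n20 n21 hb1).trans (hscale hN0 h1)
    · rfl
  · change b.repr (p (β 1) - p (β 2)) = _
    ext a
    rw [b.repr_apply_apply]
    fin_cases a
    · exact (inner_simplexConormal_right p n21 n20 (by rw [hW']; exact hb0)).trans (hscale hN'0 h2)
    · exact (inner_simplexConormal_right p n21 n20 (by rw [hW']; exact hb1)).trans (hscale hN'0 h3)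
    · rfl
  · change b.repr (p (β 2) - p (β 2)) = _
    rw [sub_self, map_zero]
  · change b.repr w = _
    ext a
    rw [b.repr_apply_apply]
    fin_cases a
    · exact Submodule.inner_left_of_mem_orthogonal hwW hb0
    · exact Submodule.inner_left_of_mem_orthogonal hwW hb1
    · change inner ℝ (b 2) w = ‖w‖
      rw [hb2, inner_smul_left, real_inner_self_eq_norm_sq]
      simp only [conj_trivial]
      field_simp

end Axial

section Sectors

variable {p : Fin 4 → EuclideanSpace ℝ (Fin 3)} {β : Equiv.Perm (Fin 4)} {Θ Θ' : ℝ}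
  {g : EuclideanSpace ℝ (Fin 3) ≃ᵃⁱ[ℝ] EuclideanSpace ℝ (Fin 3)}

theorem affineMap_eq_coord_mul {n : ℕ} {p : Fin (n + 1) → EuclideanSpace ℝ (Fin n)}
    (hp : AffineIndependent ℝ p) {i : Fin (n + 1)} (a : EuclideanSpace ℝ (Fin n) →ᵃ[ℝ] ℝ)
    (ha : ∀ j, j ≠ i → a (p j) = 0) (v : EuclideanSpace ℝ (Fin n)) :
    a v = (simplexBasis hp).coord i v * a (p i) := by
  have h1 := (affineMap_sum_smul a ((simplexBasis hp).sum_coord_apply_eq_one v) p).trans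
    (Finset.sum_eq_single i (fun j _ hj => by rw [ha j hj, smul_zero]) (by simp))
  rw [← smul_eq_mul, ← h1]
  exact congrArg a ((simplexBasis hp).linear_combination_coord_eq_self v).symm

/-- The plane of the form contains the facet opposite to `β 0`, so the form is a multiple of that
barycentric coordinate. This translates angular inequalities into membership in the simplex. -/
theorem IsAxial.exists_halfPlaneForm_snd (hp : AffineIndependent ℝ p)
    (h : IsAxial (g ∘ p) β Θ Θ') (h1 : Θ < Θ') (h2 : Θ' < Θ + Real.pi) :
    ∃ c, 0 < c ∧ ∀ v, halfPlaneForm Θ' (g v) = (simplexBasis hp).coord (β 0) v * c := by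
  obtain ⟨⟨r, z, hr, h0⟩, ⟨r', z', hr', hp1⟩, hp2, L, hL, hp3⟩ := h
  refine ⟨halfPlaneForm Θ' (g (p (β 0))), ?_, fun v => affineMap_eq_coord_mul hp
    ((halfPlaneForm Θ').toAffineMap.comp g.toAffineEquiv.toAffineMap) (fun a ha => ?_) v⟩
  · change g (p (β 0)) = _ at h0
    rw [h0, halfPlaneForm_cylPoint]
    exact mul_pos hr (Real.sin_pos_of_pos_of_lt_pi (by linarith) (by linarith))
  · change halfPlaneForm Θ' ((g ∘ p) a) = 0
    obtain ⟨a, rfl⟩ := β.surjective a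
    fin_cases a
    · exact absurd rfl ha
    · change halfPlaneForm Θ' ((g ∘ p) (β 1)) = 0
      rw [hp1, halfPlaneForm_cylPoint, sub_self, Real.sin_zero, mul_zero]
    · change halfPlaneForm Θ' ((g ∘ p) (β 2)) = 0
      rw [hp2, map_zero]
    · change halfPlaneForm Θ' ((g ∘ p) (β 3)) = 0
      rw [hp3, halfPlaneForm_axis]

theorem IsAxial.exists_halfPlaneForm_fst (hp : AffineIndependent ℝ p)
    (h : IsAxial (g ∘ p) β Θ Θ') (h1 : Θ < Θ') (h2 : Θ' < Θ + Real.pi) :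
    ∃ c, c < 0 ∧ ∀ v, halfPlaneForm Θ (g v) = (simplexBasis hp).coord (β 1) v * c := by
  obtain ⟨⟨r, z, hr, h0⟩, ⟨r', z', hr', hp1⟩, hp2, L, hL, hp3⟩ := h
  refine ⟨halfPlaneForm Θ (g (p (β 1))), ?_, fun v => affineMap_eq_coord_mul hp
    ((halfPlaneForm Θ).toAffineMap.comp g.toAffineEquiv.toAffineMap) (fun a ha => ?_) v⟩
  · change g (p (β 1)) = _ at hp1
    rw [hp1, halfPlaneForm_cylPoint]
    exact mul_neg_of_pos_of_neg hr' (Real.sin_neg_of_neg_of_neg_pi_lt (by linarith) (by linarith))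
  · change halfPlaneForm Θ ((g ∘ p) a) = 0
    obtain ⟨a, rfl⟩ := β.surjective a
    fin_cases a
    · change halfPlaneForm Θ ((g ∘ p) (β 0)) = 0
      rw [h0, halfPlaneForm_cylPoint, sub_self, Real.sin_zero, mul_zero]
    · exact absurd rfl ha
    · change halfPlaneForm Θ ((g ∘ p) (β 2)) = 0
      rw [hp2, map_zero]
    · change halfPlaneForm Θ ((g ∘ p) (β 3)) = 0
      rw [hp3, halfPlaneForm_axis]

end Sectors

/-! ### Circuits of tetrahedra around an edge -/

namespace FacetGluing

variable {T : Type*}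

/-- A tetrahedron with an ordering of its vertices. -/
abbrev Frame (T : Type*) : Type _ := T × Equiv.Perm (Fin 4)

namespace Frame

/-- The frame with the first two vertices interchanged. -/
def flip : Equiv.Perm (Frame T) :=
  Function.Involutive.toPerm (fun F => (F.1, F.2 * Equiv.swap 0 1)) fun F =>
    Prod.ext rfl (by simp [mul_assoc])

/-- The frame on the other side of the facet opposite to the first vertex. -/
def cross (G : FacetGluing T 3) : Equiv.Perm (Frame T) :=
  Function.Involutive.toPerm (fun F => (G.nbr F.1 (F.2 0), G.perm F.1 (F.2 0) * F.2)) fun F => by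
    refine Prod.ext (G.nbr_nbr _ _) ?_
    change G.perm (G.nbr F.1 (F.2 0)) (G.perm F.1 (F.2 0) (F.2 0)) * _ = _
    rw [G.perm_perm, inv_mul_cancel_left]

/-- The next frame around the edge that joins the last two vertices. -/
def turn (G : FacetGluing T 3) : Equiv.Perm (Frame T) := flip * cross G

variable (G : FacetGluing T 3) (ℓ : G.Edge → ℝ) (F : Frame T)

theorem turn_apply : turn G F = (G.nbr F.1 (F.2 0), G.perm F.1 (F.2 0) * F.2 * Equiv.swap 0 1) :=
  rfl

/-- The corner at the edge that joins the last two vertices. -/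
def corner (F : Frame T) : Corner T 3 :=
  ⟨(F.1, F.2 0, F.2 1), F.2.injective.ne (by decide)⟩

theorem corner_iterate (m : ℕ) :
    corner ((turn G)^[m] F) = (Corner.turn G)^[m] (corner F) :=
  (Function.Semiconj.iterate_right (f := corner) (ga := turn G) (gb := Corner.turn G)
    (fun _ => rfl) m) F

/-- A corner forgets only the order of the two ends of the edge; a circuit may close for corners and
yet reverse the edge. -/
theorem eq_of_corner_eq {F F' : Frame T} (h : corner F = corner F') (h2 : F.2 2 = F'.2 2) :
    F = F' := by
  have h0 : F.2 0 = F'.2 0 := congrArg (fun s : Corner T 3 => s.1.2.1) h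
  have h1 : F.2 1 = F'.2 1 := congrArg (fun s : Corner T 3 => s.1.2.2) h
  refine Prod.ext (congrArg (fun s : Corner T 3 => s.1.1) h) (Equiv.ext fun a => ?_)
  fin_cases a
  · exact h0
  · exact h1
  · exact h2
  · obtain ⟨b, hb⟩ := F'.2.surjective (F.2 3)
    fin_cases b
    · exact absurd (F.2.injective (h0.trans hb)) (by decide)
    · exact absurd (F.2.injective (h1.trans hb)) (by decide)
    · exact absurd (F.2.injective (h2.trans hb)) (by decide)
    · exact hb.symm

/-- The number of corners around the edge of a frame. -/
noncomputable def order : ℕ := Function.minimalPeriod (Corner.turn G) (corner F)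

/-- The sum of the first `m` dihedral angles around the edge of a frame. -/
noncomputable def angleSum (m : ℕ) : ℝ :=
  ∑ l ∈ Finset.range m, Corner.angle G ℓ (corner ((turn G)^[l] F))

theorem angleSum_zero : angleSum G ℓ F 0 = 0 := rfl

theorem angleSum_succ (m : ℕ) : angleSum G ℓ F (m + 1) =
    angleSum G ℓ F m + Corner.angle G ℓ (corner ((turn G)^[m] F)) :=
  Finset.sum_range_succ _ _

theorem order_pos [Finite T] : 0 < order G F :=
  Function.minimalPeriod_pos_of_mem_periodicPts ((Corner.turn G).injective.mem_periodicPts _)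

theorem corner_iterate_add_order (m : ℕ) :
    corner ((turn G)^[m + order G F] F) = corner ((turn G)^[m] F) := by
  rw [corner_iterate, corner_iterate, order, Function.iterate_add_minimalPeriod_eq]

theorem mod_order_eq [Finite T] {m m' : ℕ}
    (h : corner ((turn G)^[m] F) = corner ((turn G)^[m'] F)) :
    m % order G F = m' % order G F := by
  rw [corner_iterate, corner_iterate, ← Function.iterate_mod_minimalPeriod_eq,
    ← Function.iterate_mod_minimalPeriod_eq (n := m')] at h
  exact Function.iterate_injOn_Iio_minimalPeriod (Nat.mod_lt _ (order_pos G F))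
    (Nat.mod_lt _ (order_pos G F)) h

section Cone

variable [Fintype T] {G ℓ F} (hc : G.coneAngle ℓ (Corner.hinge G (corner F)) = 2 * Real.pi)
include hc

/-- One circuit of corners adds up to the cone angle, here 2π. -/
theorem angleSum_add_order (m : ℕ) :
    angleSum G ℓ F (m + order G F) = angleSum G ℓ F m + 2 * Real.pi := by
  induction m with
  | zero =>
    rw [zero_add, angleSum_zero, zero_add, ← hc, Corner.coneAngle_hinge, angleSum]
    simp only [corner_iterate]
    rfl
  | succ m ih =>
    rw [add_right_comm, angleSum_succ, ih, angleSum_succ, corner_iterate_add_order]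
    ring

theorem angleSum_add_order_mul (m q : ℕ) :
    angleSum G ℓ F (m + order G F * q) = angleSum G ℓ F m + q * (2 * Real.pi) := by
  induction q with
  | zero => simp
  | succ q ih =>
    rw [mul_add, mul_one, ← add_assoc, angleSum_add_order hc, ih]
    push_cast
    ring

theorem exists_angleSum_eq {m m' : ℕ} (h : m % order G F = m' % order G F) :
    ∃ j : ℤ, angleSum G ℓ F m' = angleSum G ℓ F m + j * (2 * Real.pi) := by
  have h1 := angleSum_add_order_mul hc (m % order G F) (m / order G F)
  have h2 := angleSum_add_order_mul hc (m' % order G F) (m' / order G F)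
  rw [Nat.mod_add_div] at h1 h2
  refine ⟨((m' / order G F : ℕ) : ℤ) - ((m / order G F : ℕ) : ℤ), ?_⟩
  rw [h1, h2, h, Int.cast_sub, Int.cast_natCast, Int.cast_natCast]
  ring

end Cone

/-- The motion that puts the `m`-th simplex around the edge of a frame into its sector around the
third axis. -/
noncomputable def motion (m : ℕ) : EuclideanSpace ℝ (Fin 3) ≃ᵃⁱ[ℝ] EuclideanSpace ℝ (Fin 3) :=
  Classical.epsilon fun g => IsAxial (g ∘ G.placement ℓ ((turn G)^[m] F).1) ((turn G)^[m] F).2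
    (angleSum G ℓ F m) (angleSum G ℓ F (m + 1))

section Motion

variable {G ℓ} (hℓ : G.IsPolyhedralMetric ℓ)
include hℓ

theorem angleSum_lt_succ (m : ℕ) : angleSum G ℓ F m < angleSum G ℓ F (m + 1) := by
  rw [angleSum_succ]
  exact lt_add_of_pos_right _ (dihedralAngle_pos (by norm_num) (hℓ.affineIndependent _)
    (corner ((turn G)^[m] F)).2)

theorem angleSum_succ_lt (m : ℕ) : angleSum G ℓ F (m + 1) < angleSum G ℓ F m + Real.pi := by
  rw [angleSum_succ]
  exact (add_lt_add_iff_left _).2 (dihedralAngle_lt_pi (by norm_num) (hℓ.affineIndependent _)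
    (corner ((turn G)^[m] F)).2)

theorem strictMono_angleSum : StrictMono (angleSum G ℓ F) :=
  strictMono_nat_of_lt_succ (angleSum_lt_succ F hℓ)

theorem isAxial_motion (m : ℕ) :
    IsAxial (motion G ℓ F m ∘ G.placement ℓ ((turn G)^[m] F).1) ((turn G)^[m] F).2
      (angleSum G ℓ F m) (angleSum G ℓ F (m + 1)) := by
  refine Classical.epsilon_spec (p := fun g : EuclideanSpace ℝ (Fin 3) ≃ᵃⁱ[ℝ] _ =>
    IsAxial (g ∘ G.placement ℓ ((turn G)^[m] F).1) ((turn G)^[m] F).2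
    (angleSum G ℓ F m) (angleSum G ℓ F (m + 1))) ?_
  rw [angleSum_succ]
  exact exists_isAxial (hℓ.affineIndependent _) _ _

/-- The motions are chosen independently, but adjacent sectors cross their common facet correctly,
and correct placement is unique. -/
theorem motion_succ (m : ℕ) : motion G ℓ F (m + 1) = motion G ℓ F m *
    G.transition ℓ ((turn G)^[m] F).1 (((turn G)^[m] F).2 0) := by
  refine hℓ.eq_mul_transition (by norm_num) ?_
  have h1 := isAxial_motion F hℓ (m + 1)
  rw [Function.iterate_succ_apply'] at h1
  refine (isAxial_motion F hℓ m).crosses h1 (angleSum_lt_succ F hℓ _) (angleSum_succ_lt F hℓ _)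
    (angleSum_lt_succ F hℓ _) (angleSum_succ_lt F hℓ _) fun i j hi hj => ?_
  simp only [Function.comp_apply, AffineIsometryEquiv.dist_map]
  rw [(hℓ.isPlacement _).dist_eq, (hℓ.isPlacement _).dist_eq, len_nbr _ hi hj]

/-- Angles that differ by full turns describe the same half-planes, so both motions realize the same
axial position. Equality of frames is required, not only of corners: the ends of the edge must not
be exchanged. -/
theorem motion_eq {m m' : ℕ} (h : (turn G)^[m] F = (turn G)^[m'] F) {j : ℤ}
    (hj : angleSum G ℓ F m' = angleSum G ℓ F m + j * (2 * Real.pi)) :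
    motion G ℓ F m = motion G ℓ F m' := by
  refine AffineIsometryEquiv.eq_of_comp_eq (hℓ.affineIndependent ((turn G)^[m] F).1) ?_
  have h1 := (isAxial_motion F hℓ m).add_two_pi j
  have h2 := isAxial_motion F hℓ m'
  rw [angleSum_succ, add_right_comm, ← hj, h, ← angleSum_succ, ← h] at h1
  rw [← h] at h2
  exact h1.unique h2 fun a b => by simp [AffineIsometryEquiv.dist_map]

/-- Points of the facet between two consecutive simplices have the same image. -/
theorem motion_succ_position (m : ℕ) {w : stdSimplex ℝ (Fin 4)}
    (hw : w (((turn G)^[m] F).2 0) = 0) :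
    G.point ((turn G)^[m + 1] F).1
        (stdSimplex.map (G.perm ((turn G)^[m] F).1 (((turn G)^[m] F).2 0)) w) =
      G.point ((turn G)^[m] F).1 w ∧
    motion G ℓ F (m + 1) (G.position ℓ ((turn G)^[m + 1] F).1
        (stdSimplex.map (G.perm ((turn G)^[m] F).1 (((turn G)^[m] F).2 0)) w)) =
      motion G ℓ F m (G.position ℓ ((turn G)^[m] F).1 w) := by
  rw [motion_succ F hℓ, Function.iterate_succ_apply', turn_apply]
  refine ⟨point_nbr _ hw, ?_⟩
  rw [AffineIsometryEquiv.coe_mul, Function.comp_apply, hℓ.transition_position (by norm_num) _ hw]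

theorem exists_motion_add_position (m d : ℕ) {w : stdSimplex ℝ (Fin 4)}
    (h0 : w (((turn G)^[m] F).2 0) = 0) (h1 : w (((turn G)^[m] F).2 1) = 0) :
    ∃ w' : stdSimplex ℝ (Fin 4), w' (((turn G)^[m + d] F).2 0) = 0 ∧
      w' (((turn G)^[m + d] F).2 1) = 0 ∧
      G.point ((turn G)^[m + d] F).1 w' = G.point ((turn G)^[m] F).1 w ∧
      motion G ℓ F (m + d) (G.position ℓ ((turn G)^[m + d] F).1 w') =
        motion G ℓ F m (G.position ℓ ((turn G)^[m] F).1 w) := by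
  induction d with
  | zero => exact ⟨w, h0, h1, rfl, rfl⟩
  | succ d ih =>
    obtain ⟨w', h0', h1', hp, hm⟩ := ih
    obtain ⟨hp', hm'⟩ := motion_succ_position F hℓ (m + d) h0'
    refine ⟨_, ?_, ?_, hp'.trans hp, hm'.trans hm⟩
    · rw [← add_assoc, Function.iterate_succ_apply']
      exact (stdSimplex.map_perm_apply _ _ _).trans h1'
    · rw [← add_assoc, Function.iterate_succ_apply']
      exact (stdSimplex.map_perm_apply _ _ _).trans h0'

end Motion

end Frame

end FacetGluing

/-! ### Representatives of the points of an edge -/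

namespace FacetGluing

namespace Frame

variable {T : Type*} (G : FacetGluing T 3) (ℓ : G.Edge → ℝ) (F : Frame T)
  (u : stdSimplex ℝ (Fin 4))

/-- The point of the `m`-th simplex around the edge of `F` with the barycentric coordinates that
`u` has in the simplex of `F`. -/
noncomputable def carry (m : ℕ) : stdSimplex ℝ (Fin 4) :=
  stdSimplex.map (((turn G)^[m] F).2 * F.2⁻¹ : Equiv.Perm (Fin 4)) u

theorem carry_zero : carry G F u 0 = u := by
  change stdSimplex.map (F.2 * F.2⁻¹ : Equiv.Perm (Fin 4)) u = u
  rw [mul_inv_cancel]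
  exact stdSimplex.map_id_apply u

theorem carry_apply (m : ℕ) (a : Fin 4) : carry G F u m (((turn G)^[m] F).2 a) = u (F.2 a) := by
  have h := stdSimplex.map_perm_apply (((turn G)^[m] F).2 * F.2⁻¹ : Equiv.Perm (Fin 4)) u (F.2 a)
  rwa [Equiv.Perm.mul_apply, show F.2⁻¹ (F.2 a) = a from F.2.symm_apply_apply a] at h

theorem carry_congr {m m' : ℕ} (h : (turn G)^[m] F = (turn G)^[m'] F) :
    carry G F u m = carry G F u m' := by
  rw [carry, h, carry]

variable {G F u} (hu : u (F.2 0) = 0 ∧ u (F.2 1) = 0)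
include hu

/-- Turning swaps the first two vertices, but both coordinates are zero on the edge, so the swap is
invisible. -/
theorem carry_succ (m : ℕ) : carry G F u (m + 1) =
    stdSimplex.map (G.perm ((turn G)^[m] F).1 (((turn G)^[m] F).2 0)) (carry G F u m) := by
  ext j
  obtain ⟨a, rfl⟩ := ((turn G)^[m + 1] F).2.surjective j
  rw [carry_apply, Function.iterate_succ_apply', turn_apply]
  change _ = stdSimplex.map _ _ (G.perm ((turn G)^[m] F).1 (((turn G)^[m] F).2 0)
    (((turn G)^[m] F).2 (Equiv.swap 0 1 a)))
  rw [stdSimplex.map_perm_apply, carry_apply]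
  fin_cases a
  · exact hu.1.trans hu.2.symm
  · exact hu.2.trans hu.1.symm
  · rfl
  · rfl

theorem point_carry (m : ℕ) : G.point ((turn G)^[m] F).1 (carry G F u m) = G.point F.1 u := by
  induction m with
  | zero => rw [carry_zero]; rfl
  | succ m ih =>
    rw [carry_succ hu, Function.iterate_succ_apply', turn_apply, ← ih]
    exact point_nbr _ ((carry_apply G F u m 0).trans hu.1)

variable (hu' : u (F.2 2) ≠ 0 ∧ u (F.2 3) ≠ 0)
include hu'

omit hu in
theorem eq_or_eq_of_carry_eq_zero {m : ℕ} {i : Fin 4} (hi : carry G F u m i = 0) :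
    i = ((turn G)^[m] F).2 0 ∨ i = ((turn G)^[m] F).2 1 := by
  obtain ⟨a, rfl⟩ := ((turn G)^[m] F).2.surjective i
  rw [carry_apply] at hi
  fin_cases a
  · exact .inl rfl
  · exact .inr rfl
  · exact absurd hi hu'.1
  · exact absurd hi hu'.2

omit hu hu' in
theorem exists_iterate_succ_eq [Finite T] (m : ℕ) :
    ∃ m', (turn G)^[m' + 1] F = (turn G)^[m] F := by
  have h1 : F ∈ Function.periodicPts (turn G) := (turn G).injective.mem_periodicPts F
  have h2 := Function.minimalPeriod_pos_of_mem_periodicPts h1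
  refine ⟨m + (Function.minimalPeriod (turn G) F - 1), ?_⟩
  rw [add_assoc, Nat.sub_add_cancel h2, Function.iterate_add_minimalPeriod_eq]

omit hu' in
theorem cross_snd (m : ℕ) :
    G.nbr ((turn G)^[m + 1] F).1 (((turn G)^[m + 1] F).2 1) = ((turn G)^[m] F).1 ∧
    stdSimplex.map (G.perm ((turn G)^[m + 1] F).1 (((turn G)^[m + 1] F).2 1))
      (carry G F u (m + 1)) = carry G F u m := by
  rw [carry_succ hu, Function.iterate_succ_apply', turn_apply]
  set F' := (turn G)^[m] F
  change G.nbr (G.nbr F'.1 (F'.2 0)) (G.perm F'.1 (F'.2 0) (F'.2 0)) = F'.1 ∧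
    stdSimplex.map (G.perm (G.nbr F'.1 (F'.2 0)) (G.perm F'.1 (F'.2 0) (F'.2 0))) _ = _
  rw [G.nbr_nbr, G.perm_perm]
  exact ⟨rfl, stdSimplex.map_inv_map _ _⟩

/-- An interior point of an edge lies on just two facets of each simplex around it; crossing them
moves one step forward or one step back along the circuit, and the latter is also a forward move
because the circuit is periodic. -/
theorem exists_eq_carry [Finite T] {t : T} {v : stdSimplex ℝ (Fin 4)}
    (h : G.point t v = G.point F.1 u) : ∃ m, ((turn G)^[m] F).1 = t ∧ carry G F u m = v := by
  refine point_induction (G := G) (P := fun t v => ∃ m, ((turn G)^[m] F).1 = t ∧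
    carry G F u m = v) ?_ h.symm ⟨0, rfl, carry_zero G F u⟩
  rintro _ _ i hi ⟨m, rfl, rfl⟩
  rcases eq_or_eq_of_carry_eq_zero hu' hi with rfl | rfl
  · exact ⟨m + 1, by rw [Function.iterate_succ_apply', turn_apply], carry_succ hu m⟩
  · obtain ⟨m', hm'⟩ := exists_iterate_succ_eq (G := G) (F := F) m
    obtain ⟨h1, h2⟩ := cross_snd (G := G) hu m'
    rw [← hm', ← carry_congr G F u hm']
    exact ⟨m', h1.symm, h2.symm⟩

/-- The vanishing coordinates determine the unordered pair of facets, and the circuit never meets a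
corner in the opposite sense. -/
theorem corner_eq_of_carry_eq {m m' : ℕ} (ht : ((turn G)^[m] F).1 = ((turn G)^[m'] F).1)
    (h : carry G F u m = carry G F u m') :
    corner ((turn G)^[m] F) = corner ((turn G)^[m'] F) := by
  have h0 := eq_or_eq_of_carry_eq_zero hu' (m := m) (i := ((turn G)^[m'] F).2 0)
    (by rw [h, carry_apply, hu.1])
  have h1 := eq_or_eq_of_carry_eq_zero hu' (m := m) (i := ((turn G)^[m'] F).2 1)
    (by rw [h, carry_apply, hu.2])
  have hne : ((turn G)^[m'] F).2 0 ≠ ((turn G)^[m'] F).2 1 :=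
    ((turn G)^[m'] F).2.injective.ne (by decide)
  rcases h0 with h0 | h0 <;> rcases h1 with h1 | h1
  · exact absurd (h0.trans h1.symm) hne
  · exact Subtype.ext (Prod.ext ht (Prod.ext h0.symm h1.symm))
  · exfalso
    refine Corner.turn_zpow_ne_flip G ((m' : ℤ) - m) ((Corner.turn G)^[m] (corner F)) ?_
    rw [Equiv.Perm.iterate_eq_pow, ← zpow_natCast, ← Equiv.Perm.mul_apply, ← zpow_add,
      sub_add_cancel, zpow_natCast, zpow_natCast, ← Equiv.Perm.iterate_eq_pow,
      ← Equiv.Perm.iterate_eq_pow, ← corner_iterate, ← corner_iterate]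
    exact Subtype.ext (Prod.ext ht.symm (Prod.ext h0 h1))
  · exact absurd (h0.trans h1.symm) hne

/-- Away from the midpoint the two ends of the edge are told apart by the coordinates of the point.
-/
theorem iterate_eq_of_carry_eq {m m' : ℕ} (hne : u (F.2 2) ≠ u (F.2 3))
    (ht : ((turn G)^[m] F).1 = ((turn G)^[m'] F).1) (h : carry G F u m = carry G F u m') :
    (turn G)^[m] F = (turn G)^[m'] F := by
  refine eq_of_corner_eq (corner_eq_of_carry_eq hu hu' ht h) ?_
  obtain ⟨a, ha⟩ := ((turn G)^[m] F).2.surjective (((turn G)^[m'] F).2 2)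
  have h1 := carry_apply G F u m a
  rw [ha, h, carry_apply] at h1
  fin_cases a
  · exact absurd (h1.trans hu.1) hu'.1
  · exact absurd (h1.trans hu.2) hu'.1
  · exact ha
  · exact absurd h1 hne

theorem iterate_eq_of_carry_eq_of_iterate_order [Finite T] {m m' : ℕ}
    (hF : (turn G)^[order G F] F = F)
    (ht : ((turn G)^[m] F).1 = ((turn G)^[m'] F).1) (h : carry G F u m = carry G F u m') :
    (turn G)^[m] F = (turn G)^[m'] F := by
  have h1 := mod_order_eq G F (corner_eq_of_carry_eq hu hu' ht h)
  have hP : Function.IsPeriodicPt (turn G) (order G F) F := hF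
  rw [← hP.iterate_mod_apply, h1, hP.iterate_mod_apply]

variable [Fintype T] {ℓ} (hℓ : G.IsPolyhedralMetric ℓ)
  (hc : G.coneAngle ℓ (Corner.hinge G (corner F)) = 2 * Real.pi)
include hℓ hc

/-- The simplices around an edge with cone angle `2π` fit together. -/
theorem exists_isCompatible (hH : ∀ m m', ((turn G)^[m] F).1 = ((turn G)^[m'] F).1 →
      carry G F u m = carry G F u m' → (turn G)^[m] F = (turn G)^[m'] F) :
    ∃ g, G.IsCompatible (G.transition ℓ) (G.point F.1 u) g ∧
      ∀ m, g ((turn G)^[m] F).1 (carry G F u m) = motion G ℓ F m := by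
  classical
  set g : T → stdSimplex ℝ (Fin 4) →
      (EuclideanSpace ℝ (Fin 3) ≃ᵃⁱ[ℝ] EuclideanSpace ℝ (Fin 3)) := fun t v =>
    if h : ∃ m, ((turn G)^[m] F).1 = t ∧ carry G F u m = v then motion G ℓ F h.choose else 1
    with hg
  have hg' : ∀ m, g ((turn G)^[m] F).1 (carry G F u m) = motion G ℓ F m := by
    intro m
    have h : ∃ m', ((turn G)^[m'] F).1 = ((turn G)^[m] F).1 ∧ carry G F u m' = carry G F u m :=
      ⟨m, rfl, rfl⟩
    simp only [hg, dif_pos h]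
    obtain ⟨h1, h2⟩ := h.choose_spec
    have h3 := hH _ _ h1 h2
    -- The cone angle enters here: two visits to the same frame are separated by a multiple of 2π,
    -- so the motion does not depend on the visit.
    obtain ⟨j, hj⟩ := exists_angleSum_eq hc (mod_order_eq G F (congrArg corner h3))
    exact motion_eq F hℓ h3 hj
  refine ⟨g, fun t v i hv hi => ?_, hg'⟩
  obtain ⟨m, rfl, rfl⟩ := exists_eq_carry hu hu' hv
  rcases eq_or_eq_of_carry_eq_zero hu' hi with rfl | rfl
  · rw [hg', ← motion_succ F hℓ, ← carry_succ hu, ← hg' (m + 1), Function.iterate_succ_apply',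
      turn_apply]
  · obtain ⟨m', hm'⟩ := exists_iterate_succ_eq (G := G) (F := F) m
    obtain ⟨h1, h2⟩ := cross_snd (G := G) hu m'
    rw [← hm', ← carry_congr G F u hm', h1, h2, hg', hg', motion_succ F hℓ, mul_assoc,
      Function.iterate_succ_apply', turn_apply]
    exact (mul_eq_left.2 (hℓ.transition_mul_transition (by norm_num) _ _)).symm

omit hu' [Fintype T] hc in
/-- An edge is not glued to itself with the reversed orientation, provided
that there is a development near its midpoint. -/
theorem iterate_order_eq (h23 : u (F.2 2) = u (F.2 3))
    (hdev : ∃ W γ, G.point F.1 u ∈ W ∧ G.IsDevelopment (G.transition ℓ) W γ) :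
    (turn G)^[order G F] F = F := by
  obtain ⟨W, γ, hW, hγ⟩ := hdev
  have hcomp := hγ.isCompatible hW
  have hcor : corner ((turn G)^[order G F] F) = corner F := by
    have := corner_iterate_add_order G F 0
    rwa [zero_add] at this
  -- The development and the motions pick up the same transitions along the circuit, so they differ
  -- by one constant left factor.
  have hmul : ∀ m, γ ((turn G)^[m] F).1 (carry G F u m) =
      γ F.1 u * (motion G ℓ F 0)⁻¹ * motion G ℓ F m := by
    intro m
    induction m with
    | zero => rw [inv_mul_cancel_right, carry_zero]; rfl
    | succ m ih =>
      rw [motion_succ F hℓ, ← mul_assoc, ← ih, carry_succ hu,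
        ← hcomp _ _ _ (point_carry hu m) ((carry_apply G F u m 0).trans hu.1),
        Function.iterate_succ_apply', turn_apply]
  set k := order G F with hk
  set F' := (turn G)^[k] F with hF'
  have ht : F'.1 = F.1 := congrArg (fun s : Corner T 3 => s.1.1) hcor
  have h0 : F'.2 0 = F.2 0 := congrArg (fun s : Corner T 3 => s.1.2.1) hcor
  have h1 : F'.2 1 = F.2 1 := congrArg (fun s : Corner T 3 => s.1.2.2) hcor
  refine eq_of_corner_eq hcor ?_
  obtain ⟨a, ha⟩ := F.2.surjective (F'.2 2)
  fin_cases a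
  · exact absurd (F'.2.injective (h0.trans ha)) (by decide)
  · exact absurd (F'.2.injective (h1.trans ha)) (by decide)
  · exact ha.symm
  exfalso
  change F.2 3 = F'.2 2 at ha
  have h3 : F'.2 3 = F.2 2 := by
    obtain ⟨b, hb⟩ := F.2.surjective (F'.2 3)
    fin_cases b
    · exact absurd (F'.2.injective (h0.trans hb)) (by decide)
    · exact absurd (F'.2.injective (h1.trans hb)) (by decide)
    · exact hb.symm
    · exact absurd (F'.2.injective (ha.symm.trans hb)) (by decide)
  have hcarry : carry G F u k = u := by
    ext j
    obtain ⟨a, rfl⟩ := F'.2.surjective j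
    rw [carry_apply]
    fin_cases a
    · exact congrArg u h0.symm
    · exact congrArg u h1.symm
    · exact h23.trans (congrArg u ha)
    · exact h23.symm.trans (congrArg u h3.symm)
  -- The reversed circuit returns to the same representative, because `u` is the midpoint. So
  -- motions 0 and `k` agree, although one sends the vertex `F.2 2` and the other the vertex `F.2 3`
  -- to the origin.
  have hk1 := hmul k
  rw [← hF', ht, hcarry, mul_assoc, left_eq_mul, inv_mul_eq_one] at hk1
  have hz0 := (isAxial_motion F hℓ 0).zero
  have hzk := (isAxial_motion F hℓ k).zero
  rw [← hF', ← ha, ht, ← hk1] at hzk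
  have h5 : G.placement ℓ F.1 (F.2 2) = G.placement ℓ F.1 (F.2 3) :=
    (motion G ℓ F 0).injective (hz0.trans hzk.symm)
  exact absurd (F.2.injective ((hℓ.affineIndependent F.1).injective h5)) (by decide)

end Frame

end FacetGluing

/-! ### Flatness along an edge with cone angle 2π -/

namespace FacetGluing

namespace Frame

variable {T : Type*} {G : FacetGluing T 3} {ℓ : G.Edge → ℝ} {F : Frame T}
  (hℓ : G.IsPolyhedralMetric ℓ)
include hℓ

/-- A point of the `m`-th simplex around an edge is mapped into the `m`-th sector, and to the end
of the sector only if it belongs to the first facet. -/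
theorem le_angleSum_succ {m : ℕ} {w : stdSimplex ℝ (Fin 4)} {r φ z : ℝ} (hr : 0 < r)
    (h2 : φ < angleSum G ℓ F m + 2 * Real.pi)
    (hw : motion G ℓ F m (G.position ℓ ((turn G)^[m] F).1 w) = cylPoint r φ z) :
    φ ≤ angleSum G ℓ F (m + 1) ∧
      (φ = angleSum G ℓ F (m + 1) → w (((turn G)^[m] F).2 0) = 0) := by
  have hax := isAxial_motion F hℓ m
  have hlt := angleSum_lt_succ F hℓ m
  have hlt' := angleSum_succ_lt F hℓ m
  obtain ⟨c, hc, hsnd⟩ := hax.exists_halfPlaneForm_snd (hℓ.affineIndependent _) hlt hlt'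
  obtain ⟨c', hc', hfst⟩ := hax.exists_halfPlaneForm_fst (hℓ.affineIndependent _) hlt hlt'
  replace hsnd := hsnd (G.position ℓ ((turn G)^[m] F).1 w)
  replace hfst := hfst (G.position ℓ ((turn G)^[m] F).1 w)
  rw [hℓ.coord_position, hw, halfPlaneForm_cylPoint] at hsnd hfst
  have h3 : 0 ≤ Real.sin (angleSum G ℓ F (m + 1) - φ) := by
    refine nonneg_of_mul_nonneg_right ?_ hr
    rw [hsnd]
    exact mul_nonneg (w.2.1 _) hc.le
  have h4 : Real.sin (angleSum G ℓ F m - φ) ≤ 0 := by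
    refine nonpos_of_mul_nonpos_right ?_ hr
    rw [hfst]
    exact mul_nonpos_of_nonneg_of_nonpos (w.2.1 _) hc'.le
  have h5 : φ ≤ angleSum G ℓ F m + Real.pi := by
    by_contra! h
    have := Real.sin_pos_of_pos_of_lt_pi (x := angleSum G ℓ F m - φ + 2 * Real.pi)
      (by linarith) (by linarith)
    rw [Real.sin_add_two_pi] at this
    linarith
  refine ⟨?_, fun h => ?_⟩
  · by_contra! h
    have := Real.sin_neg_of_neg_of_neg_pi_lt (x := angleSum G ℓ F (m + 1) - φ)
      (by linarith) (by linarith)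
    linarith
  · rw [h, sub_self, Real.sin_zero, mul_zero] at hsnd
    exact (mul_eq_zero.1 hsnd.symm).resolve_right hc.ne'

/-- The points of the axis come from the points of the edge. -/
theorem eq_zero_of_motion_eq_axis {m : ℕ} {w : stdSimplex ℝ (Fin 4)} {φ z : ℝ}
    (hw : motion G ℓ F m (G.position ℓ ((turn G)^[m] F).1 w) = cylPoint 0 φ z) :
    w (((turn G)^[m] F).2 0) = 0 ∧ w (((turn G)^[m] F).2 1) = 0 := by
  have hax := isAxial_motion F hℓ m
  have hlt := angleSum_lt_succ F hℓ m
  have hlt' := angleSum_succ_lt F hℓ m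
  obtain ⟨c, hc, hsnd⟩ := hax.exists_halfPlaneForm_snd (hℓ.affineIndependent _) hlt hlt'
  obtain ⟨c', hc', hfst⟩ := hax.exists_halfPlaneForm_fst (hℓ.affineIndependent _) hlt hlt'
  replace hsnd := hsnd (G.position ℓ ((turn G)^[m] F).1 w)
  replace hfst := hfst (G.position ℓ ((turn G)^[m] F).1 w)
  rw [hℓ.coord_position, hw, halfPlaneForm_cylPoint, zero_mul] at hsnd hfst
  exact ⟨(mul_eq_zero.1 hsnd.symm).resolve_right hc.ne',
    (mul_eq_zero.1 hfst.symm).resolve_right hc'.ne⟩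

theorem eq_of_motion_position_eq {m : ℕ} {w w' : stdSimplex ℝ (Fin 4)}
    (h : motion G ℓ F m (G.position ℓ ((turn G)^[m] F).1 w) =
      motion G ℓ F m (G.position ℓ ((turn G)^[m] F).1 w')) : w = w' :=
  hℓ.position_injective _ ((motion G ℓ F m).injective h)

variable [Fintype T] (hc : G.coneAngle ℓ (Corner.hinge G (corner F)) = 2 * Real.pi)
  (hF : (turn G)^[order G F] F = F)
include hc hF

omit hℓ [Fintype T] hc in
theorem iterate_mod_order (m : ℕ) : (turn G)^[m % order G F] F = (turn G)^[m] F :=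
  (show Function.IsPeriodicPt (turn G) (order G F) F from hF).iterate_mod_apply m

theorem motion_eq_of_mod_eq {m m' : ℕ} (h : m % order G F = m' % order G F) :
    motion G ℓ F m = motion G ℓ F m' := by
  obtain ⟨j, hj⟩ := exists_angleSum_eq hc h
  refine motion_eq F hℓ ?_ hj
  rw [← iterate_mod_order hF, h, iterate_mod_order hF]

/-- Within one circuit two sectors overlap only on the axis or in the half-plane between consecutive
ones, where the gluing identifies the points anyway. -/
theorem point_eq_of_motion_position_eq {m d : ℕ} (hd : d < order G F) {w w' : stdSimplex ℝ (Fin 4)}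
    (h : motion G ℓ F m (G.position ℓ ((turn G)^[m] F).1 w) =
      motion G ℓ F (m + d) (G.position ℓ ((turn G)^[m + d] F).1 w')) :
    G.point ((turn G)^[m] F).1 w = G.point ((turn G)^[m + d] F).1 w' := by
  obtain ⟨r, φ, hr, h1, h2, hv⟩ := exists_eq_cylPoint
    (motion G ℓ F m (G.position ℓ ((turn G)^[m] F).1 w)) (angleSum G ℓ F m)
  generalize (motion G ℓ F m (G.position ℓ ((turn G)^[m] F).1 w)) 2 = z at hv
  have hv' := h.symm.trans hv
  rcases hr.eq_or_lt with rfl | hr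
  · obtain ⟨h3, h4⟩ := eq_zero_of_motion_eq_axis hℓ hv
    obtain ⟨w'', -, -, h5, h6⟩ := exists_motion_add_position F hℓ m d h3 h4
    rw [← h5, eq_of_motion_position_eq hℓ (h6.trans h)]
  obtain ⟨h3, h4⟩ := le_angleSum_succ hℓ hr h2 hv
  have hmono := strictMono_angleSum F hℓ
  have hle : angleSum G ℓ F (m + d + 1) ≤ angleSum G ℓ F m + 2 * Real.pi := by
    rw [← angleSum_add_order hc]
    exact hmono.monotone (by omega)
  have hstep : ∀ m w, w (((turn G)^[m] F).2 0) = 0 → ∀ w',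
      motion G ℓ F m (G.position ℓ ((turn G)^[m] F).1 w) =
        motion G ℓ F (m + 1) (G.position ℓ ((turn G)^[m + 1] F).1 w') →
      G.point ((turn G)^[m] F).1 w = G.point ((turn G)^[m + 1] F).1 w' := by
    intro m w hw w' h
    obtain ⟨h5, h6⟩ := motion_succ_position F hℓ m hw
    rw [← h5, eq_of_motion_position_eq hℓ (h6.trans h)]
  rcases Nat.eq_zero_or_pos d with rfl | hd0
  · rw [add_zero] at h ⊢
    rw [eq_of_motion_position_eq hℓ h]
  rcases le_or_gt (angleSum G ℓ F (m + d)) φ with h5 | h5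
  -- The angle belongs to the end of sector `m` and the beginning of sector `m + d`, so these are
  -- consecutive.
  · have h6 : angleSum G ℓ F (m + 1) ≤ angleSum G ℓ F (m + d) := hmono.monotone (by omega)
    have h7 : m + 1 = m + d := hmono.injective (le_antisymm h6 (h5.trans h3))
    obtain rfl : 1 = d := by omega
    exact hstep m w (h4 (le_antisymm h3 h5)) w' h
  -- Otherwise sector `m + d` sees the point one turn later, at its very end; then it is the last
  -- sector of the circuit and is followed by sector `m`.
  · rw [← cylPoint_add_two_pi_mul r φ z 1, Int.cast_one, one_mul] at hv'
    have h7 := hmono.monotone (Nat.le_succ (m + d))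
    obtain ⟨h8, h9⟩ := le_angleSum_succ hℓ hr (by linarith) hv'
    have h10 : φ + 2 * Real.pi = angleSum G ℓ F (m + d + 1) := by linarith
    have h11 : m + d + 1 = m + order G F := hmono.injective (by
      rw [angleSum_add_order hc]; linarith)
    have h12 : (m + d + 1) % order G F = m % order G F := by rw [h11, Nat.add_mod_right]
    have h13 : (turn G)^[m + d + 1] F = (turn G)^[m] F := by
      rw [← iterate_mod_order hF, h12, iterate_mod_order hF]
    rw [← h13]
    refine (hstep (m + d) w' (h9 h10) w ?_).symm
    rw [h13, motion_eq_of_mod_eq hℓ hc hF h12, h]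

theorem point_eq_of_motion_position_eq' {m m' : ℕ} {w w' : stdSimplex ℝ (Fin 4)}
    (h : motion G ℓ F m (G.position ℓ ((turn G)^[m] F).1 w) =
      motion G ℓ F m' (G.position ℓ ((turn G)^[m'] F).1 w')) :
    G.point ((turn G)^[m] F).1 w = G.point ((turn G)^[m'] F).1 w' := by
  wlog hm : m ≤ m' generalizing m m' w w'
  · exact (this h.symm (by omega)).symm
  have h1 : (m + (m' - m) % order G F) % order G F = m' % order G F := by
    rw [Nat.add_mod_mod]
    congr 1
    omega
  have h2 : (turn G)^[m'] F = (turn G)^[m + (m' - m) % order G F] F := by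
    rw [← iterate_mod_order hF, ← h1, iterate_mod_order hF]
  rw [h2] at h ⊢
  rw [← motion_eq_of_mod_eq hℓ hc hF h1] at h
  exact point_eq_of_motion_position_eq hℓ hc hF (Nat.mod_lt _ (order_pos G F)) h

variable {u : stdSimplex ℝ (Fin 4)} (hu : u (F.2 0) = 0 ∧ u (F.2 1) = 0)
  (hu' : u (F.2 2) ≠ 0 ∧ u (F.2 3) ≠ 0)
include hu hu'

-- The sectors of one circuit exhaust the angles from 0 to 2π, and near `u` only the two facets
-- through the edge bound each simplex.
omit hF in
theorem eventually_exists_motion_position_eq :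
    ∀ᶠ v in 𝓝 (motion G ℓ F 0 (G.position ℓ F.1 u)), ∃ m w,
      motion G ℓ F m (G.position ℓ ((turn G)^[m] F).1 w) = v := by
  have hpos : ∀ m, motion G ℓ F m (G.position ℓ ((turn G)^[m] F).1 (carry G F u m)) =
      motion G ℓ F 0 (G.position ℓ F.1 u) := by
    intro m
    induction m with
    | zero => rw [carry_zero]; rfl
    | succ m ih =>
      rw [carry_succ hu, (motion_succ_position F hℓ m ((carry_apply G F u m 0).trans hu.1)).2, ih]
  have h1 : ∀ m ∈ Set.Iio (order G F), ∀ᶠ v in 𝓝 (motion G ℓ F 0 (G.position ℓ F.1 u)),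
      (∀ i, carry G F u m i = 0 →
        0 ≤ (simplexBasis (hℓ.affineIndependent ((turn G)^[m] F).1)).coord i
          ((motion G ℓ F m).symm v)) →
      ∃ w, G.position ℓ ((turn G)^[m] F).1 w = (motion G ℓ F m).symm v := by
    intro m _
    have h2 : Filter.Tendsto (motion G ℓ F m).symm (𝓝 (motion G ℓ F 0 (G.position ℓ F.1 u)))
        (𝓝 (G.position ℓ ((turn G)^[m] F).1 (carry G F u m))) := by
      have := (motion G ℓ F m).symm.continuous.tendsto
        (motion G ℓ F m (G.position ℓ ((turn G)^[m] F).1 (carry G F u m)))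
      rwa [AffineIsometryEquiv.symm_apply_apply, hpos] at this
    exact h2.eventually (hℓ.eventually_exists_position_eq _ _)
  filter_upwards [(Set.finite_Iio (order G F)).eventually_all.2 h1] with v hv
  obtain ⟨r, φ, hr, h0, h2π, hvφ⟩ := exists_eq_cylPoint v 0
  have hk := angleSum_add_order hc 0
  rw [zero_add, angleSum_zero] at hk
  -- The sector containing `φ` is the one just before the first angle sum that exceeds `φ`.
  have hex : ∃ m, φ < angleSum G ℓ F m := ⟨order G F, by rw [hk]; exact h2π⟩
  obtain ⟨m, hm⟩ : ∃ m, m + 1 = Nat.find hex := by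
    refine ⟨Nat.find hex - 1, Nat.sub_add_cancel (Nat.pos_of_ne_zero fun h => ?_)⟩
    have := Nat.find_spec hex
    rw [h, angleSum_zero] at this
    linarith
  have h3 : φ < angleSum G ℓ F (m + 1) := by rw [hm]; exact Nat.find_spec hex
  have h4 : angleSum G ℓ F m ≤ φ := not_lt.1 (Nat.find_min hex (by omega))
  have h5 : m < order G F := (strictMono_angleSum F hℓ).lt_iff_lt.1 (by linarith)
  have hax := isAxial_motion F hℓ m
  have hlt := angleSum_lt_succ F hℓ m
  have hlt' := angleSum_succ_lt F hℓ m
  obtain ⟨w, hw⟩ := hv m h5 fun i hi => by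
    rcases eq_or_eq_of_carry_eq_zero hu' hi with rfl | rfl
    · obtain ⟨c, hc, hsnd⟩ := hax.exists_halfPlaneForm_snd (hℓ.affineIndependent _) hlt hlt'
      have h6 := hsnd ((motion G ℓ F m).symm v)
      rw [AffineIsometryEquiv.apply_symm_apply, hvφ, halfPlaneForm_cylPoint, ← hvφ] at h6
      refine nonneg_of_mul_nonneg_left ?_ hc
      rw [← h6]
      exact mul_nonneg hr (Real.sin_nonneg_of_nonneg_of_le_pi (by linarith) (by linarith))
    · obtain ⟨c, hc, hfst⟩ := hax.exists_halfPlaneForm_fst (hℓ.affineIndependent _) hlt hlt'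
      have h6 := hfst ((motion G ℓ F m).symm v)
      rw [AffineIsometryEquiv.apply_symm_apply, hvφ, halfPlaneForm_cylPoint, ← hvφ] at h6
      have h7 : r * Real.sin (angleSum G ℓ F m - φ) ≤ 0 := mul_nonpos_of_nonneg_of_nonpos hr
        (Real.sin_nonpos_of_nonpos_of_neg_pi_le (by linarith) (by linarith))
      rw [h6] at h7
      exact nonneg_of_mul_nonpos_left h7 hc
  exact ⟨m, w, by rw [hw, AffineIsometryEquiv.apply_symm_apply]⟩

/-- The glued space is flat near the interior points of an edge with cone angle `2π`. -/
theorem isLocallyFlatAt_edge [T2Space G.Space] : G.IsLocallyFlatAt ℓ (G.point F.1 u) := by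
  obtain ⟨g, hg, hgm⟩ := exists_isCompatible hu hu' hℓ hc fun m m' ht h =>
    iterate_eq_of_carry_eq_of_iterate_order hu hu' hF ht h
  have hg0 : g F.1 u = motion G ℓ F 0 := by
    rw [← hgm 0, carry_zero]; rfl
  refine hg.isLocallyFlatAt hℓ (by norm_num) ?_ ?_
  · rw [hg0]
    filter_upwards [eventually_exists_motion_position_eq hℓ hc hu hu'] with v hv
    obtain ⟨m, w, hw⟩ := hv
    exact ⟨_, carry G F u m, w, point_carry hu m, by rw [hgm, hw]⟩
  · refine .of_forall fun v t v1 w t' v1' w' h h' hw hw' => ?_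
    obtain ⟨m, rfl, rfl⟩ := exists_eq_carry hu hu' h
    obtain ⟨m', rfl, rfl⟩ := exists_eq_carry hu hu' h'
    rw [hgm] at hw hw'
    exact point_eq_of_motion_position_eq' hℓ hc hF (hw.trans hw'.symm)

end Frame

end FacetGluing

/-! ### Flatness of three-manifolds without curvature -/

namespace FacetGluing

theorem exists_perm_apply_eq {N : ℕ} {i j : Fin (N + 2)} (h : i ≠ j) :
    ∃ β : Equiv.Perm (Fin (N + 2)), β 0 = i ∧ β 1 = j := by
  refine ⟨Equiv.swap 0 i * Equiv.swap 1 (Equiv.swap 0 i j), ?_, ?_⟩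
  · have h1 : (0 : Fin (N + 2)) ≠ Equiv.swap 0 i j := by
      intro h1
      have h2 := congrArg (Equiv.swap 0 i) h1
      rw [Equiv.swap_apply_left, Equiv.swap_apply_self] at h2
      exact h h2
    rw [Equiv.Perm.mul_apply, Equiv.swap_apply_of_ne_of_ne (a := 1) (by simp) h1,
      Equiv.swap_apply_left]
  · rw [Equiv.Perm.mul_apply, Equiv.swap_apply_left, Equiv.swap_apply_self]

/-- A point of a tetrahedron is an interior point, an interior point of a facet or of an edge, or a
vertex. -/
theorem tetrahedron_point_cases (u : stdSimplex ℝ (Fin 4)) :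
    (∀ i, u i ≠ 0) ∨ (∃ i, u i = 0 ∧ ∀ j, j ≠ i → u j ≠ 0) ∨
    (∃ β : Equiv.Perm (Fin 4), (u (β 0) = 0 ∧ u (β 1) = 0) ∧ (u (β 2) ≠ 0 ∧ u (β 3) ≠ 0) ∧
      u (β 2) + u (β 3) = 1) ∨
    ∀ i, u i = 0 ∨ u i = 1 := by
  by_cases h0 : ∃ i, u i = 0
  swap
  · exact .inl fun i hi => h0 ⟨i, hi⟩
  obtain ⟨i, hi⟩ := h0
  by_cases h1 : ∃ j, j ≠ i ∧ u j = 0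
  swap
  · exact .inr (.inl ⟨i, hi, fun j hj hj' => h1 ⟨j, hj, hj'⟩⟩)
  obtain ⟨j, hij, hj⟩ := h1
  obtain ⟨β, rfl, rfl⟩ := exists_perm_apply_eq hij.symm
  have hsum : u (β 2) + u (β 3) = 1 := by
    have := u.2.2
    rw [← Equiv.sum_comp β, Fin.sum_univ_four] at this
    change u (β 0) + u (β 1) + u (β 2) + u (β 3) = 1 at this
    rwa [hi, hj, zero_add, zero_add] at this
  by_cases h2 : u (β 2) ≠ 0 ∧ u (β 3) ≠ 0
  · exact .inr (.inr (.inl ⟨β, ⟨hi, hj⟩, h2, hsum⟩))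
  refine .inr (.inr (.inr fun a => ?_))
  obtain ⟨a, rfl⟩ := β.surjective a
  rw [not_and_or, not_not, not_not] at h2
  fin_cases a
  · exact .inl hi
  · exact .inl hj
  · rcases h2 with h2 | h2
    · exact .inl h2
    · exact .inr (by rw [h2, add_zero] at hsum; exact hsum)
  · rcases h2 with h2 | h2
    · exact .inr (by rw [h2, zero_add] at hsum; exact hsum)
    · exact .inl h2

variable {T : Type*} {G : FacetGluing T 3} {ℓ : G.Edge → ℝ}

/-- The vertices and the midpoints of the edges. -/
def specialPoints (G : FacetGluing T 3) : Set G.Space :=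
  {y | ∃ t u, G.point t u = y ∧ ∀ i, u i = 0 ∨ u i = 1 / 2 ∨ u i = 1}

theorem finite_specialPoints [Finite T] : (specialPoints G).Finite := by
  have h1 : {u : stdSimplex ℝ (Fin 4) | ∀ i, u i = 0 ∨ u i = 1 / 2 ∨ u i = 1}.Finite := by
    have h2 : {f : Fin 4 → ℝ | ∀ i, f i ∈ ({0, 1 / 2, 1} : Set ℝ)}.Finite :=
      Set.Finite.pi' fun _ => Set.toFinite _
    exact (h2.preimage Subtype.val_injective.injOn).subset fun u hu i => hu i
  refine ((Set.finite_univ (α := T)).image2 G.point h1).subset ?_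
  rintro _ ⟨t, u, rfl, hu⟩
  exact ⟨t, trivial, u, hu, rfl⟩

theorem eventually_notMem_specialPoints [Finite T] [T2Space G.Space] (x : G.Space) :
    ∀ᶠ y in 𝓝[≠] x, y ∉ specialPoints G := by
  have h1 := ((finite_specialPoints (G := G)).subset
    (Set.sdiff_subset : specialPoints G \ {x} ⊆ _)).isClosed
  filter_upwards [nhdsWithin_le_nhds (h1.isOpen_compl.mem_nhds fun h => h.2 rfl),
    self_mem_nhdsWithin] with y hy hne hmem
  exact hy ⟨hmem, hne⟩

/-- Only a development is claimed, not a chart: along a possibly reversed edge, a point other than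
the midpoint returns after one reversed circuit as a different representative, so no contradiction
with compatibility arises. -/
theorem IsPolyhedralMetric.exists_development [Fintype T] [T2Space G.Space]
    (hℓ : G.IsPolyhedralMetric ℓ) (hc : ∀ Q, G.coneAngle ℓ Q = 2 * Real.pi) {y : G.Space}
    (hy : y ∉ specialPoints G) : ∃ W γ, y ∈ W ∧ G.IsDevelopment (G.transition ℓ) W γ := by
  obtain ⟨t, u, rfl⟩ := exists_point_eq y
  rcases tetrahedron_point_cases u with h | ⟨i, hi, h⟩ | ⟨β, hβ, hβ', hsum⟩ | h
  · obtain ⟨φ, hφ, γ, hγ, -⟩ := hℓ.isLocallyFlatAt_interior (by norm_num) t h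
    exact ⟨_, γ, hφ, hγ⟩
  · obtain ⟨φ, hφ, γ, hγ, -⟩ := hℓ.isLocallyFlatAt_facet (by norm_num) t hi h
    exact ⟨_, γ, hφ, hγ⟩
  · have hne : u (β 2) ≠ u (β 3) := by
      intro h
      refine hy ⟨t, u, rfl, fun a => ?_⟩
      obtain ⟨a, rfl⟩ := β.surjective a
      fin_cases a
      · exact .inl hβ.1
      · exact .inl hβ.2
      · exact .inr (.inl (by change u (β 2) = 1 / 2; linarith))
      · exact .inr (.inl (by change u (β 3) = 1 / 2; linarith))
    obtain ⟨g, hg, -⟩ := Frame.exists_isCompatible (F := (t, β)) hβ hβ' hℓ (hc _)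
      fun m m' ht h => Frame.iterate_eq_of_carry_eq hβ hβ' hne ht h
    obtain ⟨W, γ, hW, hγ, -⟩ := hg.exists_isDevelopment
    exact ⟨W, γ, hW, hγ⟩
  · exact absurd ⟨t, u, rfl, fun i => (h i).imp id .inr⟩ hy

/-- In a manifold, an edge with cone angle `2π` is not glued to itself with the reversed
orientation. -/
theorem IsPolyhedralMetric.iterate_order_eq [Fintype T] [T2Space G.Space]
    (hℓ : G.IsPolyhedralMetric ℓ) (hc : ∀ Q, G.coneAngle ℓ Q = 2 * Real.pi)
    (hG : G.IsTopManifold) (F : Frame T) : (Frame.turn G)^[Frame.order G F] F = F := by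
  -- The midpoint, where reversal of the edge preserves the coordinates. It is an isolated special
  -- point, so a development over it comes from its punctured neighbourhood.
  set u₀ : stdSimplex ℝ (Fin 4) := ⟨![0, 0, 1 / 2, 1 / 2], by
    intro i
    fin_cases i <;> norm_num, by
    rw [Fin.sum_univ_four]
    change (0 : ℝ) + 0 + 1 / 2 + 1 / 2 = 1
    norm_num⟩
  set u := stdSimplex.map F.2 u₀
  have hu : ∀ a, u (F.2 a) = u₀ a := stdSimplex.map_perm_apply F.2 u₀
  obtain ⟨φ, hφ⟩ := hG.2.2 (G.point F.1 u)
  refine Frame.iterate_order_eq (u := u) ⟨hu 0, hu 1⟩ hℓ ((hu 2).trans (hu 3).symm) ?_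
  refine exists_development_of_punctured le_rfl φ hφ (fun t v hv => ?_) ?_
  · exact exists_zero_of_point_eq hv.symm ⟨_, hu 0⟩
  · filter_upwards [eventually_notMem_specialPoints (G.point F.1 u)] with y hy
    exact hℓ.exists_development hc hy

/-- Points that are not vertices have explicit charts once reversed edges are excluded; the finitely
many vertices are then isolated points with flat punctured neighbourhoods. -/
theorem IsPolyhedralMetric.isLocallyFlatAt [Fintype T] [T2Space G.Space]
    (hℓ : G.IsPolyhedralMetric ℓ) (hc : ∀ Q, G.coneAngle ℓ Q = 2 * Real.pi)
    (hG : G.IsTopManifold) (x : G.Space) : G.IsLocallyFlatAt ℓ x := by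
  have key : ∀ t u, (¬ ∀ i, u i = 0 ∨ u i = 1) → G.IsLocallyFlatAt ℓ (G.point t u) := by
    intro t u hu
    rcases tetrahedron_point_cases u with h | ⟨i, hi, h⟩ | ⟨β, hβ, hβ', -⟩ | h
    · exact hℓ.isLocallyFlatAt_interior (by norm_num) t h
    · exact hℓ.isLocallyFlatAt_facet (by norm_num) t hi h
    · exact Frame.isLocallyFlatAt_edge (F := (t, β)) hℓ (hc _) (hℓ.iterate_order_eq hc hG _) hβ hβ'
    · exact absurd h hu
  obtain ⟨t, u, rfl⟩ := exists_point_eq x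
  by_cases hu : ∀ i, u i = 0 ∨ u i = 1
  swap
  · exact key t u hu
  obtain ⟨φ, hφ⟩ := hG.2.2 (G.point t u)
  refine isLocallyFlatAt_of_punctured le_rfl hℓ φ hφ (fun t' v hv => ?_) ?_
  · refine exists_zero_of_point_eq hv.symm ?_
    by_contra! h
    have h1 : ∑ i, u i = 1 := u.2.2
    rw [Finset.sum_congr rfl fun i _ => (hu i).resolve_left (h i)] at h1
    norm_num at h1
  · filter_upwards [eventually_notMem_specialPoints (G.point t u)] with y hy
    obtain ⟨t', v, rfl⟩ := exists_point_eq y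
    exact key t' v fun hv => hy ⟨t', v, rfl, fun i => (hv i).imp id .inr⟩

theorem isFlat_of_curvature_eq_zero [Fintype T] (hG : G.IsTopManifold)
    (hℓ : G.IsPolyhedralMetric ℓ) (h : ∀ e, G.curvature ℓ e = 0) : G.IsFlat ℓ := by
  have := hG.1
  intro x
  exact (hℓ.isLocallyFlatAt (fun Q => (sub_eq_zero.1 (h Q)).symm) hG x).exists_ball hℓ
    (by norm_num)

end FacetGluing

theorem mainTheorem7 {T : Type*} [Fintype T] {n : ℕ} (hn : 2 ≤ n) (G : FacetGluing T n)
    (hG : G.IsTopManifold) (a : ℝ) (ha : a ≠ 0) (ℓ : G.Edge → ℝ) (hℓ : G.IsPolyhedralMetric ℓ) :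
    (∀ᶠ ℓ' in 𝓝 ℓ, G.IsPolyhedralMetric ℓ') ∧
    (∀ Q : G.Hinge, DifferentiableAt ℝ (fun ℓ' => G.vol ℓ' Q) ℓ) ∧
    HasFDerivAt (G.totalScalarCurvature a)
      (a • ∑ Q : G.Hinge, G.curvature ℓ Q • fderiv ℝ (fun ℓ' => G.vol ℓ' Q) ℓ) ℓ ∧
    (G.IsCriticalMetric a ℓ ↔ ∀ e : G.Edge,
      ∑ Q : G.Hinge, G.curvature ℓ Q *
        fderiv ℝ (fun ℓ' => G.vol ℓ' Q) ℓ (Pi.single e 1) = 0) ∧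
    (n = 3 → G.IsCriticalMetric a ℓ → G.IsFlat ℓ) := by
  refine ⟨FacetGluing.eventually_isPolyhedralMetric hℓ, hℓ.differentiableAt_vol hn,
    hℓ.hasFDerivAt_totalScalarCurvature hn a, hℓ.isCriticalMetric_iff hn ha, ?_⟩
  rintro rfl hc
  exact FacetGluing.isFlat_of_curvature_eq_zero hG hℓ fun e => hℓ.curvature_eq_zero ha hc e
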